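/- Let $N$ be a connected, oriented, real-analytic $3$-manifold, $h$ a real-analytic Riemannian metric on $N$, and $A$ a smooth, nowhere vanishing $1$-form on $N$ satisfying the Beltrami fields equation $\mathrm{d}A+2{*}A=0$, where $*$ is the Hodge star of $(N,h)$. Let $(M,g)$ be given by the Beltrami fields construction: $M=N\times(0,\infty)$, with projection $\varphi:M\to N$ and coordinate $\rho$ on $(0,\infty)$, and $$g=\rho^2h+\rho^{-2}(\rho\,\mathrm{d}\rho+A)^2 .$$ Let $E$ be a real-analytic soliton flow on $(M,g)$, that is, a real-analytic vector field on $M$ such that $\mathrm{Ric}_g+a\,g+\tfrac12\mathcal L_Eg=0$ for some constant $a\in\mathbb R$. Let $N^{\mathbb C}$ be a complexification of $N$ (a complex $3$-manifold in which $N$ is real-analytically embedded with $TN^{\mathbb C}|_N=TN\oplus \mathrm{i}\,TN$). Let $U\subseteq N$ be open and non-empty and let $\gamma=\{\rho\in\mathbb C:|\rho|=r\}$, $r>0$. Suppose that $E$ admits a complexification $E^{\mathbb C}$ (a holomorphic vector field which coincides with $E$ at the points of $M$ in its domain) on an open set of $N^{\mathbb C}\times\mathbb C$ which contains $U\times\gamma$.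 Let $U^{\mathbb C}\subseteq N^{\mathbb C}$ be any open neighbourhood of $U$, each of whose connected components meets $U$, such that $U^{\mathbb C}\times\gamma$ is contained in the domain of $E^{\mathbb C}$ and $h$ extends to a holomorphic (symmetric, nondegenerate) metric $h^{\mathbb C}$ on $U^{\mathbb C}$. Denote by $(\mathcal L_Eh)^{\mathbb C}$ the Lie derivative, with respect to $E^{\mathbb C}$, of the pull-back of $h^{\mathbb C}$ by the projection $(p,\rho)\mapsto p$, restricted to the slices $\rho=\text{constant}$; thus, for each $p\in U^{\mathbb C}$ and each $k\in\mathbb N$, $\int_\gamma\rho^k(\mathcal L_Eh)^{\mathbb C}\,\mathrm{d}\rho$ is a bilinear form on $T_pN^{\mathbb C}$. Then the following assertions are equivalent: (i) $(M,g)$ is Einstein; (ii) $\int_\gamma\rho\,(\mathcal L_Eh)^{\mathbb C}\,\mathrm{d}\rho=0$ on $U^{\mathbb C}$. Furthermore, if there exists an integer $j\ge1$ such that the trace-free part, with respect to $h^{\mathbb C}$, of $\int_\gamma\rho^{2j+1}(\mathcal L_Eh)^{\mathbb C}\,\mathrm{d}\rho$ is zero on $U^{\mathbb C}$, then (i) and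 (ii) hold. -/

import Mathlib

open Set Filter Topology Bundle
open scoped Manifold ContDiff

noncomputable section

namespace BeltramiSoliton

/-! ### Fields of bilinear forms, pull-backs and Lie derivatives -/

section Tensors

variable {𝕜 : Type*} [NontriviallyNormedField 𝕜]
  {E : Type*} [NormedAddCommGroup E] [NormedSpace 𝕜 E]
  {H : Type*} [TopologicalSpace H] (I : ModelWithCorners 𝕜 E H)
  {E' : Type*} [NormedAddCommGroup E'] [NormedSpace 𝕜 E']
  {H' : Type*} [TopologicalSpace H'] (I' : ModelWithCorners 𝕜 E' H')
  (M : Type*) [TopologicalSpace M] [ChartedSpace H M]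
  (M' : Type*) [TopologicalSpace M'] [ChartedSpace H' M']

/-- Vector fields (no regularity is built in). -/
abbrev VField := ∀ x : M, TangentSpace I x

/-- Fields of linear forms on the tangent spaces (no regularity is built in). -/
abbrev OneForm := ∀ x : M, TangentSpace I x →L[𝕜] 𝕜

/-- Fields of bilinear forms on the tangent spaces (no regularity is built in). -/
abbrev BilinField := ∀ x : M, TangentSpace I x →L[𝕜] TangentSpace I x →L[𝕜] 𝕜

variable {M M'}

/-- The bilinear form `(u, v) ↦ B (D u) (D v)`. -/
def pullBilin {V W : Type*} [AddCommGroup V] [Module 𝕜 V] [TopologicalSpace V]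
    [AddCommGroup W] [Module 𝕜 W] [TopologicalSpace W] [IsTopologicalAddGroup V]
    [IsTopologicalAddGroup W] [ContinuousConstSMul 𝕜 V] [ContinuousConstSMul 𝕜 W]
    (D : V →L[𝕜] W) (B : W →L[𝕜] W →L[𝕜] 𝕜) : V →L[𝕜] V →L[𝕜] 𝕜 :=
  (ContinuousLinearMap.precomp 𝕜 D).comp (B.comp D)

/-- The pull-back `f^* T` of a field of bilinear forms under a map `f : M → M'`. -/
def pullback (f : M → M') (T : BilinField I' M') : BilinField I M :=
  fun x => pullBilin (mfderiv I I' f x) (T (f x))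

/-- The expression of a field of bilinear forms in the preferred chart at `x₀`. -/
def bilinInChart (T : BilinField I M) (x₀ : M) (y : E) : E →L[𝕜] E →L[𝕜] 𝕜 :=
  pullBilin (mfderivWithin 𝓘(𝕜, E) I (extChartAt I x₀).symm (range I) y)
    (T ((extChartAt I x₀).symm y))

/-- The expression of a one-form in the preferred chart at `x₀`. -/
def oneFormInChart (α : OneForm I M) (x₀ : M) (y : E) : E →L[𝕜] 𝕜 :=
  (α ((extChartAt I x₀).symm y)).comp
    (mfderivWithin 𝓘(𝕜, E) I (extChartAt I x₀).symm (range I) y)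

/-- The differential at `x₀` of the preferred chart at `x₀`. -/
def chartDifferential (x₀ : M) : TangentSpace I x₀ →L[𝕜] E :=
  mfderiv I 𝓘(𝕜, E) (extChartAt I x₀) x₀

/-- The expression of a vector field in the preferred chart at `x₀`. -/
def vfieldInChart (X : VField I M) (x₀ : M) (y : E) : E :=
  VectorField.mpullbackWithin 𝓘(𝕜, E) I (extChartAt I x₀).symm X (range I) y

/-- The Lie derivative in a vector space:
`(𝓛_X T)(u, v) = X(T(u, v)) + T(DX(u), v) + T(u, DX(v))` for constant `u`, `v`. -/
def lieDerivE (X : E → E) (T : E → E →L[𝕜] E →L[𝕜] 𝕜) (y : E) : E →L[𝕜] E →L[𝕜] 𝕜 :=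
  fderiv 𝕜 T y (X y) + (T y).bilinearComp (fderiv 𝕜 X y) (ContinuousLinearMap.id 𝕜 E)
    + (T y).bilinearComp (ContinuousLinearMap.id 𝕜 E) (fderiv 𝕜 X y)

/-- The Lie derivative `𝓛_X T` of a field of bilinear forms on a manifold, computed at each point
in the preferred chart. -/
def lieDeriv (X : VField I M) (T : BilinField I M) : BilinField I M :=
  fun x₀ => pullBilin (chartDifferential I x₀)
    (lieDerivE (vfieldInChart I X x₀) (bilinInChart I T x₀) (extChartAt I x₀ x₀))

/-- The exterior derivative `dα(u, v)` of a one-form on a manifold, computed at each point in the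
preferred chart, with the convention `dα(u, v) = u(α(v)) - v(α(u)) - α([u, v])`. -/
def extDerivOneForm (α : OneForm I M) (x₀ : M) (u v : TangentSpace I x₀) : 𝕜 :=
  fderiv 𝕜 (oneFormInChart I α x₀) (extChartAt I x₀ x₀) (chartDifferential I x₀ u)
      (chartDifferential I x₀ v)
    - fderiv 𝕜 (oneFormInChart I α x₀) (extChartAt I x₀ x₀) (chartDifferential I x₀ v)
      (chartDifferential I x₀ u)

/-- The trace of a bilinear form `B` with respect to a nondegenerate bilinear form `h`. -/
def traceWrt (h B : E →L[𝕜] E →L[𝕜] 𝕜) : 𝕜 :=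
  LinearMap.trace 𝕜 E (h.inverse.comp B : E →L[𝕜] E).toLinearMap

/-- The trace-free part `B - (tr_h B / n) h` of a bilinear form, `n` the dimension. -/
def traceFreePart (h B : E →L[𝕜] E →L[𝕜] 𝕜) : E →L[𝕜] E →L[𝕜] 𝕜 :=
  B - (traceWrt h B / (Module.finrank 𝕜 E : 𝕜)) • h

end Tensors

/-! ### Ricci tensor, Einstein metrics and Ricci solitons -/

section Riemannian

variable {E : Type*} [NormedAddCommGroup E] [NormedSpace ℝ E] [FiniteDimensional ℝ E]
  {H : Type*} [TopologicalSpace H] (I : ModelWithCorners ℝ E H)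
  {M : Type*} [TopologicalSpace M] [ChartedSpace H M]

/-- The linear form `w ↦ D_u G(v, w) + D_v G(u, w) - D_w G(u, v)` at `y`. -/
def koszulE (G : E → E →L[ℝ] E →L[ℝ] ℝ) (y u v : E) : E →L[ℝ] ℝ :=
  fderiv ℝ G y u v + fderiv ℝ G y v u - ((fderiv ℝ G y).flip u).flip v

/-- The Christoffel map of the Levi-Civita connection of `G`: `∇_u v = D_u v + Γ(u, v)`, where
`G(Γ(u, v), w) = ½ (D_u G(v, w) + D_v G(u, w) - D_w G(u, v))`. -/
def christoffelE (G : E → E →L[ℝ] E →L[ℝ] ℝ) (y u v : E) : E :=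
  (G y).inverse ((1 / 2 : ℝ) • koszulE G y u v)

/-- The curvature tensor
`R(u, v) w = (D_u Γ)(v, w) - (D_v Γ)(u, w) + Γ(u, Γ(v, w)) - Γ(v, Γ(u, w))`. -/
def curvatureE (G : E → E →L[ℝ] E →L[ℝ] ℝ) (y u v w : E) : E :=
  fderiv ℝ (fun z => christoffelE G z v w) y u - fderiv ℝ (fun z => christoffelE G z u w) y v
    + christoffelE G y u (christoffelE G y v w) - christoffelE G y v (christoffelE G y u w)

/-- The Ricci tensor `Ric(v, w) = tr (u ↦ R(u, v) w)` in a finite-dimensional vector space, the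
trace being computed in a basis. -/
def ricciE (G : E → E →L[ℝ] E →L[ℝ] ℝ) (y v w : E) : ℝ :=
  ∑ i, (Module.finBasis ℝ E).coord i (curvatureE G y (Module.finBasis ℝ E i) v w)

/-- The Ricci tensor of a metric on a manifold, computed at each point in the preferred chart. -/
def ricci (g : BilinField I M) (x₀ : M) (v w : TangentSpace I x₀) : ℝ :=
  ricciE (bilinInChart I g x₀) (extChartAt I x₀ x₀) (chartDifferential I x₀ v)
    (chartDifferential I x₀ w)

/-- The metric `g` is Einstein on the open set `s`. -/
def IsEinsteinOn (g : BilinField I M) (s : Set M) : Prop :=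
  ∃ c : ℝ, ∀ x ∈ s, ∀ v w : TangentSpace I x, ricci I g x v w = c * g x v w

/-- `X` is a soliton flow for `g` on the open set `s`: `Ric + a g + ½ 𝓛_X g = 0` on `s`
for some constant `a`. -/
def IsSolitonFlowOn (g : BilinField I M) (X : VField I M) (s : Set M) : Prop :=
  ∃ a : ℝ, ∀ x ∈ s, ∀ v w : TangentSpace I x,
    ricci I g x v w + a * g x v w + 1 / 2 * lieDeriv I X g x v w = 0

end Riemannian

/-! ### The Beltrami fields construction -/

/-- The model space of real three-dimensional manifolds. -/
abbrev R3 := EuclideanSpace ℝ (Fin 3)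

/-- The model space of complex three-dimensional manifolds. -/
abbrev C3 := EuclideanSpace ℂ (Fin 3)

/-- Real-analytic Riemannian metrics on a three-manifold. -/
abbrev AnalyticMetric (N : Type*) [TopologicalSpace N] [ChartedSpace R3 N]
    [IsManifold (𝓡 3) ω N] :=
  ContMDiffRiemannianMetric (𝓡 3) ω R3 (fun x : N => TangentSpace (𝓡 3) x)

/-- An orientation of a three-manifold: an orientation of each tangent space, locally constant in
the trivialisations of the tangent bundle given by charts. -/
structure ManifoldOrientation (N : Type*) [TopologicalSpace N] [ChartedSpace R3 N]
    [IsManifold (𝓡 3) ω N] where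
  /-- the orientation of the tangent space at a point -/
  at_point : ∀ x : N, Orientation ℝ (TangentSpace (𝓡 3) x) (Fin 3)
  locally_constant : ∀ x₀ : N, ∃ o₀ : Orientation ℝ R3 (Fin 3), ∀ᶠ y in 𝓝 x₀,
    ∀ hy : y ∈ (trivializationAt R3 (TangentSpace (𝓡 3)) x₀).baseSet,
      Orientation.map (Fin 3) ((trivializationAt R3 (TangentSpace (𝓡 3)) x₀).continuousLinearEquivAt
        ℝ y hy).toLinearEquiv (at_point y) = o₀

section Construction

variable {N : Type*} [TopologicalSpace N] [ChartedSpace R3 N] [IsManifold (𝓡 3) ω N]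

/-- A positively oriented basis of a tangent space. -/
def positiveBasis (o : ManifoldOrientation N) (x : N) :
    Module.Basis (Fin 3) ℝ (TangentSpace (𝓡 3) x) :=
  haveI : FiniteDimensional ℝ (TangentSpace (𝓡 3) x) := inferInstanceAs (FiniteDimensional ℝ R3)
  (o.at_point x).someBasis
    (show Fintype.card (Fin 3) = Module.finrank ℝ R3 by simp)

/-- The Riemannian volume form: its value on a positive basis is the square root of the Gram
determinant. -/
def volumeForm (h : AnalyticMetric N) (o : ManifoldOrientation N) (x : N) :
    TangentSpace (𝓡 3) x [⋀^Fin 3]→ₗ[ℝ] ℝ :=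
  Real.sqrt (Matrix.det (Matrix.of fun i j : Fin 3 =>
    h.inner x (positiveBasis o x i) (positiveBasis o x j))) • (positiveBasis o x).det

/-- The vector `α^♯` dual to a linear form `α` on a tangent space. -/
def sharp (h : AnalyticMetric N) (x : N) (α : TangentSpace (𝓡 3) x →L[ℝ] ℝ) :
    TangentSpace (𝓡 3) x :=
  (h.inner x).inverse α

/-- The Hodge star of a one-form: `(*α)(u, v) = vol(α^♯, u, v)`. -/
def hodgeStar (h : AnalyticMetric N) (o : ManifoldOrientation N) (α : OneForm (𝓡 3) N)
    (x : N) (u v : TangentSpace (𝓡 3) x) : ℝ :=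
  volumeForm h o x ![sharp h x (α x), u, v]

/-- The Beltrami fields equation `dA + 2 * A = 0` for a smooth one-form `A`. -/
structure IsBeltramiField (h : AnalyticMetric N) (o : ManifoldOrientation N)
    (A : OneForm (𝓡 3) N) : Prop where
  smooth : ContMDiff (𝓡 3) ((𝓡 3).prod 𝓘(ℝ, R3 →L[ℝ] ℝ)) ∞
    (fun x => TotalSpace.mk' (R3 →L[ℝ] ℝ)
      (E := fun x : N => TangentSpace (𝓡 3) x →L[ℝ] ℝ) x (A x))
  equation : ∀ (x : N) (u v : TangentSpace (𝓡 3) x),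
    extDerivOneForm (𝓡 3) A x u v + 2 * hodgeStar h o A x u v = 0

variable (N) in
/-- The total space `M = N × (0, ∞)`, as an open subset of the manifold `N × ℝ`. -/
def totalSpace : Set (N × ℝ) := univ ×ˢ Ioi 0

/-- The one-form `θ = ρ dρ + A` at the point `p = (x, ρ)`. -/
def theta (A : OneForm (𝓡 3) N) : OneForm ((𝓡 3).prod 𝓘(ℝ, ℝ)) (N × ℝ) :=
  fun p => p.2 • mvfderiv ((𝓡 3).prod 𝓘(ℝ, ℝ)) (fun q : N × ℝ => q.2) p
    + (A p.1).comp (mfderiv ((𝓡 3).prod 𝓘(ℝ, ℝ)) (𝓡 3) Prod.fst p)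

/-- The metric `g = ρ² h + ρ⁻² (ρ dρ + A)²` on `N × (0, ∞)`; values at points with `ρ ≤ 0` are
never used. -/
def beltramiMetric (h : AnalyticMetric N) (A : OneForm (𝓡 3) N) :
    BilinField ((𝓡 3).prod 𝓘(ℝ, ℝ)) (N × ℝ) :=
  fun p => p.2 ^ 2 • pullback ((𝓡 3).prod 𝓘(ℝ, ℝ)) (𝓡 3) Prod.fst h.inner p
    + (p.2 ^ 2)⁻¹ • (theta A p).smulRight (theta A p)

end Construction

/-! ### Complexifications -/

section Complexification

variable {N : Type*} [TopologicalSpace N] [ChartedSpace R3 N] [IsManifold (𝓡 3) ω N]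
  {NC : Type*} [TopologicalSpace NC] [ChartedSpace C3 NC] [IsManifold 𝓘(ℂ, C3) ω NC]

/-- The (real) differential of a map from a real manifold to a complex manifold. -/
def realDifferential (ι : N → NC) (x : N) (u : TangentSpace (𝓡 3) x) :
    TangentSpace 𝓘(ℂ, C3) (ι x) :=
  mfderiv (𝓡 3) 𝓘(ℝ, C3) ι x u

/-- A complexification of the real-analytic three-manifold `N`: a real-analytic embedding into a
complex three-manifold `NC`, whose image is totally real, that is,
`T NC = dι(T N) ⊕ i dι(T N)` along `ι(N)`. -/
structure IsComplexification (ι : N → NC) : Prop where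
  analytic : ContMDiff (𝓡 3) 𝓘(ℝ, C3) ω ι
  embedding : IsEmbedding ι
  totally_real : ∀ (x : N) (w : TangentSpace 𝓘(ℂ, C3) (ι x)),
    ∃! uv : TangentSpace (𝓡 3) x × TangentSpace (𝓡 3) x,
      w = realDifferential ι x uv.1 + Complex.I • realDifferential ι x uv.2

/-- The differential of the inclusion `(x, ρ) ↦ (ι x, ρ)` of `N × ℝ` in `NC × ℂ`. -/
def inclusionDifferential (ι : N → NC) (p : N × ℝ)
    (u : TangentSpace ((𝓡 3).prod 𝓘(ℝ, ℝ)) p) :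
    TangentSpace (𝓘(ℂ, C3).prod 𝓘(ℂ, ℂ)) (ι p.1, (p.2 : ℂ)) :=
  mfderiv ((𝓡 3).prod 𝓘(ℝ, ℝ)) (𝓘(ℝ, C3).prod 𝓘(ℝ, ℂ))
    (fun q : N × ℝ => (ι q.1, (q.2 : ℂ))) p u

/-- `XC` is a complexification, defined on the open subset `W` of `NC × ℂ`, of the vector field `X`
on `N × (0, ∞)`. -/
structure IsVFieldComplexification (ι : N → NC) (X : VField ((𝓡 3).prod 𝓘(ℝ, ℝ)) (N × ℝ))
    (W : Set (NC × ℂ)) (XC : VField (𝓘(ℂ, C3).prod 𝓘(ℂ, ℂ)) (NC × ℂ)) : Prop where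
  isOpen : IsOpen W
  holomorphic : ContMDiffOn (𝓘(ℂ, C3).prod 𝓘(ℂ, ℂ)) (𝓘(ℂ, C3).prod 𝓘(ℂ, ℂ)).tangent ω
    (fun p => (⟨p, XC p⟩ : TangentBundle (𝓘(ℂ, C3).prod 𝓘(ℂ, ℂ)) (NC × ℂ))) W
  extends_real : ∀ (x : N) (ρ : ℝ), 0 < ρ → (ι x, (ρ : ℂ)) ∈ W →
    XC (ι x, (ρ : ℂ)) = inclusionDifferential ι (x, ρ) (X (x, ρ))

/-- `hC` is a complexification, defined on the open subset `UC` of `NC`, of the metric `h`: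
a holomorphic Riemannian metric on `UC` which extends `h`. -/
structure IsMetricComplexification (ι : N → NC) (h : AnalyticMetric N) (UC : Set NC)
    (hC : BilinField 𝓘(ℂ, C3) NC) : Prop where
  holomorphic : ContMDiffOn 𝓘(ℂ, C3) (𝓘(ℂ, C3).prod 𝓘(ℂ, C3 →L[ℂ] C3 →L[ℂ] ℂ)) ω
    (fun p => TotalSpace.mk' (C3 →L[ℂ] C3 →L[ℂ] ℂ)
      (E := fun p : NC => TangentSpace 𝓘(ℂ, C3) p →L[ℂ] TangentSpace 𝓘(ℂ, C3) p →L[ℂ] ℂ)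
      p (hC p)) UC
  symm : ∀ p ∈ UC, ∀ u v : TangentSpace 𝓘(ℂ, C3) p, hC p u v = hC p v u
  nondegenerate : ∀ p ∈ UC, ∀ u : TangentSpace 𝓘(ℂ, C3) p, (∀ v, hC p u v = 0) → u = 0
  extends_real : ∀ x : N, ι x ∈ UC → ∀ u v : TangentSpace (𝓡 3) x,
    hC (ι x) (realDifferential ι x u) (realDifferential ι x v) = (h.inner x u v : ℂ)

/-- `UC` is a complexification of the open subset `U` of `N`: an open neighbourhood of `ι(U)`, each
of whose components meets `ι(U)`. -/
structure IsComplexNeighbourhood (ι : N → NC) (U : Set N) (UC : Set NC) : Prop where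
  isOpen : IsOpen UC
  image_subset : ι '' U ⊆ UC
  component_meets : ∀ p ∈ UC, (connectedComponentIn UC p ∩ ι '' U).Nonempty

/-- The complexified Lie derivative `(𝓛_X h)^ℂ = 𝓛_{XC} hC` at `(p, ρ)`, as a bilinear form on
`T_p NC`: the Lie derivative of the pull-back of `hC` by the projection `NC × ℂ → NC`, restricted to
the slice `NC × {ρ}`. -/
def lieSlice (hC : BilinField 𝓘(ℂ, C3) NC) (XC : VField (𝓘(ℂ, C3).prod 𝓘(ℂ, ℂ)) (NC × ℂ))
    (ρ : ℂ) : BilinField 𝓘(ℂ, C3) NC :=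
  pullback 𝓘(ℂ, C3) (𝓘(ℂ, C3).prod 𝓘(ℂ, ℂ)) (fun q : NC => (q, ρ))
    (lieDeriv (𝓘(ℂ, C3).prod 𝓘(ℂ, ℂ)) XC
      (pullback (𝓘(ℂ, C3).prod 𝓘(ℂ, ℂ)) 𝓘(ℂ, C3) Prod.fst hC))

/-- The contour integral `∫_γ ρ^k (𝓛_X h)^ℂ dρ` at `p`, with `γ` the circle `|ρ| = r`. -/
def contourForm (hC : BilinField 𝓘(ℂ, C3) NC)
    (XC : VField (𝓘(ℂ, C3).prod 𝓘(ℂ, ℂ)) (NC × ℂ)) (r : ℝ) (k : ℕ) (p : NC) :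
    C3 →L[ℂ] C3 →L[ℂ] ℂ :=
  ∮ ρ in C(0, r), ρ ^ k • (show C3 →L[ℂ] C3 →L[ℂ] ℂ from lieSlice hC XC ρ p)

end Complexification

end BeltramiSoliton

end

namespace BeltramiSoliton

set_option maxSynthPendingDepth 3
set_option autoImplicit false
set_option synthInstance.maxHeartbeats 200000
set_option linter.unusedSectionVars false


/-! ### Local Riemannian geometry in a vector space -/

section ApplyConst

variable {𝕜 : Type*} [NontriviallyNormedField 𝕜]
  {E : Type*} [NormedAddCommGroup E] [NormedSpace 𝕜 E]
  {V : Type*} [NormedAddCommGroup V] [NormedSpace 𝕜 V]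
  {W : Type*} [NormedAddCommGroup W] [NormedSpace 𝕜 W]
  {Z : Type*} [NormedAddCommGroup Z] [NormedSpace 𝕜 Z]

lemma hasFDerivAt_apply_const {c : E → V →L[𝕜] W} {c' : E →L[𝕜] V →L[𝕜] W} {y : E}
    (h : HasFDerivAt c c' y) (v : V) : HasFDerivAt (fun z => c z v) (c'.flip v) y := by
  simpa using h.clm_apply (hasFDerivAt_const v y)

lemma fderiv_apply_const {c : E → V →L[𝕜] W} {y : E} (h : DifferentiableAt 𝕜 c y) (v : V)
    (u : E) : fderiv 𝕜 (fun z => c z v) y u = fderiv 𝕜 c y u v := by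
  rw [(hasFDerivAt_apply_const h.hasFDerivAt v).fderiv]; rfl

lemma fderiv_apply_const₂ {c : E → V →L[𝕜] W →L[𝕜] Z} {y : E} (h : DifferentiableAt 𝕜 c y)
    (v : V) (w : W) (u : E) : fderiv 𝕜 (fun z => c z v w) y u = fderiv 𝕜 c y u v w := by
  have := hasFDerivAt_apply_const (hasFDerivAt_apply_const h.hasFDerivAt v) w
  rw [this.fderiv]; rfl

end ApplyConst

section LocalRicci

variable {E : Type*} [NormedAddCommGroup E] [NormedSpace ℝ E]

/-- The Koszul combination `D u v w + D v u w - D w u v` as a continuous linear map in `D`. -/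
noncomputable def koszulL : (E →L[ℝ] E →L[ℝ] E →L[ℝ] ℝ) →L[ℝ] (E →L[ℝ] E →L[ℝ] E →L[ℝ] ℝ) :=
  let fl : (E →L[ℝ] E →L[ℝ] E →L[ℝ] ℝ) →L[ℝ] (E →L[ℝ] E →L[ℝ] E →L[ℝ] ℝ) :=
    (ContinuousLinearMap.flipₗᵢ ℝ E E (E →L[ℝ] ℝ)).toContinuousLinearEquiv.toContinuousLinearMap
  let fl' : (E →L[ℝ] E →L[ℝ] ℝ) →L[ℝ] (E →L[ℝ] E →L[ℝ] ℝ) :=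
    (ContinuousLinearMap.flipₗᵢ ℝ E E ℝ).toContinuousLinearEquiv.toContinuousLinearMap
  ContinuousLinearMap.id ℝ _ + fl - (ContinuousLinearMap.compL ℝ E _ _ fl').comp fl

@[simp] lemma koszulL_apply (D : E →L[ℝ] E →L[ℝ] E →L[ℝ] ℝ) (u v w : E) :
    koszulL D u v w = D u v w + D v u w - D w u v := rfl

lemma koszulE_eq (G : E → E →L[ℝ] E →L[ℝ] ℝ) (y u v : E) :
    koszulE G y u v = koszulL (fderiv ℝ G y) u v := by
  ext w; simp [koszulE]

lemma koszulE_apply (G : E → E →L[ℝ] E →L[ℝ] ℝ) (y u v w : E) :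
    koszulE G y u v w = fderiv ℝ G y u v w + fderiv ℝ G y v u w - fderiv ℝ G y w u v := by
  simp [koszulE]

/-- The Christoffel map, as a continuous bilinear map. -/
noncomputable def christoffelL (G : E → E →L[ℝ] E →L[ℝ] ℝ) (y : E) : E →L[ℝ] E →L[ℝ] E :=
  (ContinuousLinearMap.compL ℝ E (E →L[ℝ] ℝ) E (G y).inverse).comp
    ((1 / 2 : ℝ) • koszulL (fderiv ℝ G y))

lemma christoffelL_apply (G : E → E →L[ℝ] E →L[ℝ] ℝ) (y u v : E) :
    christoffelL G y u v = christoffelE G y u v := by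
  simp [christoffelL, christoffelE, koszulE_eq]

lemma metric_christoffelL {G : E → E →L[ℝ] E →L[ℝ] ℝ} {y : E} (hG : (G y).IsInvertible)
    (u v w : E) : G y (christoffelL G y u v) w = 1 / 2 * koszulE G y u v w := by
  rw [christoffelL_apply, christoffelE, hG.self_apply_inverse]
  simp

lemma eventually_isInvertible [CompleteSpace E] {F : Type*} [NormedAddCommGroup F]
    [NormedSpace ℝ F] {G : F → E →L[ℝ] E →L[ℝ] ℝ} {y : F}
    (hG : ContinuousAt G y) (hi : (G y).IsInvertible) : ∀ᶠ z in 𝓝 y, (G z).IsInvertible := by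
  obtain ⟨e, he⟩ := hi
  have := ContinuousLinearEquiv.nhds e
  rw [he] at this
  filter_upwards [hG this] with z hz
  exact hz

lemma contDiffAt_christoffelL [CompleteSpace E] {G : E → E →L[ℝ] E →L[ℝ] ℝ} {y : E}
    {m n : WithTop ℕ∞} (hG : ContDiffAt ℝ n G y) (hi : (G y).IsInvertible) (hmn : m + 1 ≤ n) :
    ContDiffAt ℝ m (christoffelL G) y := by
  have h1 : ContDiffAt ℝ m (fun z => (G z).inverse) y := by
    obtain ⟨e, he⟩ := hi
    have := contDiffAt_map_inverse (n := m) e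
    rw [he] at this
    exact this.comp y (hG.of_le (le_trans le_self_add hmn))
  have h2 : ContDiffAt ℝ m (fun z => (1 / 2 : ℝ) • koszulL (fderiv ℝ G z)) y :=
    (koszulL.contDiff.contDiffAt.comp y (hG.fderiv_right hmn)).const_smul (1 / 2 : ℝ)
  exact ((ContinuousLinearMap.contDiff
    (ContinuousLinearMap.compL ℝ E (E →L[ℝ] ℝ) E)).contDiffAt.comp y h1).clm_comp h2

lemma fderiv_apply_symm {G : E → E →L[ℝ] E →L[ℝ] ℝ} {y : E}
    (hs : ∀ᶠ z in 𝓝 y, ∀ v w, G z v w = G z w v) (hd : DifferentiableAt ℝ G y) (a b c : E) :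
    fderiv ℝ G y a b c = fderiv ℝ G y a c b := by
  have h1 : (fun z => G z b c) =ᶠ[𝓝 y] fun z => G z c b := hs.mono fun z hz => hz b c
  rw [← fderiv_apply_const₂ hd b c, ← fderiv_apply_const₂ hd c b, h1.fderiv_eq]

lemma fderiv_metric_eq {G : E → E →L[ℝ] E →L[ℝ] ℝ} {y : E}
    (hs : ∀ᶠ z in 𝓝 y, ∀ v w, G z v w = G z w v) (hd : DifferentiableAt ℝ G y)
    (hi : (G y).IsInvertible) (u a b : E) :
    fderiv ℝ G y u a b = G y (christoffelL G y u a) b + G y (christoffelL G y u b) a := by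
  rw [metric_christoffelL hi, metric_christoffelL hi, koszulE_apply, koszulE_apply,
    fderiv_apply_symm hs hd u b a, fderiv_apply_symm hs hd b u a, fderiv_apply_symm hs hd a u b]
  ring

lemma fderiv_christoffelE {G : E → E →L[ℝ] E →L[ℝ] ℝ} {y : E}
    (hd : DifferentiableAt ℝ (christoffelL G) y) (u v w : E) :
    fderiv ℝ (fun z => christoffelE G z v w) y u = fderiv ℝ (christoffelL G) y u v w := by
  simp only [← christoffelL_apply]
  exact fderiv_apply_const₂ hd v w u

lemma curvatureE_eq {G : E → E →L[ℝ] E →L[ℝ] ℝ} {y : E}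
    (hd : DifferentiableAt ℝ (christoffelL G) y) (u v w : E) :
    curvatureE G y u v w = fderiv ℝ (christoffelL G) y u v w - fderiv ℝ (christoffelL G) y v u w
      + christoffelL G y u (christoffelL G y v w) - christoffelL G y v (christoffelL G y u w) := by
  simp only [curvatureE, fderiv_christoffelE hd, christoffelL_apply]

/-- The curvature as a linear map in its first argument. -/
noncomputable def curvatureL (G : E → E →L[ℝ] E →L[ℝ] ℝ) (y v w : E) : E →ₗ[ℝ] E where
  toFun u := fderiv ℝ (christoffelL G) y u v w - fderiv ℝ (christoffelL G) y v u w
      + christoffelL G y u (christoffelL G y v w) - christoffelL G y v (christoffelL G y u w)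
  map_add' u u' := by
    simp only [map_add, add_apply]; abel
  map_smul' c u := by
    simp only [map_smul, smul_apply, RingHom.id_apply, smul_add, smul_sub]

lemma ricciE_eq_trace [FiniteDimensional ℝ E] {G : E → E →L[ℝ] E →L[ℝ] ℝ} {y : E}
    (hd : DifferentiableAt ℝ (christoffelL G) y) (v w : E) :
    ricciE G y v w = LinearMap.trace ℝ E (curvatureL G y v w) := by
  rw [LinearMap.trace_eq_matrix_trace ℝ (Module.finBasis ℝ E), Matrix.trace]
  simp only [ricciE, Matrix.diag_apply, LinearMap.toMatrix_apply, curvatureE_eq hd]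
  rfl

/-- The second derivatives of the metric occurring in the curvature. -/
noncomputable def curvatureSecond (D2 : E →L[ℝ] E →L[ℝ] E →L[ℝ] E →L[ℝ] ℝ) (u v w z : E) : ℝ :=
  1 / 2 * (D2 u w v z - D2 u z v w - D2 v w u z + D2 v z u w)

lemma metric_curvatureE [CompleteSpace E] {G : E → E →L[ℝ] E →L[ℝ] ℝ} {y : E}
    (hG : ContDiffAt ℝ 2 G y)
    (hs : ∀ᶠ z in 𝓝 y, ∀ v w, G z v w = G z w v) (hi : (G y).IsInvertible) (u v w z : E) :
    G y (curvatureE G y u v w) z = curvatureSecond (fderiv ℝ (fderiv ℝ G) y) u v w z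
      - G y (christoffelL G y u z) (christoffelL G y v w)
      + G y (christoffelL G y v z) (christoffelL G y u w) := by
  have hd : DifferentiableAt ℝ G y := hG.differentiableAt (by simp)
  have hΓ : DifferentiableAt ℝ (christoffelL G) y :=
    (contDiffAt_christoffelL (m := 1) hG hi (by norm_num)).differentiableAt (by simp)
  have hd2 : DifferentiableAt ℝ (fderiv ℝ G) y :=
    (hG.fderiv_right (m := 1) (by norm_num)).differentiableAt (by simp)
  have sym2 : ∀ a b, fderiv ℝ (fderiv ℝ G) y a b = fderiv ℝ (fderiv ℝ G) y b a := by
    intro a b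
    exact (hG.isSymmSndFDerivAt (by simp)).eq a b
  have key : ∀ a b c, G y (fderiv ℝ (christoffelL G) y a b c) z =
      1 / 2 * koszulL (fderiv ℝ (fderiv ℝ G) y a) b c z
      - fderiv ℝ G y a (christoffelL G y b c) z := by
    intro a b c
    have h1 : (fun x => G x (christoffelL G x b c) z) =ᶠ[𝓝 y]
        fun x => 1 / 2 * koszulL (fderiv ℝ G x) b c z := by
      filter_upwards [eventually_isInvertible hd.continuousAt hi] with x hx
      rw [metric_christoffelL hx, koszulE_eq]
    have e1 := hasFDerivAt_apply_const (hasFDerivAt_apply_const hΓ.hasFDerivAt b) c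
    have e2 := hasFDerivAt_apply_const (hd.hasFDerivAt.clm_apply e1) z
    have e0 : HasFDerivAt (fun x => koszulL (fderiv ℝ G x))
        (koszulL.comp (fderiv ℝ (fderiv ℝ G) y)) y :=
      koszulL.hasFDerivAt.comp y hd2.hasFDerivAt
    have e3 := hasFDerivAt_apply_const (hasFDerivAt_apply_const
      (hasFDerivAt_apply_const e0 b) c) z
    have := h1.fderiv_eq (𝕜 := ℝ)
    rw [e2.fderiv, (e3.const_mul (1 / 2 : ℝ)).fderiv] at this
    have := DFunLike.congr_fun this a
    simp only [add_apply, ContinuousLinearMap.comp_apply, ContinuousLinearMap.flip_apply,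
      smul_apply, smul_eq_mul] at this
    linarith
  rw [curvatureE_eq hΓ]
  simp only [map_sub, map_add, sub_apply, add_apply, key,
    fderiv_metric_eq hs hd hi, curvatureSecond, koszulL_apply]
  rw [sym2 v u]
  ring

/-- The Ricci tensor computed in an orthogonal frame, in terms of the first two derivatives of the
metric. -/
theorem ricciE_frame [FiniteDimensional ℝ E] {ι : Type*} [Fintype ι]
    {G : E → E →L[ℝ] E →L[ℝ] ℝ} {y : E} (hG : ContDiffAt ℝ 2 G y)
    (hs : ∀ᶠ z in 𝓝 y, ∀ v w, G z v w = G z w v) (hi : (G y).IsInvertible)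
    (b : Module.Basis ι ℝ E) (l : ι → ℝ) (hl : ∀ i, l i ≠ 0)
    (hb : ∀ i, G y (b i) (b i) = l i) (hb' : ∀ i j, i ≠ j → G y (b i) (b j) = 0) (v w : E) :
    ricciE G y v w = ∑ i, (l i)⁻¹ * (curvatureSecond (fderiv ℝ (fderiv ℝ G) y) (b i) v w (b i)
      + ∑ c, (l c)⁻¹ * (1 / 4) * (koszulE G y v (b i) (b c) * koszulE G y (b i) w (b c)
        - koszulE G y (b i) (b i) (b c) * koszulE G y v w (b c))) := by
  classical
  have : CompleteSpace E := FiniteDimensional.complete ℝ E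
  have hΓ : DifferentiableAt ℝ (christoffelL G) y :=
    (contDiffAt_christoffelL (m := 1) hG hi (by norm_num)).differentiableAt (by simp)
  have coord : ∀ x i, b.repr x i = (l i)⁻¹ * G y x (b i) := by
    intro x i
    have : G y x (b i) = b.repr x i * l i := by
      conv_lhs => rw [← b.sum_repr x]
      simp only [map_sum, map_smul, sum_apply, smul_apply,
        smul_eq_mul]
      rw [Finset.sum_eq_single i (fun j _ hj => by rw [hb' j i hj, mul_zero]) (by simp), hb]
    rw [this]; field_simp [hl i]
  have expand : ∀ x x', G y x x' = ∑ c, (l c)⁻¹ * (G y x (b c) * G y x' (b c)) := by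
    intro x x'
    conv_lhs => rw [← b.sum_repr x']
    simp only [map_sum, map_smul, smul_eq_mul, coord]
    exact Finset.sum_congr rfl fun c _ => by ring
  rw [ricciE_eq_trace hΓ, LinearMap.trace_eq_matrix_trace ℝ b, Matrix.trace]
  simp only [Matrix.diag_apply, LinearMap.toMatrix_apply]
  refine Finset.sum_congr rfl fun i _ => ?_
  have : (curvatureL G y v w) (b i) = curvatureE G y (b i) v w := (curvatureE_eq hΓ _ _ _).symm
  rw [this, coord, metric_curvatureE hG hs hi, expand (christoffelL G y (b i) (b i)),
    expand (christoffelL G y v (b i)), sub_add, ← Finset.sum_sub_distrib, sub_eq_add_neg,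
    ← Finset.sum_neg_distrib]
  simp only [metric_christoffelL hi]
  congr 2
  exact Finset.sum_congr rfl fun c _ => by ring

end LocalRicci

section PullBilin

variable {𝕜 : Type*} [NontriviallyNormedField 𝕜]
  {E : Type*} [NormedAddCommGroup E] [NormedSpace 𝕜 E]
  {F : Type*} [NormedAddCommGroup F] [NormedSpace 𝕜 F]

@[simp] lemma pullBilin_apply (D : E →L[𝕜] F) (B : F →L[𝕜] F →L[𝕜] 𝕜) (u v : E) :
    pullBilin D B u v = B (D u) (D v) := rfl

lemma hasFDerivAt_pullBilin_apply {D : E → E →L[𝕜] F} {φ : E → F} {T : F → F →L[𝕜] F →L[𝕜] 𝕜}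
    {y : E} {D' : E →L[𝕜] E →L[𝕜] F} {φ' : E →L[𝕜] F} {T' : F →L[𝕜] F →L[𝕜] F →L[𝕜] 𝕜}
    (hD : HasFDerivAt D D' y) (hφ : HasFDerivAt φ φ' y) (hT : HasFDerivAt T T' (φ y)) (u v : E) :
    HasFDerivAt (fun z => pullBilin (D z) (T (φ z)) u v)
      ((T (φ y) (D y u)).comp (D'.flip v)
        + ((T (φ y)).comp (D'.flip u) + (T'.comp φ').flip (D y u)).flip (D y v)) y := by
  have h1 := hasFDerivAt_apply_const hD u
  have h2 := hasFDerivAt_apply_const hD v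
  exact ((hT.comp y hφ).clm_apply h1).clm_apply h2

/-- The derivative of the pull-back of a field of bilinear forms. -/
lemma fderiv_pullBilin {T' : E → E →L[𝕜] E →L[𝕜] 𝕜} {φ : E → F} {T : F → F →L[𝕜] F →L[𝕜] 𝕜}
    {y : E} (hφ : DifferentiableAt 𝕜 φ y) (hφ2 : DifferentiableAt 𝕜 (fderiv 𝕜 φ) y)
    (hT : DifferentiableAt 𝕜 T (φ y)) (hT' : DifferentiableAt 𝕜 T' y)
    (h : T' =ᶠ[𝓝 y] fun z => pullBilin (fderiv 𝕜 φ z) (T (φ z))) (u v a : E) :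
    fderiv 𝕜 T' y a u v = fderiv 𝕜 T (φ y) (fderiv 𝕜 φ y a) (fderiv 𝕜 φ y u) (fderiv 𝕜 φ y v)
      + T (φ y) (fderiv 𝕜 (fderiv 𝕜 φ) y a u) (fderiv 𝕜 φ y v)
      + T (φ y) (fderiv 𝕜 φ y u) (fderiv 𝕜 (fderiv 𝕜 φ) y a v) := by
  rw [← fderiv_apply_const₂ hT' u v]
  have h1 : (fun z => T' z u v) =ᶠ[𝓝 y] fun z => pullBilin (fderiv 𝕜 φ z) (T (φ z)) u v :=
    h.mono fun z hz => by simp only [hz]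
  rw [h1.fderiv_eq, (hasFDerivAt_pullBilin_apply hφ2.hasFDerivAt hφ.hasFDerivAt hT.hasFDerivAt
    u v).fderiv]
  simp only [add_apply, ContinuousLinearMap.comp_apply, ContinuousLinearMap.flip_apply]
  ring

end PullBilin

section Naturality

variable {E : Type*} [NormedAddCommGroup E] [NormedSpace ℝ E]

lemma isInvertible_pullBilin {D : E →L[ℝ] E} {B : E →L[ℝ] E →L[ℝ] ℝ} (hD : D.IsInvertible)
    (hB : B.IsInvertible) : (pullBilin D B).IsInvertible := by
  obtain ⟨d, rfl⟩ := hD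
  obtain ⟨b, rfl⟩ := hB
  refine ⟨(d.trans b).trans (d.symm.arrowCongr (ContinuousLinearEquiv.refl ℝ ℝ)), ?_⟩
  ext u v
  simp [ContinuousLinearEquiv.arrowCongr]

variable {G G' : E → E →L[ℝ] E →L[ℝ] ℝ} {φ : E → E} {y : E}

/-- The transformation law of the Christoffel map. -/
lemma christoffelL_pullback (hφ : DifferentiableAt ℝ φ y)
    (hφ2 : DifferentiableAt ℝ (fderiv ℝ φ) y)
    (hsym : ∀ u v, fderiv ℝ (fderiv ℝ φ) y u v = fderiv ℝ (fderiv ℝ φ) y v u)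
    (hinv : (fderiv ℝ φ y).IsInvertible) (hG : DifferentiableAt ℝ G (φ y))
    (hG' : DifferentiableAt ℝ G' y)
    (hs : ∀ v w, G (φ y) v w = G (φ y) w v)
    (hi : (G (φ y)).IsInvertible)
    (h : G' =ᶠ[𝓝 y] fun z => pullBilin (fderiv ℝ φ z) (G (φ z))) (u v : E) :
    fderiv ℝ φ y (christoffelL G' y u v) =
      christoffelL G (φ y) (fderiv ℝ φ y u) (fderiv ℝ φ y v)
        + fderiv ℝ (fderiv ℝ φ) y u v := by
  have hi' : (G' y).IsInvertible := by
    rw [h.self_of_nhds]; exact isInvertible_pullBilin hinv hi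
  have inj : Function.Injective (G (φ y)) := by
    obtain ⟨e, he⟩ := hi
    rw [← he]; exact e.injective
  apply inj
  ext w'
  obtain ⟨d, hd⟩ := hinv
  obtain ⟨w, rfl⟩ : ∃ w, fderiv ℝ φ y w = w' := ⟨d.symm w', by rw [← hd]; simp⟩
  have e1 : G (φ y) (fderiv ℝ φ y (christoffelL G' y u v)) (fderiv ℝ φ y w) =
      G' y (christoffelL G' y u v) w := by rw [h.self_of_nhds]; rfl
  have D := fun a b c => fderiv_pullBilin hφ hφ2 hG hG' h b c a
  rw [e1, metric_christoffelL hi', map_add, add_apply, metric_christoffelL hi, koszulE_apply,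
    koszulE_apply, D, D, D, hsym v u, hsym w u, hsym w v,
    hs (fderiv ℝ φ y v) (fderiv ℝ (fderiv ℝ φ) y u w)]
  ring

/-- Naturality of the Ricci tensor under local diffeomorphisms. -/
theorem ricciE_pullback [FiniteDimensional ℝ E] (hφ : ContDiffAt ℝ 3 φ y)
    (hinv : (fderiv ℝ φ y).IsInvertible) (hG : ContDiffAt ℝ 2 G (φ y))
    (hs : ∀ᶠ z in 𝓝 (φ y), ∀ v w, G z v w = G z w v) (hi : (G (φ y)).IsInvertible)
    (h : G' =ᶠ[𝓝 y] fun z => pullBilin (fderiv ℝ φ z) (G (φ z))) (v w : E) :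
    ricciE G' y v w = ricciE G (φ y) (fderiv ℝ φ y v) (fderiv ℝ φ y w) := by
  have : CompleteSpace E := FiniteDimensional.complete ℝ E
  have hφ1 : ContDiffAt ℝ 2 (fderiv ℝ φ) y := hφ.fderiv_right (by norm_num)
  have hφ2 : ContDiffAt ℝ 1 (fderiv ℝ (fderiv ℝ φ)) y := hφ1.fderiv_right (by norm_num)
  have hφd : ∀ᶠ z in 𝓝 y, ContDiffAt ℝ 3 φ z := hφ.eventually (by simp)
  have hφc : ContinuousAt φ y := hφ.continuousAt
  have hGev : ∀ᶠ z in 𝓝 y, ContDiffAt ℝ 2 G (φ z) :=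
    hφc.eventually (hG.eventually (by simp))
  have hsev : ∀ᶠ z in 𝓝 y, ∀ v w, G (φ z) v w = G (φ z) w v := hφc.eventually hs
  have hiev : ∀ᶠ z in 𝓝 y, (G (φ z)).IsInvertible :=
    eventually_isInvertible (hG.continuousAt.comp hφc) hi
  have hinvev : ∀ᶠ z in 𝓝 y, (fderiv ℝ φ z).IsInvertible := by
    obtain ⟨d, hd⟩ := hinv
    have := ContinuousLinearEquiv.nhds d
    rw [hd] at this
    exact hφ1.continuousAt this
  have hG'c : ContDiffAt ℝ 2 G' y := by
    refine ContDiffAt.congr_of_eventuallyEq ?_ h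
    have h1 : ContDiffAt ℝ 2 (fun z => G (φ z)) y := hG.comp y (hφ.of_le (by norm_num))
    have h2 := (ContinuousLinearMap.contDiff
      (ContinuousLinearMap.compL ℝ E E ℝ).flip).contDiffAt.comp y hφ1
    exact h2.clm_comp (h1.clm_comp hφ1)
  have hi' : (G' y).IsInvertible := by
    rw [h.self_of_nhds]; exact isInvertible_pullBilin hinv hi
  have law : ∀ᶠ z in 𝓝 y, ∀ u v, fderiv ℝ φ z (christoffelL G' z u v) =
      christoffelL G (φ z) (fderiv ℝ φ z u) (fderiv ℝ φ z v)
        + fderiv ℝ (fderiv ℝ φ) z u v := by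
    filter_upwards [hφd, hGev, hsev, hiev, hinvev, hG'c.eventually (by simp),
      h.eventuallyEq_nhds] with z z1 z2 z3 z4 z5 z6 z7 u v
    exact christoffelL_pullback (z1.differentiableAt (by simp))
      ((z1.fderiv_right (m := 2) (by norm_num)).differentiableAt (by simp))
      (fun a b => ((z1.of_le (by norm_num : (2 : WithTop ℕ∞) ≤ 3)).isSymmSndFDerivAt
        (by simp)).eq a b) z5 (z2.differentiableAt (by simp))
      (z6.differentiableAt (by simp)) z3 z4 z7 u v
  have hΓ : DifferentiableAt ℝ (christoffelL G) (φ y) :=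
    (contDiffAt_christoffelL (m := 1) hG hi (by norm_num)).differentiableAt (by simp)
  have hΓ' : DifferentiableAt ℝ (christoffelL G') y :=
    (contDiffAt_christoffelL (m := 1) hG'c hi' (by norm_num)).differentiableAt (by simp)
  set P := fderiv ℝ φ y with hP
  set S := fderiv ℝ (fderiv ℝ φ) y with hS
  set T := fderiv ℝ (fderiv ℝ (fderiv ℝ φ)) y with hT
  have dφ : HasFDerivAt φ P y := (hφ.differentiableAt (by simp)).hasFDerivAt
  have dP : HasFDerivAt (fderiv ℝ φ) S y := (hφ1.differentiableAt (by simp)).hasFDerivAt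
  have dS : HasFDerivAt (fderiv ℝ (fderiv ℝ φ)) T y := (hφ2.differentiableAt (by simp)).hasFDerivAt
  have symS : ∀ a b, S a b = S b a := fun a b =>
    ((hφ.of_le (by norm_num : (2 : WithTop ℕ∞) ≤ 3)).isSymmSndFDerivAt (by simp)).eq a b
  have symT : ∀ a b, T a b = T b a := fun a b => (hφ1.isSymmSndFDerivAt (by simp)).eq a b
  have lawy : ∀ u v, P (christoffelL G' y u v) = christoffelL G (φ y) (P u) (P v) + S u v :=
    law.self_of_nhds
  have der : ∀ u v w, P (fderiv ℝ (christoffelL G') y u v w) + S u (christoffelL G' y v w)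
      = fderiv ℝ (christoffelL G) (φ y) (P u) (P v) (P w)
        + christoffelL G (φ y) (S u v) (P w) + christoffelL G (φ y) (P v) (S u w)
        + T u v w := by
    intro u v w
    have h1 : (fun z => fderiv ℝ φ z (christoffelL G' z v w)) =ᶠ[𝓝 y] fun z =>
        christoffelL G (φ z) (fderiv ℝ φ z v) (fderiv ℝ φ z w)
          + fderiv ℝ (fderiv ℝ φ) z v w := law.mono fun z hz => hz v w
    have e1 := dP.clm_apply
      (hasFDerivAt_apply_const (hasFDerivAt_apply_const hΓ'.hasFDerivAt v) w)
    have e2 := ((hΓ.hasFDerivAt.comp y dφ).clm_apply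
      (hasFDerivAt_apply_const dP v)).clm_apply (hasFDerivAt_apply_const dP w)
    have e3 := hasFDerivAt_apply_const (hasFDerivAt_apply_const dS v) w
    have e4 := h1.fderiv_eq (𝕜 := ℝ)
    rw [e1.fderiv] at e4
    have e5 := (e2.add e3).fderiv
    have e6 := DFunLike.congr_fun (e4.trans e5) u
    simp only [add_apply, ContinuousLinearMap.comp_apply, ContinuousLinearMap.flip_apply,
      Function.comp_apply] at e6
    rw [e6]; abel
  have curv : ∀ u, P (curvatureL G' y v w u) = curvatureL G (φ y) (P v) (P w) (P u) := by
    intro u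
    simp only [curvatureL, LinearMap.coe_mk, AddHom.coe_mk]
    have d1 := der u v w
    have d2 := der v u w
    rw [symT v u, symS v u] at d2
    have l1 := lawy u (christoffelL G' y v w)
    have l2 := lawy v (christoffelL G' y u w)
    rw [lawy v w, map_add] at l1
    rw [lawy u w, map_add] at l2
    rw [map_sub, map_add, map_sub, l1, l2, ← sub_eq_zero, eq_sub_of_add_eq d1, eq_sub_of_add_eq d2]
    abel
  rw [ricciE_eq_trace hΓ', ricciE_eq_trace hΓ]
  obtain ⟨d, hd⟩ := hinv
  have : curvatureL G (φ y) (P v) (P w)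
      = (d.toLinearEquiv : E ≃ₗ[ℝ] E).conj (curvatureL G' y v w) := by
    ext x
    have hx : P (d.symm x) = x := by rw [← hd]; simp
    have := curv (d.symm x)
    rw [hx] at this
    rw [← this, ← hd]
    simp [LinearEquiv.conj_apply]
  rw [this, LinearMap.trace_conj']

end Naturality

/-! ### The Beltrami metric in a chart -/

section BeltramiChart

variable {E : Type*} [NormedAddCommGroup E] [NormedSpace ℝ E]

/-- The form `θ = ρ dρ + α` on `E × ℝ`. -/
noncomputable def thetaE (α : E → E →L[ℝ] ℝ) (p : E × ℝ) : E × ℝ →L[ℝ] ℝ :=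
  p.2 • ContinuousLinearMap.snd ℝ E ℝ + (α p.1).comp (ContinuousLinearMap.fst ℝ E ℝ)

/-- The metric `ρ² H + ρ⁻² (ρ dρ + α)²` on `E × ℝ`. -/
noncomputable def beltramiE (H : E → E →L[ℝ] E →L[ℝ] ℝ) (α : E → E →L[ℝ] ℝ) (p : E × ℝ) :
    E × ℝ →L[ℝ] E × ℝ →L[ℝ] ℝ :=
  p.2 ^ 2 • pullBilin (ContinuousLinearMap.fst ℝ E ℝ) (H p.1)
    + (p.2 ^ 2)⁻¹ • (thetaE α p).smulRight (thetaE α p)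

variable {H : E → E →L[ℝ] E →L[ℝ] ℝ} {α : E → E →L[ℝ] ℝ} {p : E × ℝ}

lemma beltramiE_apply (hp : p.2 ≠ 0) (V W : E × ℝ) :
    beltramiE H α p V W = p.2 ^ 2 * H p.1 V.1 W.1
      + (V.2 + α p.1 V.1 / p.2) * (W.2 + α p.1 W.1 / p.2) := by
  have : beltramiE H α p V W = p.2 ^ 2 * H p.1 V.1 W.1
    + (p.2 ^ 2)⁻¹ * ((p.2 * V.2 + α p.1 V.1) * (p.2 * W.2 + α p.1 W.1)) := by
    simp [beltramiE, thetaE]; ring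
  rw [this]; field_simp

lemma contDiffAt_beltramiE {n : WithTop ℕ∞} (hp : p.2 ≠ 0) (hH : ContDiffAt ℝ n H p.1)
    (hα : ContDiffAt ℝ n α p.1) : ContDiffAt ℝ n (beltramiE H α) p := by
  have h2 : ContDiffAt ℝ n (fun q : E × ℝ => q.2) p := contDiffAt_snd
  have hH' : ContDiffAt ℝ n (fun q : E × ℝ => H q.1) p := hH.comp p contDiffAt_fst
  have hα' : ContDiffAt ℝ n (fun q : E × ℝ => α q.1) p := hα.comp p contDiffAt_fst
  have hθ : ContDiffAt ℝ n (thetaE α) p :=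
    (h2.smul contDiffAt_const).add (hα'.clm_comp contDiffAt_const)
  refine ((h2.pow 2).smul (contDiffAt_const.clm_comp (hH'.clm_comp contDiffAt_const))).add ?_
  exact ((h2.pow 2).inv (pow_ne_zero 2 hp)).smul (hθ.smulRight hθ)

lemma hasDerivAt_line {F F' : Type*} [NormedAddCommGroup F] [NormedSpace ℝ F]
    [NormedAddCommGroup F'] [NormedSpace ℝ F'] {f : F → F'} {f' : F →L[ℝ] F'} {y : F}
    (hf : HasFDerivAt f f' y) (x : F) : HasDerivAt (fun t : ℝ => f (y + t • x)) (f' x) 0 := by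
  have h1 : HasDerivAt (fun t : ℝ => y + t • x) x 0 := by
    simpa using ((hasDerivAt_id (0 : ℝ)).smul_const x).const_add y
  have h2 : HasFDerivAt f f' (y + (0 : ℝ) • x) := by simpa using hf
  exact h2.comp_hasDerivAt 0 h1

/-- The derivative of `η(V) = dρ(V) + α(V) / ρ`. -/
noncomputable def etaDeriv (α : E → E →L[ℝ] ℝ) (p X V : E × ℝ) : ℝ :=
  fderiv ℝ α p.1 X.1 V.1 / p.2 - X.2 * α p.1 V.1 / p.2 ^ 2

lemma fderiv_beltramiE (hp : p.2 ≠ 0) (hH : DifferentiableAt ℝ H p.1)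
    (hα : DifferentiableAt ℝ α p.1) (hG : DifferentiableAt ℝ (beltramiE H α) p)
    (X V W : E × ℝ) :
    fderiv ℝ (beltramiE H α) p X V W = 2 * p.2 * X.2 * H p.1 V.1 W.1
      + p.2 ^ 2 * fderiv ℝ H p.1 X.1 V.1 W.1
      + etaDeriv α p X V * (W.2 + α p.1 W.1 / p.2)
      + (V.2 + α p.1 V.1 / p.2) * etaDeriv α p X W := by
  have e1 := hasDerivAt_line (hasFDerivAt_apply_const
    (hasFDerivAt_apply_const hG.hasFDerivAt V) W) X
  have hH1 := hasDerivAt_line (hasFDerivAt_apply_const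
    (hasFDerivAt_apply_const hH.hasFDerivAt V.1) W.1) X.1
  have hV := hasDerivAt_line (hasFDerivAt_apply_const hα.hasFDerivAt V.1) X.1
  have hW := hasDerivAt_line (hasFDerivAt_apply_const hα.hasFDerivAt W.1) X.1
  have hρ : HasDerivAt (fun t : ℝ => p.2 + t * X.2) X.2 0 := by
    simpa using ((hasDerivAt_id (0 : ℝ)).mul_const X.2).const_add p.2
  have hne : p.2 + 0 * X.2 ≠ 0 := by simpa using hp
  have e2 := ((hρ.pow 2).mul hH1).add (((hV.div hρ hne).const_add V.2).mul
    ((hW.div hρ hne).const_add W.2))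
  have := e1.unique (e2.congr_of_eventuallyEq <| by
    have : ∀ᶠ t in 𝓝 (0 : ℝ), p.2 + t * X.2 ≠ 0 :=
      hρ.continuousAt.eventually_ne hne
    filter_upwards [this] with t ht
    exact beltramiE_apply (p := p + t • X) (by simpa using ht) V W)
  simp only [ContinuousLinearMap.flip_apply] at this
  rw [this]
  simp only [zero_mul, add_zero, zero_smul, etaDeriv, Pi.pow_apply, Pi.div_apply]
  field_simp
  push_cast
  ring

/-- The second derivative of `η(V) = dρ(V) + α(V) / ρ`. -/
noncomputable def etaDeriv₂ (α : E → E →L[ℝ] ℝ) (p X Y V : E × ℝ) : ℝ :=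
  fderiv ℝ (fderiv ℝ α) p.1 X.1 Y.1 V.1 / p.2
    - (X.2 * fderiv ℝ α p.1 Y.1 V.1 + Y.2 * fderiv ℝ α p.1 X.1 V.1) / p.2 ^ 2
    + 2 * X.2 * Y.2 * α p.1 V.1 / p.2 ^ 3

lemma hasDerivAt_etaDeriv (hp : p.2 ≠ 0) (hα : DifferentiableAt ℝ α p.1)
    (hα2 : DifferentiableAt ℝ (fderiv ℝ α) p.1) (X Y V : E × ℝ) :
    HasDerivAt (fun t : ℝ => etaDeriv α (p + t • X) Y V) (etaDeriv₂ α p X Y V) 0 := by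
  have hV := hasDerivAt_line (hasFDerivAt_apply_const hα.hasFDerivAt V.1) X.1
  have hV2 := hasDerivAt_line (hasFDerivAt_apply_const
    (hasFDerivAt_apply_const hα2.hasFDerivAt Y.1) V.1) X.1
  have hρ : HasDerivAt (fun t : ℝ => p.2 + t * X.2) X.2 0 := by
    simpa using ((hasDerivAt_id (0 : ℝ)).mul_const X.2).const_add p.2
  have hne : p.2 + 0 * X.2 ≠ 0 := by simpa using hp
  have : HasDerivAt (fun t : ℝ => etaDeriv α (p + t • X) Y V) _ 0 :=
    (hV2.div hρ hne).sub ((hV.const_mul Y.2).div (hρ.pow 2) (pow_ne_zero 2 hne))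
  refine this.congr_deriv ?_
  simp only [zero_mul, add_zero, zero_smul, etaDeriv₂, ContinuousLinearMap.flip_apply]
  field_simp
  push_cast
  ring

lemma fderiv_fderiv_beltramiE (hp : p.2 ≠ 0) (hH : ContDiffAt ℝ 2 H p.1)
    (hα : ContDiffAt ℝ 2 α p.1) (X Y V W : E × ℝ) :
    fderiv ℝ (fderiv ℝ (beltramiE H α)) p X Y V W =
      2 * X.2 * Y.2 * H p.1 V.1 W.1
      + 2 * p.2 * (X.2 * fderiv ℝ H p.1 Y.1 V.1 W.1 + Y.2 * fderiv ℝ H p.1 X.1 V.1 W.1)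
      + p.2 ^ 2 * fderiv ℝ (fderiv ℝ H) p.1 X.1 Y.1 V.1 W.1
      + etaDeriv₂ α p X Y V * (W.2 + α p.1 W.1 / p.2)
      + etaDeriv₂ α p X Y W * (V.2 + α p.1 V.1 / p.2)
      + etaDeriv α p X V * etaDeriv α p Y W + etaDeriv α p X W * etaDeriv α p Y V := by
  have hG := contDiffAt_beltramiE hp hH hα
  have hH2 : DifferentiableAt ℝ (fderiv ℝ H) p.1 :=
    (hH.fderiv_right (m := 1) (by norm_num)).differentiableAt (by simp)
  have hα2 : DifferentiableAt ℝ (fderiv ℝ α) p.1 :=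
    (hα.fderiv_right (m := 1) (by norm_num)).differentiableAt (by simp)
  have hG2 : DifferentiableAt ℝ (fderiv ℝ (beltramiE H α)) p :=
    (hG.fderiv_right (m := 1) (by norm_num)).differentiableAt (by simp)
  have hHd := hH.differentiableAt (by simp)
  have hαd := hα.differentiableAt (by simp)
  have e1 := hasDerivAt_line (hasFDerivAt_apply_const (hasFDerivAt_apply_const
    (hasFDerivAt_apply_const hG2.hasFDerivAt Y) V) W) X
  have hH1 := hasDerivAt_line (hasFDerivAt_apply_const
    (hasFDerivAt_apply_const hHd.hasFDerivAt V.1) W.1) X.1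
  have hH3 := hasDerivAt_line (hasFDerivAt_apply_const (hasFDerivAt_apply_const
    (hasFDerivAt_apply_const hH2.hasFDerivAt Y.1) V.1) W.1) X.1
  have hV := hasDerivAt_line (hasFDerivAt_apply_const hαd.hasFDerivAt V.1) X.1
  have hW := hasDerivAt_line (hasFDerivAt_apply_const hαd.hasFDerivAt W.1) X.1
  have hρ : HasDerivAt (fun t : ℝ => p.2 + t * X.2) X.2 0 := by
    simpa using ((hasDerivAt_id (0 : ℝ)).mul_const X.2).const_add p.2
  have hne : p.2 + 0 * X.2 ≠ 0 := by simpa using hp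
  have e2 := (((((hρ.const_mul 2).mul_const Y.2).mul hH1).add ((hρ.pow 2).mul hH3)).add
    ((hasDerivAt_etaDeriv hp hαd hα2 X Y V).mul ((hW.div hρ hne).const_add W.2))).add
    (((hV.div hρ hne).const_add V.2).mul (hasDerivAt_etaDeriv hp hαd hα2 X Y W))
  have hline : Tendsto (fun t : ℝ => p + t • X) (𝓝 0) (𝓝 p) := by
    have : Continuous fun t : ℝ => p + t • X := by fun_prop
    simpa using this.tendsto 0
  have := e1.unique (e2.congr_of_eventuallyEq <| by
    have h0 : ∀ᶠ q in 𝓝 p, q.2 ≠ 0 := continuousAt_snd.eventually_ne hp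
    have h1 : ∀ᶠ q in 𝓝 p, ContDiffAt ℝ 2 H q.1 :=
      continuousAt_fst.eventually (hH.eventually (by simp))
    have h2 : ∀ᶠ q in 𝓝 p, ContDiffAt ℝ 2 α q.1 :=
      continuousAt_fst.eventually (hα.eventually (by simp))
    filter_upwards [hline.eventually h0, hline.eventually h1, hline.eventually h2] with t h0 h1 h2
    exact fderiv_beltramiE h0 (h1.differentiableAt (by simp)) (h2.differentiableAt (by simp))
      ((contDiffAt_beltramiE h0 h1 h2).differentiableAt (by simp)) Y V W)
  simp only [ContinuousLinearMap.flip_apply] at this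
  rw [this]
  simp only [zero_mul, add_zero, zero_smul, etaDeriv, Pi.pow_apply, Pi.div_apply]
  field_simp
  push_cast
  ring

end BeltramiChart

section JetAlgebra

/-- The Ricci tensor of a metric in an orthonormal frame, in terms of the values `D1 x v w`,
`D2 x y v w` of its first and second derivatives on the frame. -/
noncomputable def jetRicci {ι : Type*} [Fintype ι] (D1 : ι → ι → ι → ℝ) (D2 : ι → ι → ι → ι → ℝ)
    (v w : ι) : ℝ :=
  ∑ x, (1 / 2 * (D2 x w v x - D2 x x v w - D2 v w x x + D2 v x x w)
    + ∑ c, 1 / 4 * ((D1 v x c + D1 x v c - D1 c v x) * (D1 x w c + D1 w x c - D1 c x w)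
      - (D1 x x c + D1 x x c - D1 c x x) * (D1 v w c + D1 w v c - D1 c v w)))

variable (a : Fin 3 → ℝ) (B : Fin 3 → Fin 3 → ℝ) (C N : Fin 3 → Fin 3 → Fin 3 → ℝ)
  (Q : Fin 3 → Fin 3 → Fin 3 → Fin 3 → ℝ)

/-- The first derivatives of the Beltrami metric in the normalised frame, up to a factor. -/
noncomputable def beltramiJet₁ : Fin 3 ⊕ Unit → Fin 3 ⊕ Unit → Fin 3 ⊕ Unit → ℝ
  | .inl k, .inl i, .inl j => N k i j - 2 * a k * (if i = j then 1 else 0)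
  | .inl k, .inl i, .inr _ => B k i + a k * a i
  | .inl k, .inr _, .inl i => B k i + a k * a i
  | .inr _, .inl i, .inl j => 2 * (if i = j then 1 else 0)
  | .inr _, .inl i, .inr _ => -a i
  | .inr _, .inr _, .inl i => -a i
  | .inl _, .inr _, .inr _ => 0
  | .inr _, .inr _, .inr _ => 0

/-- The second derivatives of the Beltrami metric in the normalised frame, up to a factor. -/
noncomputable def beltramiJet₂ :
    Fin 3 ⊕ Unit → Fin 3 ⊕ Unit → Fin 3 ⊕ Unit → Fin 3 ⊕ Unit → ℝ
  | .inl k, .inl l, .inl i, .inl j => Q k l i j + 2 * a k * a l * (if i = j then 1 else 0)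
      - 2 * (a k * N l i j + a l * N k i j)
      + (B k i + a k * a i) * (B l j + a l * a j) + (B k j + a k * a j) * (B l i + a l * a i)
  | .inl k, .inl l, .inl i, .inr _ => C k l i + a k * B l i + a l * B k i + 2 * a k * a l * a i
  | .inl k, .inl l, .inr _, .inl i => C k l i + a k * B l i + a l * B k i + 2 * a k * a l * a i
  | .inl k, .inr _, .inl i, .inl j => 2 * N k i j - 2 * a k * (if i = j then 1 else 0)
      - (B k i + a k * a i) * a j - (B k j + a k * a j) * a i
  | .inr _, .inl k, .inl i, .inl j => 2 * N k i j - 2 * a k * (if i = j then 1 else 0)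
      - (B k i + a k * a i) * a j - (B k j + a k * a j) * a i
  | .inl k, .inr _, .inl i, .inr _ => -B k i - 2 * a k * a i
  | .inl k, .inr _, .inr _, .inl i => -B k i - 2 * a k * a i
  | .inr _, .inl k, .inl i, .inr _ => -B k i - 2 * a k * a i
  | .inr _, .inl k, .inr _, .inl i => -B k i - 2 * a k * a i
  | .inr _, .inr _, .inl i, .inl j => 2 * (if i = j then 1 else 0) + 2 * a i * a j
  | .inr _, .inr _, .inl i, .inr _ => 2 * a i
  | .inr _, .inr _, .inr _, .inl i => 2 * a i
  | _, _, .inr _, .inr _ => 0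

variable {a B C N Q}

theorem jetRicci_beltrami
    (hB : ∀ i : Fin 3, B i (i + 1) - B (i + 1) i = -2 * a (i + 2))
    (hC : ∀ w i : Fin 3, C w i (i + 1) - C w (i + 1) i
      = -2 * ((1 / 2 * ∑ l, N w l l) * a (i + 2) + B w (i + 2) - ∑ l, N w (i + 2) l * a l))
    (hCs : ∀ x y i, C x y i = C y x i) (hN : ∀ x i j, N x i j = N x j i)
    (hQ : ∀ x y i j, Q x y i j = Q y x i j) (hQ' : ∀ x y i j, Q x y i j = Q x y j i)
    (v w : Fin 3 ⊕ Unit) :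
    jetRicci (beltramiJet₁ a B N) (beltramiJet₂ a B C N Q) v w =
      Sum.elim (fun i => Sum.elim (fun j => jetRicci N Q i j - 2 * (if i = j then 1 else 0))
        (fun _ => 0) w) (fun _ => 0) v := by
  have b10 := hB 0
  have b21 := hB 1
  have b20 := hB 2
  have c01 := fun w => hC w 0
  have c12 := fun w => hC w 1
  have c20 := fun w => hC w 2
  simp only [Fin.isValue, zero_add, Fin.reduceAdd, Fin.sum_univ_three] at b10 b20 b21 c01 c12 c20
  rw [sub_eq_iff_eq_add, ← sub_eq_iff_eq_add'] at b10 b20 b21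
  have b22 : B 2 2 = (N 0 0 0 * a 0 + N 0 0 1 * a 1 + N 0 0 2 * a 2 + N 1 1 0 * a 0 + N 1 1 1 * a 1
      + N 1 1 2 * a 2 + N 2 2 0 * a 0 + N 2 2 1 * a 1 + N 2 2 2 * a 2)
      - 1 / 2 * ((N 0 0 0 + N 0 1 1 + N 0 2 2) * a 0 + (N 1 0 0 + N 1 1 1 + N 1 2 2) * a 1
      + (N 2 0 0 + N 2 1 1 + N 2 2 2) * a 2) - B 0 0 - B 1 1 := by
    linarith [c01 2, c12 0, c20 1, hCs 0 1 2, hCs 0 2 1, hCs 1 2 0]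
  simp only [Fin.isValue, hN _ 1 0, hN _ 2 0, hN _ 2 1] at c01 c12 c20
  simp only [jetRicci, Fintype.sum_sum_type, Finset.univ_unique, Finset.sum_singleton,
    Fin.sum_univ_three]
  rcases v with i | i <;> rcases w with j | j
  · simp only [beltramiJet₁, beltramiJet₂, Sum.elim_inl]
    fin_cases i <;> fin_cases j <;>
    · simp only [Fin.zero_eta, Fin.mk_one, Fin.reduceFinMk, Fin.isValue, Fin.reduceEq, if_true,
        if_false, ← b10, ← b21, ← b20, b22, hN _ 1 0, hN _ 2 0, hN _ 2 1, hQ 1 0, hQ 2 0, hQ 2 1,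
        hQ' _ _ 1 0, hQ' _ _ 2 0, hQ' _ _ 2 1]
      ring
  · simp only [beltramiJet₁, beltramiJet₂, Sum.elim_inl, Sum.elim_inr]
    fin_cases i <;>
      simp only [Fin.zero_eta, Fin.mk_one, Fin.reduceFinMk, Fin.isValue, Fin.reduceEq,
        if_true, if_false, ← b10, ← b21, ← b20, b22, hN _ 1 0, hN _ 2 0, hN _ 2 1]
    · linear_combination 1 / 2 * c01 1 - 1 / 2 * c20 2 + 1 / 2 * hCs 0 1 1 + 1 / 2 * hCs 0 2 2 - b21
    · linear_combination 1 / 2 * c12 2 - 1 / 2 * c01 0 + 1 / 2 * hCs 1 2 2 + 1 / 2 * hCs 1 0 0 - b20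
    · linear_combination 1 / 2 * c20 0 - 1 / 2 * c12 1 + 1 / 2 * hCs 2 0 0 + 1 / 2 * hCs 2 1 1 - b10
  · simp only [beltramiJet₁, beltramiJet₂, Sum.elim_inr]
    fin_cases j <;>
      simp only [Fin.zero_eta, Fin.mk_one, Fin.reduceFinMk, Fin.isValue, Fin.reduceEq,
        if_true, if_false, ← b10, ← b21, ← b20, b22, hN _ 1 0, hN _ 2 0, hN _ 2 1]
    · linear_combination 1 / 2 * c01 1 - 1 / 2 * c20 2 - b21
    · linear_combination 1 / 2 * c12 2 - 1 / 2 * c01 0 - b20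
    · linear_combination 1 / 2 * c20 0 - 1 / 2 * c12 1 - b10
  · simp only [beltramiJet₁, beltramiJet₂, Sum.elim_inr]
    simp only [Fin.isValue, Fin.reduceEq, if_true,
        if_false, ← b10, ← b21, ← b20, b22, hN _ 1 0, hN _ 2 0, hN _ 2 1]
    ring

end JetAlgebra

section RicciBilinear

variable {E : Type*} [NormedAddCommGroup E] [NormedSpace ℝ E] [FiniteDimensional ℝ E]

/-- The Ricci tensor as a bilinear map. -/
noncomputable def ricciL (G : E → E →L[ℝ] E →L[ℝ] ℝ) (y : E) : E →ₗ[ℝ] E →ₗ[ℝ] ℝ :=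
  LinearMap.mk₂ ℝ (fun v w => ∑ i, (Module.finBasis ℝ E).coord i
      (curvatureL G y v w (Module.finBasis ℝ E i)))
    (fun v v' w => by
      rw [← Finset.sum_add_distrib]
      refine Finset.sum_congr rfl fun i _ => ?_
      simp only [curvatureL, LinearMap.coe_mk, AddHom.coe_mk, map_add, map_sub, add_apply]
      ring)
    (fun c v w => by
      rw [smul_eq_mul, Finset.mul_sum]
      refine Finset.sum_congr rfl fun i _ => ?_
      simp only [curvatureL, LinearMap.coe_mk, AddHom.coe_mk, map_smul, smul_apply,
        map_add, map_sub, smul_eq_mul]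
      ring)
    (fun v w w' => by
      rw [← Finset.sum_add_distrib]
      refine Finset.sum_congr rfl fun i _ => ?_
      simp only [curvatureL, LinearMap.coe_mk, AddHom.coe_mk, map_add, map_sub]
      ring)
    (fun c v w => by
      rw [smul_eq_mul, Finset.mul_sum]
      refine Finset.sum_congr rfl fun i _ => ?_
      simp only [curvatureL, LinearMap.coe_mk, AddHom.coe_mk, map_smul,
        map_add, map_sub, smul_eq_mul]
      ring)

lemma ricciE_eq_ricciL {G : E → E →L[ℝ] E →L[ℝ] ℝ} {y : E} (hG : ContDiffAt ℝ 2 G y)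
    (hi : (G y).IsInvertible) (v w : E) : ricciE G y v w = ricciL G y v w := by
  have : CompleteSpace E := FiniteDimensional.complete ℝ E
  have hΓ : DifferentiableAt ℝ (christoffelL G) y :=
    (contDiffAt_christoffelL (m := 1) hG hi (by norm_num)).differentiableAt (by simp)
  simp only [ricciE, curvatureE_eq hΓ]
  rfl

end RicciBilinear

section BeltramiRicci

variable {E : Type*} [NormedAddCommGroup E] [NormedSpace ℝ E] [FiniteDimensional ℝ E]

lemma isInvertible_of_injective {B : E →L[ℝ] E →L[ℝ] ℝ} (hB : ∀ u, (∀ v, B u v = 0) → u = 0) :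
    B.IsInvertible := by
  have inj : Function.Injective B := by
    rw [injective_iff_map_eq_zero]
    intro u hu
    exact hB u fun v => by rw [hu]; rfl
  have hd : Module.finrank ℝ E = Module.finrank ℝ (E →L[ℝ] ℝ) := by
    rw [← (LinearMap.toContinuousLinearMap : (E →ₗ[ℝ] ℝ) ≃ₗ[ℝ] _).finrank_eq,
      Subspace.dual_finrank_eq]
  exact ⟨(LinearEquiv.ofInjectiveOfFinrankEq (B : E →ₗ[ℝ] E →L[ℝ] ℝ) inj
    hd).toContinuousLinearEquiv, by ext; rfl⟩

lemma isInvertible_of_orthogonal {ι : Type*} [Fintype ι] [DecidableEq ι] {B : E →L[ℝ] E →L[ℝ] ℝ}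
    (b : Module.Basis ι ℝ E) (l : ι → ℝ) (hl : ∀ i, l i ≠ 0)
    (h : ∀ i j, B (b i) (b j) = if i = j then l i else 0) : B.IsInvertible := by
  refine isInvertible_of_injective fun u hu => ?_
  rw [← b.sum_repr u]
  refine Finset.sum_eq_zero fun j _ => ?_
  have := hu (b j)
  rw [← b.sum_repr u] at this
  simp only [map_sum, map_smul, sum_apply, smul_apply, h, smul_eq_mul, mul_ite, mul_zero,
    Finset.sum_ite_eq', Finset.mem_univ, if_true, mul_eq_zero, hl, or_false] at this
  rw [this, zero_smul]

end BeltramiRicci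

section JetRicci

variable {E : Type*} [NormedAddCommGroup E] [NormedSpace ℝ E] [FiniteDimensional ℝ E]

lemma ricciE_eq_jetRicci {ι : Type*} [Fintype ι] [DecidableEq ι]
    {G : E → E →L[ℝ] E →L[ℝ] ℝ} {y : E} (hG : ContDiffAt ℝ 2 G y)
    (hs : ∀ᶠ z in 𝓝 y, ∀ v w, G z v w = G z w v) (hi : (G y).IsInvertible)
    (b : Module.Basis ι ℝ E) (hb : ∀ i j, G y (b i) (b j) = if i = j then 1 else 0) (v w : ι) :
    ricciE G y (b v) (b w) = jetRicci (fun x v w => fderiv ℝ G y (b x) (b v) (b w))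
      (fun x z v w => fderiv ℝ (fderiv ℝ G) y (b x) (b z) (b v) (b w)) v w := by
  rw [ricciE_frame hG hs hi b (fun _ => 1) (by simp) (fun i => by simp [hb])
    (fun i j hij => by simp [hb, hij])]
  simp only [jetRicci, koszulE_apply, curvatureSecond, inv_one, one_mul]

end JetRicci

section Frame

variable {E : Type*} [NormedAddCommGroup E] [NormedSpace ℝ E]

/-- The orthonormal frame of normalised horizontal lifts, completed by `∂/∂ρ`. -/
noncomputable def liftBasis (e : Module.Basis (Fin 3) ℝ E) (α : E →L[ℝ] ℝ) {ρ : ℝ} (hρ : ρ ≠ 0) :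
    Module.Basis (Fin 3 ⊕ Unit) ℝ (E × ℝ) :=
  (e.prod (Module.Basis.singleton Unit ℝ)).map
    { toFun := fun q => (ρ⁻¹ • q.1, q.2 - α q.1 / ρ ^ 2)
      invFun := fun q => (ρ • q.1, q.2 + α q.1 / ρ)
      map_add' := fun q q' => by ext <;> simp; ring
      map_smul' := fun c q => by
        ext
        · exact smul_comm _ _ _
        · simp; ring
      left_inv := fun q => by
        ext
        · simp [hρ]
        · simp; field_simp; ring
      right_inv := fun q => by
        ext
        · simp [hρ]
        · simp; field_simp; ring }

lemma liftBasis_inl (e : Module.Basis (Fin 3) ℝ E) (α : E →L[ℝ] ℝ) {ρ : ℝ} (hρ : ρ ≠ 0)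
    (i : Fin 3) : liftBasis e α hρ (Sum.inl i) = (ρ⁻¹ • e i, -(α (e i) / ρ ^ 2)) := by
  simp [liftBasis, Module.Basis.prod_apply]

lemma liftBasis_inr (e : Module.Basis (Fin 3) ℝ E) (α : E →L[ℝ] ℝ) {ρ : ℝ} (hρ : ρ ≠ 0)
    (i : Unit) : liftBasis e α hρ (Sum.inr i) = (0, 1) := by
  simp [liftBasis, Module.Basis.prod_apply]

lemma fderiv_fderiv_apply_symm {H : E → E →L[ℝ] E →L[ℝ] ℝ} {y : E} (hH : ContDiffAt ℝ 2 H y)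
    (hs : ∀ᶠ z in 𝓝 y, ∀ v w, H z v w = H z w v) (a b v w : E) :
    fderiv ℝ (fderiv ℝ H) y a b v w = fderiv ℝ (fderiv ℝ H) y a b w v := by
  have hd : DifferentiableAt ℝ (fderiv ℝ H) y :=
    (hH.fderiv_right (m := 1) (by norm_num)).differentiableAt (by simp)
  have h1 : (fun z => fderiv ℝ H z b v w) =ᶠ[𝓝 y] fun z => fderiv ℝ H z b w v := by
    filter_upwards [hs.eventually_nhds, hH.eventually (by simp)] with z hz hz'
    exact fderiv_apply_symm hz (hz'.differentiableAt (by simp)) b v w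
  have e := fun v w => hasFDerivAt_apply_const (hasFDerivAt_apply_const
    (hasFDerivAt_apply_const hd.hasFDerivAt b) v) w
  have := h1.fderiv_eq (𝕜 := ℝ)
  rw [(e v w).fderiv, (e w v).fderiv] at this
  exact DFunLike.congr_fun this a

variable [FiniteDimensional ℝ E] {H : E → E →L[ℝ] E →L[ℝ] ℝ} {α : E → E →L[ℝ] ℝ} {p : E × ℝ}

theorem ricciE_beltramiE (hp : p.2 ≠ 0) (hH : ContDiffAt ℝ 2 H p.1) (hα : ContDiffAt ℝ 2 α p.1)
    (hs : ∀ᶠ z in 𝓝 p.1, ∀ v w, H z v w = H z w v) (e : Module.Basis (Fin 3) ℝ E)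
    (he : ∀ i j, H p.1 (e i) (e j) = if i = j then 1 else 0)
    (hB : ∀ i : Fin 3, fderiv ℝ α p.1 (e i) (e (i + 1)) - fderiv ℝ α p.1 (e (i + 1)) (e i)
      = -2 * α p.1 (e (i + 2)))
    (hC : ∀ w i : Fin 3, fderiv ℝ (fderiv ℝ α) p.1 (e w) (e i) (e (i + 1))
      - fderiv ℝ (fderiv ℝ α) p.1 (e w) (e (i + 1)) (e i)
      = -2 * ((1 / 2 * ∑ l, fderiv ℝ H p.1 (e w) (e l) (e l)) * α p.1 (e (i + 2))
        + fderiv ℝ α p.1 (e w) (e (i + 2))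
        - ∑ l, fderiv ℝ H p.1 (e w) (e (i + 2)) (e l) * α p.1 (e l)))
    (V W : E × ℝ) :
    ricciE (beltramiE H α) p V W = ricciE H p.1 V.1 W.1 - 2 * H p.1 V.1 W.1 := by
  have hG := contDiffAt_beltramiE hp hH hα
  have hiH : (H p.1).IsInvertible := isInvertible_of_orthogonal e (fun _ => 1) (by simp) he
  set b := liftBasis e (α p.1) hp with hb
  have hbG : ∀ i j, beltramiE H α p (b i) (b j) = if i = j then 1 else 0 := by
    rintro (i | i) (j | j) <;>
      simp [hb, liftBasis_inl, liftBasis_inr, beltramiE_apply hp, he] <;> field_simp <;> simp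
  have hiG : (beltramiE H α p).IsInvertible := isInvertible_of_orthogonal b _ (by simp) hbG
  have hsG : ∀ᶠ z in 𝓝 p, ∀ v w, beltramiE H α z v w = beltramiE H α z w v := by
    have h0 : ∀ᶠ q in 𝓝 p, q.2 ≠ 0 := continuousAt_snd.eventually_ne hp
    filter_upwards [h0, continuousAt_fst.eventually hs] with z h0 h1 v w
    rw [beltramiE_apply h0, beltramiE_apply h0, h1 v.1 w.1]
    ring
  rw [ricciE_eq_ricciL hG hiG, ricciE_eq_ricciL hH hiH]
  have symC : ∀ x y, fderiv ℝ (fderiv ℝ α) p.1 x y = fderiv ℝ (fderiv ℝ α) p.1 y x :=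
    fun x y => (hα.isSymmSndFDerivAt (by simp)).eq x y
  have symQ : ∀ x y, fderiv ℝ (fderiv ℝ H) p.1 x y = fderiv ℝ (fderiv ℝ H) p.1 y x :=
    fun x y => (hH.isSymmSndFDerivAt (by simp)).eq x y
  have symQ' := fderiv_fderiv_apply_symm hH hs
  have symN := fderiv_apply_symm hs (hH.differentiableAt (by simp))
  have d1 := fderiv_beltramiE hp (hH.differentiableAt (by simp)) (hα.differentiableAt (by simp))
    (hG.differentiableAt (by simp))
  have d2 := fderiv_fderiv_beltramiE hp hH hα
  have frG : ∀ v w, ricciE (beltramiE H α) p (b v) (b w) = _ := fun v w =>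
    ricciE_eq_jetRicci hG hsG hiG b hbG v w
  have frH : ∀ v w, ricciE H p.1 (e v) (e w) = _ := fun v w =>
    ricciE_eq_jetRicci hH hs hiH e he v w
  suffices h : ricciL (beltramiE H α) p = (ricciL H p.1
      - (2 : ℝ) • ((ContinuousLinearMap.coeLM ℝ).comp (H p.1 : E →ₗ[ℝ] E →L[ℝ] ℝ))).compl₁₂
        (LinearMap.fst ℝ E ℝ) (LinearMap.fst ℝ E ℝ) by
    rw [h]; simp
  set a : Fin 3 → ℝ := fun i => α p.1 (e i) / p.2 ^ 2 with ha
  set B : Fin 3 → Fin 3 → ℝ := fun i j => fderiv ℝ α p.1 (e i) (e j) / p.2 ^ 2 with hBdef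
  set C : Fin 3 → Fin 3 → Fin 3 → ℝ :=
    fun w i j => fderiv ℝ (fderiv ℝ α) p.1 (e w) (e i) (e j) / p.2 ^ 2 with hCdef
  set N : Fin 3 → Fin 3 → Fin 3 → ℝ := fun w i j => fderiv ℝ H p.1 (e w) (e i) (e j) with hN
  set Q : Fin 3 → Fin 3 → Fin 3 → Fin 3 → ℝ :=
    fun w x i j => fderiv ℝ (fderiv ℝ H) p.1 (e w) (e x) (e i) (e j) with hQ
  have t1 : ∀ x v w, fderiv ℝ (beltramiE H α) p (b x) (b v) (b w)
      = p.2⁻¹ * beltramiJet₁ a B N x v w := by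
    rintro (x | x) (v | v) (w | w) <;>
    · simp only [d1, hb, liftBasis_inl, liftBasis_inr, beltramiJet₁, ha, hBdef, hN, etaDeriv,
        map_smul, smul_apply, smul_eq_mul, he, map_zero, zero_apply]
      field_simp
      ring
  have t2 : ∀ x y v w, fderiv ℝ (fderiv ℝ (beltramiE H α)) p (b x) (b y) (b v) (b w)
      = (p.2 ^ 2)⁻¹ * beltramiJet₂ a B C N Q x y v w := by
    rintro (x | x) (y | y) (v | v) (w | w) <;>
    · simp only [d2, hb, liftBasis_inl, liftBasis_inr, beltramiJet₂, ha, hBdef, hN, hCdef, hQ,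
        etaDeriv, etaDeriv₂, map_smul, smul_apply, smul_eq_mul, he, map_zero, zero_apply]
      field_simp
      ring
  have main := jetRicci_beltrami (a := a) (B := B) (C := C) (N := N) (Q := Q)
    (fun i => by simp only [ha, hBdef]; rw [← sub_div, hB]; ring)
    (fun w i => by
      simp only [ha, hBdef, hCdef, hN]
      rw [← sub_div, hC, Finset.sum_congr rfl fun l _ => (mul_div_assoc _ _ _).symm,
        ← Finset.sum_div]
      ring)
    (fun x y i => by simp only [hCdef, symC (e x) (e y)]) (fun x i j => symN _ _ _)
    (fun x y i j => by simp only [hQ, symQ (e x) (e y)]) (fun x y i j => symQ' _ _ _ _)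
  refine LinearMap.ext_basis b b fun v w => ?_
  have scale : jetRicci (fun x v w => fderiv ℝ (beltramiE H α) p (b x) (b v) (b w))
      (fun x y v w => fderiv ℝ (fderiv ℝ (beltramiE H α)) p (b x) (b y) (b v) (b w)) v w
      = (p.2 ^ 2)⁻¹ * jetRicci (beltramiJet₁ a B N) (beltramiJet₂ a B C N Q) v w := by
    simp only [jetRicci, t1, t2, Finset.mul_sum, mul_add]
    refine Finset.sum_congr rfl fun x _ => ?_
    congr 1
    · ring
    · refine Finset.sum_congr rfl fun c _ => ?_
      ring
  rw [← ricciE_eq_ricciL hG hiG, frG, scale, main]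
  rcases v with i | i <;> rcases w with j | j
  · simp only [hb, liftBasis_inl, Sum.elim_inl, LinearMap.compl₁₂_apply, LinearMap.fst_apply,
      map_smul, LinearMap.smul_apply, LinearMap.sub_apply, ← ricciE_eq_ricciL hH hiH, frH,
      LinearMap.comp_apply, ContinuousLinearMap.coe_coe, ContinuousLinearMap.coeLM_apply,
      smul_eq_mul, he]
    ring
  · simp [hb, liftBasis_inl, liftBasis_inr]
  · simp [hb, liftBasis_inr]
  · simp [hb, liftBasis_inr]

end Frame

/-! ### Readings in charts -/

section Readings

variable {𝕜 : Type*} [NontriviallyNormedField 𝕜]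
  {E : Type*} [NormedAddCommGroup E] [NormedSpace 𝕜 E]
  {H : Type*} [TopologicalSpace H] (I : ModelWithCorners 𝕜 E H)
  {E' : Type*} [NormedAddCommGroup E'] [NormedSpace 𝕜 E']
  {H' : Type*} [TopologicalSpace H'] (I' : ModelWithCorners 𝕜 E' H')
  {M : Type*} [TopologicalSpace M] [ChartedSpace H M]
  {M' : Type*} [TopologicalSpace M'] [ChartedSpace H' M']

/-- The differential at `x` of the preferred chart at `x₀`. -/
noncomputable def chartReading (x₀ x : M) : TangentSpace I x →L[𝕜] E :=
  mfderiv I 𝓘(𝕜, E) (extChartAt I x₀) x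

/-- The inverse of the differential at `x` of the preferred chart at `x₀`. -/
noncomputable def chartReadingSymm (x₀ x : M) : E →L[𝕜] TangentSpace I x :=
  mfderivWithin 𝓘(𝕜, E) I (extChartAt I x₀).symm (range I) (extChartAt I x₀ x)

lemma bilinInChart_symm {x₀ x : M} (hx : x ∈ (extChartAt I x₀).source) (T : BilinField I M)
    (u v : E) : bilinInChart I T x₀ (extChartAt I x₀ x) u v
      = T x (chartReadingSymm I x₀ x u) (chartReadingSymm I x₀ x v) := by
  have key : ∀ z, z = x → ∀ D : E →L[𝕜] E,
      (T z : E →L[𝕜] E →L[𝕜] 𝕜) (D u) (D v) = (T x : E →L[𝕜] E →L[𝕜] 𝕜) (D u) (D v) := by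
    rintro z rfl D; rfl
  exact key _ ((extChartAt I x₀).left_inv hx) _

/-- The expression of a map in two charts. -/
def mapInCharts (f : M → M') (x₀ : M) (x₀' : M') (y : E) : E' :=
  extChartAt I' x₀' (f ((extChartAt I x₀).symm y))

lemma mapInCharts_apply {x₀ x : M} (hx : x ∈ (extChartAt I x₀).source) (f : M → M') (x₀' : M') :
    mapInCharts I I' f x₀ x₀' (extChartAt I x₀ x) = extChartAt I' x₀' (f x) := by
  rw [mapInCharts, (extChartAt I x₀).left_inv hx]

section

variable [IsManifold I 1 M] [IsManifold I' 1 M']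

@[simp] lemma chartReading_self (x : M) (v : TangentSpace I x) : chartReading I x x v = v := by
  have := mfderiv_extChartAt_self (I := I) (x := x)
  exact DFunLike.congr_fun this v

@[simp] lemma chartDifferential_apply (x : M) (v : TangentSpace I x) :
    chartDifferential I x v = v := chartReading_self I x v

lemma chartReading_symm {x₀ x : M} (hx : x ∈ (extChartAt I x₀).source) (v : E) :
    chartReading I x₀ x (chartReadingSymm I x₀ x v) = v :=
  DFunLike.congr_fun (mfderiv_extChartAt_comp_mfderivWithin_extChartAt_symm' (I := I) hx) v

lemma chartReadingSymm_reading {x₀ x : M} (hx : x ∈ (extChartAt I x₀).source)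
    (v : TangentSpace I x) : chartReadingSymm I x₀ x (chartReading I x₀ x v) = v :=
  DFunLike.congr_fun (mfderivWithin_extChartAt_symm_comp_mfderiv_extChartAt' (I := I) hx) v

/-- The differential of a chart as a continuous linear equivalence. -/
noncomputable def chartReadingEquiv {x₀ x : M} (hx : x ∈ (extChartAt I x₀).source) :
    TangentSpace I x ≃L[𝕜] E :=
  ContinuousLinearEquiv.equivOfInverse (chartReading I x₀ x) (chartReadingSymm I x₀ x)
    (chartReadingSymm_reading I hx) (chartReading_symm I hx)

lemma bilinInChart_reading {x₀ x : M} (hx : x ∈ (extChartAt I x₀).source) (T : BilinField I M)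
    (u v : TangentSpace I x) : bilinInChart I T x₀ (extChartAt I x₀ x)
      (chartReading I x₀ x u) (chartReading I x₀ x v) = T x u v := by
  rw [bilinInChart_symm I hx, chartReadingSymm_reading I hx, chartReadingSymm_reading I hx]

lemma oneFormInChart_reading {x₀ x : M} (hx : x ∈ (extChartAt I x₀).source) (α : OneForm I M)
    (u : TangentSpace I x) : oneFormInChart I α x₀ (extChartAt I x₀ x) (chartReading I x₀ x u)
      = α x u := by
  have key : ∀ z, z = x → ∀ D : E →L[𝕜] E, ∀ u : E,
      (α z : E →L[𝕜] 𝕜) (D u) = (α x : E →L[𝕜] 𝕜) (D u) := by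
    rintro z rfl D; exact fun _ => rfl
  refine (key _ ((extChartAt I x₀).left_inv hx) (chartReadingSymm I x₀ x)
    (chartReading I x₀ x u)).trans ?_
  exact congrArg (α x) (chartReadingSymm_reading I hx u)

lemma vfieldInChart_reading {x₀ x : M} (hx : x ∈ (extChartAt I x₀).source) (X : VField I M) :
    vfieldInChart I X x₀ (extChartAt I x₀ x) = chartReading I x₀ x (X x) := by
  have key : ∀ z, z = x → ∀ D : E →L[𝕜] E, D.inverse (X z : E) = D.inverse (X x : E) := by
    rintro z rfl D; rfl
  refine (key _ ((extChartAt I x₀).left_inv hx) (chartReadingSymm I x₀ x)).trans ?_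
  have : (chartReadingSymm I x₀ x : E →L[𝕜] TangentSpace I x)
      = ((chartReadingEquiv I hx).symm : E →L[𝕜] TangentSpace I x) := rfl
  exact (congrArg (fun D : E →L[𝕜] TangentSpace I x => D.inverse (X x)) this).trans
    (by rw [ContinuousLinearMap.inverse_equiv]; rfl)

lemma bilinInChart_self (x : M) (T : BilinField I M) (u v : TangentSpace I x) :
    bilinInChart I T x (extChartAt I x x) u v = T x u v :=
  (congrArg₂ (fun a b : E => bilinInChart I T x (extChartAt I x x) a b)
    (chartReading_self I x u) (chartReading_self I x v)).symm.trans
    (bilinInChart_reading I (mem_extChartAt_source x) T u v)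

lemma oneFormInChart_self (x : M) (α : OneForm I M) (u : TangentSpace I x) :
    oneFormInChart I α x (extChartAt I x x) u = α x u :=
  (congrArg (fun a : E => oneFormInChart I α x (extChartAt I x x) a)
    (chartReading_self I x u)).symm.trans
    (oneFormInChart_reading I (mem_extChartAt_source x) α u)

lemma hasFDerivAt_mapInCharts [I.Boundaryless] {f : M → M'} {x₀ x : M} {x₀' : M'}
    (hx : x ∈ (extChartAt I x₀).source) (hfx : f x ∈ (extChartAt I' x₀').source)
    (hf : MDifferentiableAt I I' f x) :
    HasFDerivAt (mapInCharts I I' f x₀ x₀')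
      ((chartReading I' x₀' (f x)).comp ((mfderiv I I' f x).comp (chartReadingSymm I x₀ x)))
      (extChartAt I x₀ x) := by
  have hx' : extChartAt I x₀ x ∈ (extChartAt I x₀).target := (extChartAt I x₀).map_source hx
  have e0 : (extChartAt I x₀).symm (extChartAt I x₀ x) = x := (extChartAt I x₀).left_inv hx
  have h1 : HasMFDerivAt 𝓘(𝕜, E) I (extChartAt I x₀).symm (extChartAt I x₀ x)
      (chartReadingSymm I x₀ x) := by
    have := (mdifferentiableWithinAt_extChartAt_symm hx').hasMFDerivWithinAt
    rw [I.range_eq_univ, hasMFDerivWithinAt_univ] at this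
    have e : chartReadingSymm I x₀ x = mfderivWithin 𝓘(𝕜, E) I (extChartAt I x₀).symm univ
      (extChartAt I x₀ x) := by rw [chartReadingSymm, I.range_eq_univ]
    rw [e]
    exact this
  have h2 : HasMFDerivAt I' 𝓘(𝕜, E') (extChartAt I' x₀') (f x) (chartReading I' x₀' (f x)) :=
    (mdifferentiableAt_extChartAt (by rwa [← extChartAt_source (I := I')])).hasMFDerivAt
  have h3 := h2.comp x hf.hasMFDerivAt
  have key : ∀ z, z = x → HasMFDerivAt I 𝓘(𝕜, E') (extChartAt I' x₀' ∘ f) z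
      ((chartReading I' x₀' (f x)).comp (mfderiv I I' f x) : E →L[𝕜] E') := by
    rintro z rfl; exact h3
  exact ((key _ e0).comp _ h1).hasFDerivAt

end

end Readings

/-! ### Smoothness of the readings -/

lemma contDiffAt_clm_of_apply {𝕜 D E F : Type*} [NontriviallyNormedField 𝕜] [CompleteSpace 𝕜]
    [NormedAddCommGroup D] [NormedSpace 𝕜 D] [NormedAddCommGroup E] [NormedSpace 𝕜 E]
    [NormedAddCommGroup F] [NormedSpace 𝕜 F] [FiniteDimensional 𝕜 E] {n : WithTop ℕ∞}
    {f : D → E →L[𝕜] F} {x : D} (h : ∀ y, ContDiffAt 𝕜 n (fun x => f x y) x) :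
    ContDiffAt 𝕜 n f x := by
  let d := Module.finrank 𝕜 E
  have hd : d = Module.finrank 𝕜 (Fin d → 𝕜) := (Module.finrank_fin_fun 𝕜).symm
  let e₁ := ContinuousLinearEquiv.ofFinrankEq hd
  let e₂ := (e₁.arrowCongr (1 : F ≃L[𝕜] F)).trans (ContinuousLinearEquiv.piRing (Fin d))
  rw [← Function.id_comp f, ← e₂.symm_comp_self]
  exact e₂.symm.contDiff.contDiffAt.comp x (contDiffAt_pi.mpr fun i => h _)

section Smoothness

variable {𝕜 : Type*} [NontriviallyNormedField 𝕜] [CompleteSpace 𝕜]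
  {E : Type*} [NormedAddCommGroup E] [NormedSpace 𝕜 E]
  {H : Type*} [TopologicalSpace H] (I : ModelWithCorners 𝕜 E H) [I.Boundaryless]
  {E' : Type*} [NormedAddCommGroup E'] [NormedSpace 𝕜 E']
  {H' : Type*} [TopologicalSpace H'] (I' : ModelWithCorners 𝕜 E' H')
  {M : Type*} [TopologicalSpace M] [ChartedSpace H M] [IsManifold I ω M]
  {M' : Type*} [TopologicalSpace M'] [ChartedSpace H' M'] [IsManifold I' ω M']
  {n : WithTop ℕ∞}

lemma contDiffAt_comp_extChartAt_symm {F : Type*} [NormedAddCommGroup F] [NormedSpace 𝕜 F]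
    {f : M → F} {x₀ x : M} (hx : x ∈ (extChartAt I x₀).source)
    (hf : ContMDiffAt I 𝓘(𝕜, F) n f x) :
    ContDiffAt 𝕜 n (fun y => f ((extChartAt I x₀).symm y)) (extChartAt I x₀ x) := by
  have : IsManifold I n M := .of_le le_top
  rw [← contMDiffAt_iff_contDiffAt]
  have hx' : extChartAt I x₀ x ∈ (extChartAt I x₀).target := (extChartAt I x₀).map_source hx
  have h1 : ContMDiffAt 𝓘(𝕜, E) I n (extChartAt I x₀).symm (extChartAt I x₀ x) :=
    (contMDiffOn_extChartAt_symm x₀).contMDiffAt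
      ((isOpen_extChartAt_target x₀).mem_nhds hx')
  exact ContMDiffAt.comp (I' := I) _ (by rwa [(extChartAt I x₀).left_inv hx]) h1

lemma contDiffAt_mapInCharts {f : M → M'} {x₀ x : M} {x₀' : M'}
    (hx : x ∈ (extChartAt I x₀).source) (hfx : f x ∈ (extChartAt I' x₀').source)
    (hf : ContMDiffAt I I' n f x) :
    ContDiffAt 𝕜 n (mapInCharts I I' f x₀ x₀') (extChartAt I x₀ x) := by
  have : IsManifold I' n M' := .of_le le_top
  refine contDiffAt_comp_extChartAt_symm I (f := fun z => extChartAt I' x₀' (f z)) hx ?_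
  exact (contMDiffAt_extChartAt' (I := I') (by rwa [← extChartAt_source (I := I')])).comp x hf

lemma contDiffAt_vfieldInChart [ContMDiffVectorBundle n E (TangentSpace I : M → Type _) I]
    {X : VField I M} {x₀ x : M} (hx : x ∈ (extChartAt I x₀).source)
    (hX : ContMDiffAt I I.tangent n (fun x => (⟨x, X x⟩ : TangentBundle I M)) x) :
    ContDiffAt 𝕜 n (vfieldInChart I X x₀) (extChartAt I x₀ x) := by
  have hx' : x ∈ (trivializationAt E (TangentSpace I) x₀).baseSet := by
    rwa [TangentBundle.trivializationAt_baseSet, ← extChartAt_source (I := I)]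
  have h1 := ((trivializationAt E (TangentSpace I) x₀).contMDiffAt_section_iff hx').1 hX
  refine (contDiffAt_comp_extChartAt_symm I hx h1).congr_of_eventuallyEq ?_
  filter_upwards [(isOpen_extChartAt_target x₀).mem_nhds ((extChartAt I x₀).map_source hx)]
    with y hy
  have hys := (extChartAt I x₀).map_target hy
  have := vfieldInChart_reading I hys X
  rw [(extChartAt I x₀).right_inv hy] at this
  rw [this, chartReading, ← TangentBundle.continuousLinearMapAt_trivializationAt
    (by rwa [← extChartAt_source (I := I)])]
  rw [Trivialization.continuousLinearMapAt_apply, Trivialization.coe_linearMapAt_of_mem _ (by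
    rwa [TangentBundle.trivializationAt_baseSet, ← extChartAt_source (I := I)])]

/-- The vector field with constant expression in a chart is smooth. -/
lemma contMDiffAt_chartReadingSymm [ContMDiffVectorBundle n E (TangentSpace I : M → Type _) I]
    {x₀ x : M} (hx : x ∈ (extChartAt I x₀).source) (v : E) :
    ContMDiffAt I I.tangent n
      (fun x => (⟨x, chartReadingSymm I x₀ x v⟩ : TangentBundle I M)) x := by
  have hx' : x ∈ (trivializationAt E (TangentSpace I) x₀).baseSet := by
    rwa [TangentBundle.trivializationAt_baseSet, ← extChartAt_source (I := I)]
  refine ((trivializationAt E (TangentSpace I) x₀).contMDiffAt_section_iff hx').2 ?_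
  refine (contMDiffAt_const (c := v)).congr_of_eventuallyEq ?_
  filter_upwards [(trivializationAt E (TangentSpace I) x₀).open_baseSet.mem_nhds hx'] with z hz
  have hzs : z ∈ (extChartAt I x₀).source := by
    rwa [TangentBundle.trivializationAt_baseSet, ← extChartAt_source (I := I)] at hz
  have := chartReading_symm I hzs v
  rw [chartReading, ← TangentBundle.continuousLinearMapAt_trivializationAt
    (by rwa [← extChartAt_source (I := I)])] at this
  rwa [Trivialization.continuousLinearMapAt_apply, Trivialization.coe_linearMapAt_of_mem _ hz]
    at this

lemma contDiffAt_oneFormInChart [FiniteDimensional 𝕜 E]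
    [ContMDiffVectorBundle n E (TangentSpace I : M → Type _) I]
    {α : OneForm I M} {x₀ x : M} (hx : x ∈ (extChartAt I x₀).source)
    (hα : ContMDiffAt I (I.prod 𝓘(𝕜, E →L[𝕜] 𝕜)) n
      (fun x => TotalSpace.mk' (E →L[𝕜] 𝕜)
        (E := fun x : M => TangentSpace I x →L[𝕜] 𝕜) x (α x)) x) :
    ContDiffAt 𝕜 n (oneFormInChart I α x₀) (extChartAt I x₀ x) := by
  refine contDiffAt_clm_of_apply fun u => ?_
  have h1 := ContMDiffAt.clm_bundle_apply (F₂ := 𝕜) (E₂ := Bundle.Trivial M 𝕜) hα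
    (contMDiffAt_chartReadingSymm I hx u)
  rw [contMDiffAt_section] at h1
  refine (contDiffAt_comp_extChartAt_symm I hx h1).congr_of_eventuallyEq ?_
  filter_upwards [(isOpen_extChartAt_target x₀).mem_nhds ((extChartAt I x₀).map_source hx)]
    with y hy
  have hys := (extChartAt I x₀).map_target hy
  have := oneFormInChart_reading I hys α (chartReadingSymm I x₀ _ u)
  rw [(extChartAt I x₀).right_inv hy, chartReading_symm I hys] at this
  exact this

lemma contDiffAt_bilinInChart [FiniteDimensional 𝕜 E]
    [ContMDiffVectorBundle n E (TangentSpace I : M → Type _) I]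
    {T : BilinField I M} {x₀ x : M} (hx : x ∈ (extChartAt I x₀).source)
    (hT : ContMDiffAt I (I.prod 𝓘(𝕜, E →L[𝕜] E →L[𝕜] 𝕜)) n
      (fun x => TotalSpace.mk' (E →L[𝕜] E →L[𝕜] 𝕜)
        (E := fun x : M => TangentSpace I x →L[𝕜] TangentSpace I x →L[𝕜] 𝕜) x (T x)) x) :
    ContDiffAt 𝕜 n (bilinInChart I T x₀) (extChartAt I x₀ x) := by
  refine contDiffAt_clm_of_apply fun u => contDiffAt_clm_of_apply fun v => ?_
  have h1 := ContMDiffAt.clm_bundle_apply₂ (F₃ := 𝕜) (E₃ := Bundle.Trivial M 𝕜) hT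
    (contMDiffAt_chartReadingSymm I hx u) (contMDiffAt_chartReadingSymm I hx v)
  rw [contMDiffAt_section] at h1
  refine (contDiffAt_comp_extChartAt_symm I hx h1).congr_of_eventuallyEq ?_
  filter_upwards [(isOpen_extChartAt_target x₀).mem_nhds ((extChartAt I x₀).map_source hx)]
    with y hy
  have hys := (extChartAt I x₀).map_target hy
  have := bilinInChart_reading I hys T (chartReadingSymm I x₀ _ u) (chartReadingSymm I x₀ _ v)
  rw [(extChartAt I x₀).right_inv hy, chartReading_symm I hys, chartReading_symm I hys] at this
  exact this

end Smoothness

/-! ### Naturality of Lie and exterior derivatives -/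

lemma lieDerivE_apply {𝕜 E : Type*} [NontriviallyNormedField 𝕜] [NormedAddCommGroup E]
    [NormedSpace 𝕜 E] {X : E → E} {T : E → E →L[𝕜] E →L[𝕜] 𝕜} (y u v : E) :
    lieDerivE X T y u v = fderiv 𝕜 T y (X y) u v + T y (fderiv 𝕜 X y u) v
      + T y u (fderiv 𝕜 X y v) := rfl

section Naturality

variable {𝕜 : Type*} [NontriviallyNormedField 𝕜] [IsRCLikeNormedField 𝕜]
  {𝕜' : Type*} [NontriviallyNormedField 𝕜'] [NormedAlgebra 𝕜 𝕜']
  {E : Type*} [NormedAddCommGroup E] [NormedSpace 𝕜 E]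
  {E' : Type*} [NormedAddCommGroup E'] [NormedSpace 𝕜 E'] [NormedSpace 𝕜' E']
  [IsScalarTower 𝕜 𝕜' E']

lemma fderiv_fderiv_symm {φ : E → E'} {y : E} (hφ : ContDiffAt 𝕜 2 φ y) (u v : E) :
    fderiv 𝕜 (fderiv 𝕜 φ) y u v = fderiv 𝕜 (fderiv 𝕜 φ) y v u := by
  have := hφ.isSymmSndFDerivAt (by simp)
  exact this.eq u v

/-- The Lie derivative is natural under maps which relate the vector fields and the bilinear
forms; the scalar field of the target may be larger than that of the source. -/
theorem lieDerivE_natural {X : E → E} {T : E → E →L[𝕜] E →L[𝕜] 𝕜} {X' : E' → E'}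
    {T' : E' → E' →L[𝕜'] E' →L[𝕜'] 𝕜'} {φ : E → E'} {y : E} (hφ : ContDiffAt 𝕜 2 φ y)
    (hX : DifferentiableAt 𝕜 X y) (hT : DifferentiableAt 𝕜 T y)
    (hX' : DifferentiableAt 𝕜' X' (φ y)) (hT' : DifferentiableAt 𝕜' T' (φ y))
    (hXX' : ∀ᶠ z in 𝓝 y, X' (φ z) = fderiv 𝕜 φ z (X z))
    (hTT' : ∀ᶠ z in 𝓝 y, ∀ u v,
      T' (φ z) (fderiv 𝕜 φ z u) (fderiv 𝕜 φ z v) = algebraMap 𝕜 𝕜' (T z u v)) (u v : E) :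
    lieDerivE X' T' (φ y) (fderiv 𝕜 φ y u) (fderiv 𝕜 φ y v)
      = algebraMap 𝕜 𝕜' (lieDerivE X T y u v) := by
  have hφ1 : DifferentiableAt 𝕜 φ y := hφ.differentiableAt (by simp)
  have hφ2 : DifferentiableAt 𝕜 (fderiv 𝕜 φ) y :=
    (hφ.fderiv_right (m := 1) (by norm_num)).differentiableAt (by simp)
  have e0 : fderiv 𝕜 φ y (X y) = X' (φ y) := hXX'.self_of_nhds.symm
  have hD : ∀ a, HasFDerivAt (fun z => fderiv 𝕜 φ z a) ((fderiv 𝕜 (fderiv 𝕜 φ) y).flip a) y :=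
    fun a => hasFDerivAt_apply_const hφ2.hasFDerivAt a
  -- derivative of the relation between the vector fields
  have eX : ∀ w, fderiv 𝕜' X' (φ y) (fderiv 𝕜 φ y w)
      = fderiv 𝕜 (fderiv 𝕜 φ) y w (X y) + fderiv 𝕜 φ y (fderiv 𝕜 X y w) := by
    intro w
    have h1 := (hX'.hasFDerivAt.restrictScalars 𝕜).comp y hφ1.hasFDerivAt
    have h2 := hφ2.hasFDerivAt.clm_apply hX.hasFDerivAt
    have h3 := h1.unique (h2.congr_of_eventuallyEq hXX')
    have := DFunLike.congr_fun h3 w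
    simpa [add_comm] using this
  -- derivative of the relation between the forms
  have eT : algebraMap 𝕜 𝕜' (fderiv 𝕜 T y (X y) u v)
      = fderiv 𝕜' T' (φ y) (X' (φ y)) (fderiv 𝕜 φ y u) (fderiv 𝕜 φ y v)
        + T' (φ y) (fderiv 𝕜 (fderiv 𝕜 φ) y (X y) u) (fderiv 𝕜 φ y v)
        + T' (φ y) (fderiv 𝕜 φ y u) (fderiv 𝕜 (fderiv 𝕜 φ) y (X y) v) := by
    have h1 : HasFDerivAt (fun z => algebraMap 𝕜 𝕜' (T z u v)) _ y :=
      (Algebra.linearMap 𝕜 𝕜' |>.mkContinuous 1 (fun x => by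
        simp [norm_algebraMap'])).hasFDerivAt.comp y
        (hasFDerivAt_apply_const (hasFDerivAt_apply_const hT.hasFDerivAt u) v)
    have h2 : HasFDerivAt (𝕜 := 𝕜') (fun q : E' × E' × E' => T' q.1 q.2.1 q.2.2) _
        (φ y, fderiv 𝕜 φ y u, fderiv 𝕜 φ y v) :=
      ((HasFDerivAt.comp (g := T') (φ y, fderiv 𝕜 φ y u, fderiv 𝕜 φ y v) hT'.hasFDerivAt
        hasFDerivAt_fst).clm_apply (hasFDerivAt_fst.comp _ hasFDerivAt_snd)).clm_apply
        (hasFDerivAt_snd.comp _ hasFDerivAt_snd)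
    have h3 := (h2.restrictScalars 𝕜).comp y
      (hφ1.hasFDerivAt.prodMk ((hD u).prodMk (hD v)))
    have h4 := h1.unique (h3.congr_of_eventuallyEq (hTT'.mono fun z hz => (hz u v).symm))
    have h5 := DFunLike.congr_fun h4 (X y)
    simp only [ContinuousLinearMap.comp_apply, ContinuousLinearMap.flip_apply,
      LinearMap.mkContinuous_apply, Algebra.linearMap_apply] at h5
    rw [h5, ← e0]
    simp
    ring
  rw [lieDerivE_apply, lieDerivE_apply, map_add, map_add, eT, eX, eX, map_add, map_add, add_apply,
    ← hTT'.self_of_nhds, ← hTT'.self_of_nhds, fderiv_fderiv_symm (𝕜 := 𝕜) hφ u,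
    fderiv_fderiv_symm (𝕜 := 𝕜) hφ v]
  ring

end Naturality

/-! ### Change of charts -/

section ChartChange

variable {𝕜 : Type*} [NontriviallyNormedField 𝕜]
  {E : Type*} [NormedAddCommGroup E] [NormedSpace 𝕜 E]
  {H : Type*} [TopologicalSpace H] (I : ModelWithCorners 𝕜 E H) [I.Boundaryless]
  {E' : Type*} [NormedAddCommGroup E'] [NormedSpace 𝕜 E']
  {H' : Type*} [TopologicalSpace H'] (I' : ModelWithCorners 𝕜 E' H')
  {M : Type*} [TopologicalSpace M] [ChartedSpace H M]
  {M' : Type*} [TopologicalSpace M'] [ChartedSpace H' M']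

lemma eventually_extChartAt {x₀ x : M} (hx : x ∈ (extChartAt I x₀).source) {P : E → Prop}
    (h : ∀ᶠ z in 𝓝 x, z ∈ (extChartAt I x₀).source → P (extChartAt I x₀ z)) :
    ∀ᶠ y in 𝓝 (extChartAt I x₀ x), P y := by
  have hc : ContinuousAt (extChartAt I x₀).symm (extChartAt I x₀ x) :=
    continuousAt_extChartAt_symm' hx
  rw [ContinuousAt, (extChartAt I x₀).left_inv hx] at hc
  filter_upwards [hc.eventually h,
    (isOpen_extChartAt_target x₀).mem_nhds ((extChartAt I x₀).map_source hx)] with y hy hyt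
  have := hy ((extChartAt I x₀).map_target hyt)
  rwa [(extChartAt I x₀).right_inv hyt] at this

variable [IsManifold I 1 M] [IsManifold I' 1 M']

lemma fderiv_mapInCharts {f : M → M'} {x₀ x : M} {x₀' : M'}
    (hx : x ∈ (extChartAt I x₀).source) (hfx : f x ∈ (extChartAt I' x₀').source)
    (hf : MDifferentiableAt I I' f x) (u : E) :
    fderiv 𝕜 (mapInCharts I I' f x₀ x₀') (extChartAt I x₀ x) u
      = chartReading I' x₀' (f x) (mfderiv I I' f x (chartReadingSymm I x₀ x u)) := by
  rw [(hasFDerivAt_mapInCharts I I' hx hfx hf).fderiv]; rfl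

end ChartChange

section Transition

variable {𝕜 : Type*} [NontriviallyNormedField 𝕜] [CompleteSpace 𝕜]
  {E : Type*} [NormedAddCommGroup E] [NormedSpace 𝕜 E]
  {H : Type*} [TopologicalSpace H] (I : ModelWithCorners 𝕜 E H) [I.Boundaryless]
  {M : Type*} [TopologicalSpace M] [ChartedSpace H M] [IsManifold I ω M]

/-- The transition map between two charts. -/
noncomputable def transition (x₀ x₁ : M) : E → E := mapInCharts I I (id : M → M) x₀ x₁

lemma transition_apply {x₀ x : M} (hx : x ∈ (extChartAt I x₀).source) (x₁ : M) :
    transition I x₀ x₁ (extChartAt I x₀ x) = extChartAt I x₁ x :=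
  mapInCharts_apply I I hx id x₁

lemma contDiffAt_transition {x₀ x₁ x : M} (hx : x ∈ (extChartAt I x₀).source)
    (hx' : x ∈ (extChartAt I x₁).source) :
    ContDiffAt 𝕜 ω (transition I x₀ x₁) (extChartAt I x₀ x) :=
  contDiffAt_mapInCharts I I hx hx' contMDiffAt_id

lemma fderiv_transition {x₀ x₁ x : M} (hx : x ∈ (extChartAt I x₀).source)
    (hx' : x ∈ (extChartAt I x₁).source) (u : E) :
    fderiv 𝕜 (transition I x₀ x₁) (extChartAt I x₀ x) u
      = chartReading I x₁ x (chartReadingSymm I x₀ x u) := by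
  have := fderiv_mapInCharts I I (f := id) hx hx' mdifferentiableAt_id u
  rw [mfderiv_id] at this
  exact this

lemma fderiv_transition_self {x₁ x : M} (hx' : x ∈ (extChartAt I x₁).source)
    (u : TangentSpace I x) :
    fderiv 𝕜 (transition I x x₁) (extChartAt I x x) u = chartReading I x₁ x u := by
  have hx := mem_extChartAt_source (I := I) x
  have := chartReadingSymm_reading I hx u
  rw [chartReading_self] at this
  exact (fderiv_transition I hx hx' u).trans (congrArg (chartReading I x₁ x) this)

lemma isInvertible_fderiv_transition {x₀ x₁ x : M} (hx : x ∈ (extChartAt I x₀).source)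
    (hx' : x ∈ (extChartAt I x₁).source) :
    (fderiv 𝕜 (transition I x₀ x₁) (extChartAt I x₀ x)).IsInvertible :=
  ⟨(chartReadingEquiv I hx).symm.trans (chartReadingEquiv I hx'), by
    ext u; exact (fderiv_transition I hx hx' u).symm⟩

lemma eventually_mem_extChartAt_source {x₀ x : M} (hx : x ∈ (extChartAt I x₀).source) :
    ∀ᶠ z in 𝓝 x, z ∈ (extChartAt I x₀).source :=
  (isOpen_extChartAt_source x₀).mem_nhds hx

lemma bilinInChart_transition_apply {x₀ x₁ x : M} (hx : x ∈ (extChartAt I x₀).source)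
    (hx' : x ∈ (extChartAt I x₁).source) (T : BilinField I M) (u v : E) :
    bilinInChart I T x₁ (transition I x₀ x₁ (extChartAt I x₀ x))
      (fderiv 𝕜 (transition I x₀ x₁) (extChartAt I x₀ x) u)
      (fderiv 𝕜 (transition I x₀ x₁) (extChartAt I x₀ x) v)
      = bilinInChart I T x₀ (extChartAt I x₀ x) u v := by
  rw [transition_apply I hx, fderiv_transition I hx hx', fderiv_transition I hx hx',
    bilinInChart_reading I hx', bilinInChart_symm I hx]

lemma oneFormInChart_transition_apply {x₀ x₁ x : M} (hx : x ∈ (extChartAt I x₀).source)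
    (hx' : x ∈ (extChartAt I x₁).source) (α : OneForm I M) (u : E) :
    oneFormInChart I α x₁ (transition I x₀ x₁ (extChartAt I x₀ x))
      (fderiv 𝕜 (transition I x₀ x₁) (extChartAt I x₀ x) u)
      = oneFormInChart I α x₀ (extChartAt I x₀ x) u := by
  rw [transition_apply I hx, fderiv_transition I hx hx', oneFormInChart_reading I hx',
    ← oneFormInChart_reading I hx, chartReading_symm I hx]

lemma vfieldInChart_transition_apply {x₀ x₁ x : M} (hx : x ∈ (extChartAt I x₀).source)
    (hx' : x ∈ (extChartAt I x₁).source) (X : VField I M) :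
    vfieldInChart I X x₁ (transition I x₀ x₁ (extChartAt I x₀ x))
      = fderiv 𝕜 (transition I x₀ x₁) (extChartAt I x₀ x)
        (vfieldInChart I X x₀ (extChartAt I x₀ x)) := by
  rw [transition_apply I hx, fderiv_transition I hx hx', vfieldInChart_reading I hx',
    vfieldInChart_reading I hx, chartReadingSymm_reading I hx]

lemma bilinInChart_transition {x₀ x₁ x : M} (hx : x ∈ (extChartAt I x₀).source)
    (hx' : x ∈ (extChartAt I x₁).source) (T : BilinField I M) :
    bilinInChart I T x₀ =ᶠ[𝓝 (extChartAt I x₀ x)] fun y =>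
      pullBilin (fderiv 𝕜 (transition I x₀ x₁) y) (bilinInChart I T x₁ (transition I x₀ x₁ y)) := by
  refine eventually_extChartAt I hx ?_
  filter_upwards [eventually_mem_extChartAt_source I hx'] with z hz' hz
  ext u v
  exact (bilinInChart_transition_apply I hz hz' T u v).symm

lemma lieDeriv_apply (X : VField I M) (T : BilinField I M) (x : M) (u v : TangentSpace I x) :
    lieDeriv I X T x u v = lieDerivE (vfieldInChart I X x) (bilinInChart I T x)
      (extChartAt I x x) u v :=
  congrArg₂ (fun a b : E => lieDerivE (vfieldInChart I X x) (bilinInChart I T x)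
    (extChartAt I x x) a b) (chartDifferential_apply I x u) (chartDifferential_apply I x v)

/-- The Lie derivative may be computed in any chart. -/
theorem lieDeriv_eq_chart [IsRCLikeNormedField 𝕜] {X : VField I M} {T : BilinField I M} {x₀ x : M}
    (hx : x ∈ (extChartAt I x₀).source)
    (hX : DifferentiableAt 𝕜 (vfieldInChart I X x) (extChartAt I x x))
    (hX' : DifferentiableAt 𝕜 (vfieldInChart I X x₀) (extChartAt I x₀ x))
    (hT : DifferentiableAt 𝕜 (bilinInChart I T x) (extChartAt I x x))
    (hT' : DifferentiableAt 𝕜 (bilinInChart I T x₀) (extChartAt I x₀ x))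
    (u v : TangentSpace I x) :
    lieDeriv I X T x u v = lieDerivE (vfieldInChart I X x₀) (bilinInChart I T x₀)
      (extChartAt I x₀ x) (chartReading I x₀ x u) (chartReading I x₀ x v) := by
  have hs := mem_extChartAt_source (I := I) x
  have e1 : transition I x x₀ (extChartAt I x x) = extChartAt I x₀ x :=
    transition_apply I hs x₀
  have key := lieDerivE_natural (𝕜 := 𝕜) (𝕜' := 𝕜) (φ := transition I x x₀)
    ((contDiffAt_transition I hs hx).of_le le_top) hX hT (by rwa [e1]) (by rwa [e1])
    (X' := vfieldInChart I X x₀) (T' := bilinInChart I T x₀)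
    (eventually_extChartAt I hs (by
      filter_upwards [eventually_mem_extChartAt_source I hx] with z hz' hz
      exact vfieldInChart_transition_apply I hz hz' X))
    (eventually_extChartAt I hs (by
      filter_upwards [eventually_mem_extChartAt_source I hx] with z hz' hz u v
      rw [Algebra.algebraMap_self, RingHom.id_apply]
      exact bilinInChart_transition_apply I hz hz' T u v)) u v
  rw [e1, fderiv_transition_self I hx, fderiv_transition_self I hx, Algebra.algebraMap_self,
    RingHom.id_apply] at key
  rw [key, lieDeriv_apply]

/-- The exterior derivative may be computed in any chart. -/
theorem extDerivOneForm_eq_chart [IsRCLikeNormedField 𝕜] {α : OneForm I M} {x₀ x : M}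
    (hx : x ∈ (extChartAt I x₀).source)
    (hα : DifferentiableAt 𝕜 (oneFormInChart I α x) (extChartAt I x x))
    (hα' : DifferentiableAt 𝕜 (oneFormInChart I α x₀) (extChartAt I x₀ x))
    (u v : TangentSpace I x) :
    extDerivOneForm I α x u v
      = fderiv 𝕜 (oneFormInChart I α x₀) (extChartAt I x₀ x) (chartReading I x₀ x u)
          (chartReading I x₀ x v)
        - fderiv 𝕜 (oneFormInChart I α x₀) (extChartAt I x₀ x) (chartReading I x₀ x v)
          (chartReading I x₀ x u) := by
  have hs := mem_extChartAt_source (I := I) x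
  have e1 : transition I x x₀ (extChartAt I x x) = extChartAt I x₀ x :=
    transition_apply I hs x₀
  have hφ : ContDiffAt 𝕜 2 (transition I x x₀) (extChartAt I x x) :=
    (contDiffAt_transition I hs hx).of_le le_top
  have hφ2 : DifferentiableAt 𝕜 (fderiv 𝕜 (transition I x x₀)) (extChartAt I x x) :=
    (hφ.fderiv_right (m := 1) (by norm_num)).differentiableAt (by simp)
  have hαφ := hα'
  rw [← e1] at hαφ
  have ev : ∀ᶠ y in 𝓝 (extChartAt I x x), ∀ u,
      oneFormInChart I α x₀ (transition I x x₀ y) (fderiv 𝕜 (transition I x x₀) y u)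
        = oneFormInChart I α x y u := eventually_extChartAt I hs (by
      filter_upwards [eventually_mem_extChartAt_source I hx] with z hz' hz u
      exact oneFormInChart_transition_apply I hz hz' α u)
  have key : ∀ a b : E, fderiv 𝕜 (oneFormInChart I α x) (extChartAt I x x) a b
      = fderiv 𝕜 (oneFormInChart I α x₀) (extChartAt I x₀ x)
          (fderiv 𝕜 (transition I x x₀) (extChartAt I x x) a)
          (fderiv 𝕜 (transition I x x₀) (extChartAt I x x) b)
        + oneFormInChart I α x₀ (extChartAt I x₀ x)
          (fderiv 𝕜 (fderiv 𝕜 (transition I x x₀)) (extChartAt I x x) a b) := by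
    intro a b
    rw [← fderiv_apply_const hα]
    have h1 := ((hαφ.hasFDerivAt.comp (extChartAt I x x)
      (hφ.differentiableAt (by simp)).hasFDerivAt).clm_apply
      (hasFDerivAt_apply_const hφ2.hasFDerivAt b)).congr_of_eventuallyEq
      (ev.mono fun y hy => (hy b).symm)
    rw [h1.fderiv]
    simp only [e1, add_apply, ContinuousLinearMap.comp_apply, ContinuousLinearMap.flip_apply,
      Function.comp_apply]
    ring
  change fderiv 𝕜 (oneFormInChart I α x) (extChartAt I x x) (chartDifferential I x u)
      (chartDifferential I x v) - fderiv 𝕜 (oneFormInChart I α x) (extChartAt I x x)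
      (chartDifferential I x v) (chartDifferential I x u) = _
  rw [chartDifferential_apply, chartDifferential_apply]
  refine (congrArg₂ _ (key u v) (key v u)).trans ?_
  rw [fderiv_fderiv_symm (𝕜 := 𝕜) hφ (u : E) v, fderiv_transition_self I hx,
    fderiv_transition_self I hx]
  ring

end Transition

section Ricci

variable {E : Type*} [NormedAddCommGroup E] [NormedSpace ℝ E] [FiniteDimensional ℝ E]
  {H : Type*} [TopologicalSpace H] (I : ModelWithCorners ℝ E H) [I.Boundaryless]
  {M : Type*} [TopologicalSpace M] [ChartedSpace H M] [IsManifold I ω M]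

lemma isInvertible_bilinInChart {g : BilinField I M} {x₀ x : M}
    (hx : x ∈ (extChartAt I x₀).source) (hi : ∀ u, (∀ v, g x u v = 0) → u = 0) :
    (bilinInChart I g x₀ (extChartAt I x₀ x)).IsInvertible := by
  refine isInvertible_of_injective fun u hu => ?_
  have := hi (chartReadingSymm I x₀ x u) fun v => by
    have := hu (chartReading I x₀ x v)
    rwa [bilinInChart_symm I hx, chartReadingSymm_reading I hx] at this
  rw [← chartReading_symm I hx u, this, map_zero]

lemma ricciE_congr {G G' : E → E →L[ℝ] E →L[ℝ] ℝ} {y : E} (h : G =ᶠ[𝓝 y] G') (v w : E) :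
    ricciE G y v w = ricciE G' y v w := by
  have h1 : ∀ u v, (fun z => christoffelE G z u v) =ᶠ[𝓝 y] fun z => christoffelE G' z u v := by
    intro u v
    filter_upwards [h.eventuallyEq_nhds] with z hz
    simp only [christoffelE, koszulE, hz.self_of_nhds, hz.fderiv_eq (𝕜 := ℝ)]
  simp only [ricciE, curvatureE, (h1 _ _).fderiv_eq (𝕜 := ℝ), (h1 _ _).self_of_nhds]

lemma ricci_apply (g : BilinField I M) (x : M) (u v : TangentSpace I x) :
    ricci I g x u v = ricciE (bilinInChart I g x) (extChartAt I x x) u v :=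
  congrArg₂ (fun a b : E => ricciE (bilinInChart I g x) (extChartAt I x x) a b)
    (chartDifferential_apply I x u) (chartDifferential_apply I x v)

/-- The Ricci tensor may be computed in any chart. -/
theorem ricci_eq_chart {g : BilinField I M} {x₀ x : M} (hx : x ∈ (extChartAt I x₀).source)
    (hg : ContDiffAt ℝ 2 (bilinInChart I g x₀) (extChartAt I x₀ x))
    (hs : ∀ᶠ z in 𝓝 x, ∀ u v, g z u v = g z v u) (hi : ∀ u, (∀ v, g x u v = 0) → u = 0)
    (u v : TangentSpace I x) :
    ricci I g x u v = ricciE (bilinInChart I g x₀) (extChartAt I x₀ x)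
      (chartReading I x₀ x u) (chartReading I x₀ x v) := by
  have hxs := mem_extChartAt_source (I := I) x
  have e1 : transition I x x₀ (extChartAt I x x) = extChartAt I x₀ x :=
    transition_apply I hxs x₀
  have key := ricciE_pullback (φ := transition I x x₀) (y := extChartAt I x x)
    (G := bilinInChart I g x₀) (G' := bilinInChart I g x)
    ((contDiffAt_transition I hxs hx).of_le le_top) (isInvertible_fderiv_transition I hxs hx)
    (by rwa [e1]) (by
      rw [e1]
      refine eventually_extChartAt I hx ?_
      filter_upwards [hs] with z hz hzs u v
      rw [bilinInChart_symm I hzs, bilinInChart_symm I hzs, hz])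
    (by rw [e1]; exact isInvertible_bilinInChart I hx hi)
    (bilinInChart_transition I hxs hx g) u v
  rw [e1, fderiv_transition_self I hx, fderiv_transition_self I hx] at key
  rw [← key, ricci_apply]

end Ricci

/-! ### Readings in the charts of a product with a line -/

section Product

variable {𝕜 : Type*} [NontriviallyNormedField 𝕜]
  {E : Type*} [NormedAddCommGroup E] [NormedSpace 𝕜 E]
  {H : Type*} [TopologicalSpace H] (I : ModelWithCorners 𝕜 E H)
  {M : Type*} [TopologicalSpace M] [ChartedSpace H M]

lemma extChartAt_prod_line (p : M × 𝕜) :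
    (extChartAt (I.prod 𝓘(𝕜, 𝕜)) p : M × 𝕜 → E × 𝕜) = Prod.map (extChartAt I p.1) id := by
  rw [extChartAt_prod, extChartAt_model_space_eq_id]; rfl

lemma mem_extChartAt_source_line {p q : M × 𝕜} :
    q ∈ (extChartAt (I.prod 𝓘(𝕜, 𝕜)) p).source ↔ q.1 ∈ (extChartAt I p.1).source := by
  rw [extChartAt_prod, extChartAt_model_space_eq_id]; simp

lemma extChartAt_prod_line_apply (p q : M × 𝕜) :
    extChartAt (I.prod 𝓘(𝕜, 𝕜)) p q = (extChartAt I p.1 q.1, q.2) := by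
  rw [extChartAt_prod_line]; rfl

variable [IsManifold I 1 M]

lemma chartReading_line {p q : M × 𝕜} (hq : q.1 ∈ (extChartAt I p.1).source)
    (u : TangentSpace (I.prod 𝓘(𝕜, 𝕜)) q) :
    chartReading (I.prod 𝓘(𝕜, 𝕜)) p q u
      = (chartReading I p.1 q.1 (u : E × 𝕜).1, (u : E × 𝕜).2) := by
  have h := mfderiv_prodMap (p := q) (I := I) (J := 𝓘(𝕜, E)) (I' := 𝓘(𝕜, 𝕜)) (J' := 𝓘(𝕜, 𝕜))
    (f := extChartAt I p.1) (g := id)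
    (mdifferentiableAt_extChartAt (by rwa [← extChartAt_source (I := I)])) mdifferentiableAt_id
  rw [mfderiv_id, ← modelWithCornersSelf_prod, chartedSpaceSelf_prod] at h
  rw [chartReading, extChartAt_prod_line]
  exact DFunLike.congr_fun h u

lemma chartReadingSymm_line {p q : M × 𝕜} (hq : q.1 ∈ (extChartAt I p.1).source)
    (u : E × 𝕜) :
    chartReadingSymm (I.prod 𝓘(𝕜, 𝕜)) p q u = (chartReadingSymm I p.1 q.1 u.1, u.2) := by
  have hq' := (mem_extChartAt_source_line I).2 hq
  let w : TangentSpace (I.prod 𝓘(𝕜, 𝕜)) q := (chartReadingSymm I p.1 q.1 u.1, u.2)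
  have h : chartReading (I.prod 𝓘(𝕜, 𝕜)) p q w = u :=
    (chartReading_line I hq w).trans (Prod.ext (chartReading_symm I hq u.1) rfl)
  exact (congrArg (chartReadingSymm (I.prod 𝓘(𝕜, 𝕜)) p q) h.symm).trans
    (chartReadingSymm_reading (I.prod 𝓘(𝕜, 𝕜)) hq' w)

lemma bilinInChart_pullback_fst {p : M × 𝕜} {q : M × 𝕜} (hq : q.1 ∈ (extChartAt I p.1).source)
    (T : BilinField I M) :
    bilinInChart (I.prod 𝓘(𝕜, 𝕜)) (pullback (I.prod 𝓘(𝕜, 𝕜)) I Prod.fst T) p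
        (extChartAt I p.1 q.1, q.2)
      = pullBilin (ContinuousLinearMap.fst 𝕜 E 𝕜) (bilinInChart I T p.1 (extChartAt I p.1 q.1)) := by
  have hq' := (mem_extChartAt_source_line I).2 hq
  refine ContinuousLinearMap.ext fun u => ContinuousLinearMap.ext fun v => ?_
  rw [← extChartAt_prod_line_apply, bilinInChart_symm _ hq', pullBilin_apply,
    bilinInChart_symm I hq, chartReadingSymm_line I hq, chartReadingSymm_line I hq]
  change T q.1 (mfderiv (I.prod 𝓘(𝕜, 𝕜)) I Prod.fst q _)
    (mfderiv (I.prod 𝓘(𝕜, 𝕜)) I Prod.fst q _) = _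
  rw [mfderiv_fst]
  rfl

lemma vfieldInChart_line {p : M × 𝕜} {q : M × 𝕜} (hq : q.1 ∈ (extChartAt I p.1).source)
    (X : VField (I.prod 𝓘(𝕜, 𝕜)) (M × 𝕜)) :
    vfieldInChart (I.prod 𝓘(𝕜, 𝕜)) X p (extChartAt I p.1 q.1, q.2)
      = (chartReading I p.1 q.1 (X q : E × 𝕜).1, (X q : E × 𝕜).2) := by
  rw [← extChartAt_prod_line_apply,
    vfieldInChart_reading _ ((mem_extChartAt_source_line I).2 hq), chartReading_line I hq]

end Product

section Beltrami

variable {N : Type*} [TopologicalSpace N] [ChartedSpace R3 N] [IsManifold (𝓡 3) ω N]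

lemma beltramiMetric_apply (h : AnalyticMetric N) (A : OneForm (𝓡 3) N) (q : N × ℝ)
    (u v : TangentSpace ((𝓡 3).prod 𝓘(ℝ, ℝ)) q) :
    beltramiMetric h A q u v = q.2 ^ 2 * h.inner q.1 (u : R3 × ℝ).1 (v : R3 × ℝ).1
      + (q.2 ^ 2)⁻¹ * ((q.2 * (u : R3 × ℝ).2 + A q.1 (u : R3 × ℝ).1)
        * (q.2 * (v : R3 × ℝ).2 + A q.1 (v : R3 × ℝ).1)) := by
  have h1 : mfderiv ((𝓡 3).prod 𝓘(ℝ, ℝ)) (𝓡 3) Prod.fst q = _ := mfderiv_fst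
  have h2 : mfderiv ((𝓡 3).prod 𝓘(ℝ, ℝ)) 𝓘(ℝ, ℝ) Prod.snd q = _ := mfderiv_snd
  have h3 : ∀ u : TangentSpace ((𝓡 3).prod 𝓘(ℝ, ℝ)) q,
      theta A q u = q.2 * (u : R3 × ℝ).2 + A q.1 (u : R3 × ℝ).1 := by
    intro u
    change q.2 * (show ℝ from mfderiv ((𝓡 3).prod 𝓘(ℝ, ℝ)) 𝓘(ℝ, ℝ) Prod.snd q u)
      + A q.1 (mfderiv ((𝓡 3).prod 𝓘(ℝ, ℝ)) (𝓡 3) Prod.fst q u) = _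
    exact congrArg₂ (fun a b : ℝ => q.2 * a + b) (DFunLike.congr_fun h2 u)
      (congrArg (A q.1) (DFunLike.congr_fun h1 u))
  change q.2 ^ 2 * h.inner q.1 (mfderiv ((𝓡 3).prod 𝓘(ℝ, ℝ)) (𝓡 3) Prod.fst q u)
    (mfderiv ((𝓡 3).prod 𝓘(ℝ, ℝ)) (𝓡 3) Prod.fst q v)
    + (q.2 ^ 2)⁻¹ * (theta A q u * theta A q v) = _
  rw [h3, h3, h1]; rfl

lemma beltramiInChart (h : AnalyticMetric N) (A : OneForm (𝓡 3) N) {p q : N × ℝ}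
    (hq : q.1 ∈ (extChartAt (𝓡 3) p.1).source) :
    bilinInChart ((𝓡 3).prod 𝓘(ℝ, ℝ)) (beltramiMetric h A) p (extChartAt (𝓡 3) p.1 q.1, q.2)
      = beltramiE (bilinInChart (𝓡 3) h.inner p.1) (oneFormInChart (𝓡 3) A p.1)
        (extChartAt (𝓡 3) p.1 q.1, q.2) := by
  have hq' := (mem_extChartAt_source_line (𝓡 3)).2 hq
  have hA : ∀ u, oneFormInChart (𝓡 3) A p.1 (extChartAt (𝓡 3) p.1 q.1) u
      = A q.1 (chartReadingSymm (𝓡 3) p.1 q.1 u) := fun u => by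
    rw [← oneFormInChart_reading (𝓡 3) hq, chartReading_symm _ hq]
  refine ContinuousLinearMap.ext fun u => ContinuousLinearMap.ext fun v => ?_
  rw [← extChartAt_prod_line_apply, bilinInChart_symm _ hq', beltramiMetric_apply,
    chartReadingSymm_line _ hq, chartReadingSymm_line _ hq, extChartAt_prod_line_apply]
  change _ = q.2 ^ 2 * bilinInChart (𝓡 3) h.inner p.1 (extChartAt (𝓡 3) p.1 q.1) u.1 v.1
    + (q.2 ^ 2)⁻¹ * ((q.2 * u.2 + oneFormInChart (𝓡 3) A p.1 (extChartAt (𝓡 3) p.1 q.1) u.1)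
      * (q.2 * v.2 + oneFormInChart (𝓡 3) A p.1 (extChartAt (𝓡 3) p.1 q.1) v.1))
  rw [hA, hA, bilinInChart_symm _ hq]

lemma beltramiInChart_eventuallyEq (h : AnalyticMetric N) (A : OneForm (𝓡 3) N) (x : N) (ρ : ℝ) :
    bilinInChart ((𝓡 3).prod 𝓘(ℝ, ℝ)) (beltramiMetric h A) (x, ρ)
      =ᶠ[𝓝 (extChartAt (𝓡 3) x x, ρ)]
      beltramiE (bilinInChart (𝓡 3) h.inner x) (oneFormInChart (𝓡 3) A x) := by
  have h1 := eventually_extChartAt ((𝓡 3).prod 𝓘(ℝ, ℝ)) (x₀ := (x, ρ)) (x := (x, ρ))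
    (P := fun q => bilinInChart ((𝓡 3).prod 𝓘(ℝ, ℝ)) (beltramiMetric h A) (x, ρ) q
      = beltramiE (bilinInChart (𝓡 3) h.inner x) (oneFormInChart (𝓡 3) A x) q)
      (mem_extChartAt_source _) (.of_forall fun q hq => by
      rw [extChartAt_prod_line_apply]
      exact beltramiInChart h A (p := (x, ρ)) ((mem_extChartAt_source_line _).1 hq))
  rwa [extChartAt_prod_line_apply] at h1

end Beltrami

/-! ### Volume forms and the Beltrami equation -/

section Volume

variable {V : Type*} [AddCommGroup V] [Module ℝ V]

/-- The volume form does not depend on the positive basis in which it is computed. -/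
lemma sqrt_gram_smul_det (B : LinearMap.BilinForm ℝ V) (b e : Module.Basis (Fin 3) ℝ V)
    (ho : b.orientation = e.orientation) :
    Real.sqrt (Matrix.of fun i j => B (b i) (b j)).det • b.det
      = Real.sqrt (Matrix.of fun i j => B (e i) (e j)).det • e.det := by
  have h1 : ∀ c : Module.Basis (Fin 3) ℝ V,
      (Matrix.of fun i j => B (c i) (c j)) = LinearMap.BilinForm.toMatrix c B := by
    intro c; ext i j; simp
  have h2 : (LinearMap.BilinForm.toMatrix b B).det
      = (e.det b) ^ 2 * (LinearMap.BilinForm.toMatrix e B).det := by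
    rw [← LinearMap.BilinForm.toMatrix_mul_basis_toMatrix (b := e) (c := b) B, Matrix.det_mul,
      Matrix.det_mul, Matrix.det_transpose, Module.Basis.det_apply]
    ring
  have h3 : 0 < e.det b := (Module.Basis.orientation_eq_iff_det_pos e b).1 ho.symm
  have h4 : e.det = e.det b • b.det := AlternatingMap.eq_smul_basis_det b e.det
  rw [h1, h1, h2, Real.sqrt_mul (sq_nonneg _), Real.sqrt_sq h3.le]
  conv_rhs => rw [h4]
  rw [smul_smul, mul_comm]

lemma exists_orthonormal_basis_orientation (B : LinearMap.BilinForm ℝ V)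
    [FiniteDimensional ℝ V] (hd : Module.finrank ℝ V = 3)
    (hs : ∀ u v, B u v = B v u) (hp : ∀ u, u ≠ 0 → 0 < B u u) (o : Orientation ℝ V (Fin 3)) :
    ∃ e : Module.Basis (Fin 3) ℝ V, (∀ i j, B (e i) (e j) = if i = j then 1 else 0) ∧
      e.orientation = o := by
  obtain ⟨v, hv⟩ := LinearMap.BilinForm.exists_orthogonal_basis (B := B) ⟨hs⟩
  let v' := v.reindex (finCongr hd)
  have hv' : ∀ i j, i ≠ j → B (v' i) (v' j) = 0 := by
    intro i j hij
    have := LinearMap.isOrthoᵢ_def.1 hv ((finCongr hd).symm i) ((finCongr hd).symm j)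
      (fun h => hij ((finCongr hd).symm.injective h))
    simpa [v'] using this
  have hpos : ∀ i, 0 < B (v' i) (v' i) := fun i => hp _ (v'.ne_zero i)
  let w : Fin 3 → ℝˣ := fun i => Units.mk0 (Real.sqrt (B (v' i) (v' i)))⁻¹
    (inv_ne_zero (Real.sqrt_ne_zero'.2 (hpos i)))
  let f := v'.unitsSMul w
  have hf : ∀ i j, B (f i) (f j) = if i = j then 1 else 0 := by
    intro i j
    have hfi : ∀ i, f i = (Real.sqrt (B (v' i) (v' i)))⁻¹ • v' i := fun i => by
      simp [f, w, Module.Basis.unitsSMul_apply, Units.smul_def]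
    rw [hfi, hfi]
    split_ifs with h
    · subst h
      have := Real.mul_self_sqrt (hpos i).le
      have h0 := Real.sqrt_ne_zero'.2 (hpos i)
      simp only [map_smul, LinearMap.smul_apply, smul_eq_mul]
      field_simp
      rw [sq, this]
    · simp [hv' i j h]
  refine ⟨f.adjustToOrientation o, fun i j => ?_, f.orientation_adjustToOrientation o⟩
  by_cases hij : i = j
  · subst hij
    rcases f.adjustToOrientation_apply_eq_or_eq_neg o i with h | h <;> rw [h] <;> simp [hf]
  · rcases f.adjustToOrientation_apply_eq_or_eq_neg o i with h | h <;>
    rcases f.adjustToOrientation_apply_eq_or_eq_neg o j with h' | h' <;> rw [h, h'] <;>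
    simp [hf, hij]

lemma det_cyclic (e : Module.Basis (Fin 3) ℝ V) (x : V) (k : Fin 3) :
    e.det ![x, e (k + 1), e (k + 2)] = e.repr x k := by
  rw [Module.Basis.det_apply, Matrix.det_fin_three]
  fin_cases k <;> simp [Module.Basis.toMatrix_apply]

end Volume

section LocalBeltrami

variable {E : Type*} [NormedAddCommGroup E] [NormedSpace ℝ E]
  {H : E → E →L[ℝ] E →L[ℝ] ℝ} {α : E → E →L[ℝ] ℝ} {y : E}

/-- The Beltrami equation and its first derivative in an orthonormal frame. -/
lemma beltrami_jet (e : Module.Basis (Fin 3) ℝ E)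
    (he : ∀ i j, H y (e i) (e j) = if i = j then 1 else 0)
    (hH : DifferentiableAt ℝ H y) (hα : ContDiffAt ℝ 2 α y)
    (hb : ∀ᶠ z in 𝓝 y, ∀ l, ∑ k, H z (e l) (e k) *
      (fderiv ℝ α z (e (k + 1)) (e (k + 2)) - fderiv ℝ α z (e (k + 2)) (e (k + 1)))
      = -2 * Real.sqrt (Matrix.of fun i j => H z (e i) (e j)).det * α z (e l)) :
    (∀ i, fderiv ℝ α y (e i) (e (i + 1)) - fderiv ℝ α y (e (i + 1)) (e i) = -2 * α y (e (i + 2))) ∧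
    ∀ w i, fderiv ℝ (fderiv ℝ α) y (e w) (e i) (e (i + 1))
      - fderiv ℝ (fderiv ℝ α) y (e w) (e (i + 1)) (e i)
      = -2 * ((1 / 2 * ∑ l, fderiv ℝ H y (e w) (e l) (e l)) * α y (e (i + 2))
        + fderiv ℝ α y (e w) (e (i + 2))
        - ∑ l, fderiv ℝ H y (e w) (e (i + 2)) (e l) * α y (e l)) := by
  have hα1 : DifferentiableAt ℝ α y := hα.differentiableAt (by simp)
  have hα2 : DifferentiableAt ℝ (fderiv ℝ α) y :=
    (hα.fderiv_right (m := 1) (by norm_num)).differentiableAt (by simp)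
  have hG : (Matrix.of fun i j => H y (e i) (e j)) = (1 : Matrix (Fin 3) (Fin 3) ℝ) := by
    ext i j; simp [he, Matrix.one_apply]
  have h0 : ∀ l, fderiv ℝ α y (e (l + 1)) (e (l + 2)) - fderiv ℝ α y (e (l + 2)) (e (l + 1))
      = -2 * α y (e l) := by
    intro l
    have := hb.self_of_nhds l
    rw [hG] at this
    simpa [he] using this
  have h1 : ∀ w l, fderiv ℝ (fderiv ℝ α) y (e w) (e (l + 1)) (e (l + 2))
      - fderiv ℝ (fderiv ℝ α) y (e w) (e (l + 2)) (e (l + 1))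
      = -2 * ((1 / 2 * ∑ l, fderiv ℝ H y (e w) (e l) (e l)) * α y (e l)
        + fderiv ℝ α y (e w) (e l)
        - ∑ k, fderiv ℝ H y (e w) (e l) (e k) * α y (e k)) := by
    intro w l
    have dH : ∀ i j, HasDerivAt (fun t : ℝ => H (y + t • e w) (e i) (e j))
        (fderiv ℝ H y (e w) (e i) (e j)) 0 := fun i j => hasDerivAt_line
      (hasFDerivAt_apply_const (hasFDerivAt_apply_const hH.hasFDerivAt (e i)) (e j)) (e w)
    have dα : ∀ i, HasDerivAt (fun t : ℝ => α (y + t • e w) (e i))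
        (fderiv ℝ α y (e w) (e i)) 0 := fun i => hasDerivAt_line
      (hasFDerivAt_apply_const hα1.hasFDerivAt (e i)) (e w)
    have dα2 : ∀ i j, HasDerivAt (fun t : ℝ => fderiv ℝ α (y + t • e w) (e i) (e j))
        (fderiv ℝ (fderiv ℝ α) y (e w) (e i) (e j)) 0 := fun i j => hasDerivAt_line
      (hasFDerivAt_apply_const (hasFDerivAt_apply_const hα2.hasFDerivAt (e i)) (e j)) (e w)
    have dL := HasDerivAt.fun_sum (u := Finset.univ) fun k _ => (dH l k).mul
      ((dα2 (k + 1) (k + 2)).sub (dα2 (k + 2) (k + 1)))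
    have dS : HasDerivAt (fun t : ℝ =>
        Real.sqrt (Matrix.of fun i j => H (y + t • e w) (e i) (e j)).det)
        (1 / 2 * ∑ l, fderiv ℝ H y (e w) (e l) (e l)) 0 := by
      simp only [Matrix.det_fin_three, Matrix.of_apply]
      have dD := ((((((dH 0 0).mul (dH 1 1)).mul (dH 2 2)).sub
        (((dH 0 0).mul (dH 1 2)).mul (dH 2 1))).sub (((dH 0 1).mul (dH 1 0)).mul (dH 2 2))).add
        (((dH 0 1).mul (dH 1 2)).mul (dH 2 0))).add (((dH 0 2).mul (dH 1 0)).mul (dH 2 1)) |>.sub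
        (((dH 0 2).mul (dH 1 1)).mul (dH 2 0))
      have := dD.sqrt (by simp [he])
      convert! this using 1
      simp [he, Fin.sum_univ_three]
      ring
    have dR := (dS.const_mul (-2)).mul (dα l)
    have hline : Tendsto (fun t : ℝ => y + t • e w) (𝓝 0) (𝓝 y) := by
      have : ContinuousAt (fun t : ℝ => y + t • e w) 0 := by fun_prop
      simpa [ContinuousAt] using this
    have hI : (Matrix.of fun i j : Fin 3 => if i = j then (1 : ℝ) else 0) = 1 := by
      rw [← hG]; simp only [he]
    have := dL.unique (dR.congr_of_eventuallyEq ((hline.eventually hb).mono fun t ht => ht l))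
    simp only [Pi.sub_apply, zero_smul, add_zero, he, hI, Matrix.det_one, Real.sqrt_one, h0,
      Finset.sum_add_distrib, ite_mul, one_mul, zero_mul, Finset.sum_ite_eq,
      Finset.mem_univ, if_true] at this
    rw [eq_sub_of_add_eq' this]
    have e1 : ∑ k, fderiv ℝ H y (e w) (e l) (e k) * (-2 * α y (e k))
        = -2 * ∑ k, fderiv ℝ H y (e w) (e l) (e k) * α y (e k) := by
      rw [Finset.mul_sum]; exact Finset.sum_congr rfl fun k _ => by ring
    rw [e1]
    ring
  have hi : ∀ i : Fin 3, i + 2 + 1 = i ∧ i + 2 + 2 = i + 1 := by decide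
  refine ⟨fun i => ?_, fun w i => ?_⟩
  · have := h0 (i + 2); rwa [(hi i).1, (hi i).2] at this
  · have := h1 w (i + 2); rwa [(hi i).1, (hi i).2] at this

end LocalBeltrami

section ManifoldBeltrami

variable {N : Type*} [TopologicalSpace N] [ChartedSpace R3 N] [IsManifold (𝓡 3) ω N]

instance instFiniteDimensionalTangentSpace (x : N) :
    FiniteDimensional ℝ (TangentSpace (𝓡 3) x) :=
  inferInstanceAs (FiniteDimensional ℝ R3)

lemma trivializationAt_eq_chartReading {x₀ x : N} (hx : x ∈ (extChartAt (𝓡 3) x₀).source)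
    (hx' : x ∈ (trivializationAt R3 (TangentSpace (𝓡 3)) x₀).baseSet) :
    (trivializationAt R3 (TangentSpace (𝓡 3)) x₀).continuousLinearEquivAt ℝ x hx'
      = chartReadingEquiv (𝓡 3) hx := by
  refine ContinuousLinearEquiv.ext (funext fun v => ?_)
  have h1 := DFunLike.congr_fun (TangentBundle.continuousLinearMapAt_trivializationAt
    (I := 𝓡 3) (x₀ := x₀) (x := x) (by rwa [← extChartAt_source (I := 𝓡 3)])) v
  refine Eq.trans ?_ h1
  rw [Trivialization.continuousLinearMapAt_apply, Trivialization.coe_linearMapAt_of_mem _ hx']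
  rfl

/-- The volume form read in a chart. -/
lemma volumeForm_chart (h : AnalyticMetric N) (o : ManifoldOrientation N) {x₀ x : N}
    (hx : x ∈ (extChartAt (𝓡 3) x₀).source) (e : Module.Basis (Fin 3) ℝ R3)
    (ho : Orientation.map (Fin 3) (chartReadingEquiv (𝓡 3) hx).toLinearEquiv (o.at_point x)
      = e.orientation) (v : Fin 3 → TangentSpace (𝓡 3) x) :
    volumeForm h o x v = Real.sqrt (Matrix.of fun i j =>
        bilinInChart (𝓡 3) h.inner x₀ (extChartAt (𝓡 3) x₀ x) (e i) (e j)).det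
      * e.det (fun i => chartReading (𝓡 3) x₀ x (v i)) := by
  let e' : Module.Basis (Fin 3) ℝ (TangentSpace (𝓡 3) x) :=
    e.map (chartReadingEquiv (𝓡 3) hx).toLinearEquiv.symm
  have he' : ∀ i, e' i = chartReadingSymm (𝓡 3) x₀ x (e i) := fun i => rfl
  have ho' : (positiveBasis o x).orientation = e'.orientation := by
    have h1 : (positiveBasis o x).orientation = o.at_point x :=
      Orientation.someBasis_orientation _ _
    rw [h1, Module.Basis.orientation_map, ← ho, ← Orientation.map_symm, Equiv.symm_apply_apply]
  have h2 := sqrt_gram_smul_det (ContinuousLinearMap.toBilinForm (h.inner x)) (positiveBasis o x)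
    e' ho'
  have h3 := DFunLike.congr_fun h2 v
  refine h3.trans ?_
  rw [AlternatingMap.smul_apply, smul_eq_mul, Module.Basis.det_map]
  congr 3
  congr 1
  ext i j
  simp only [ContinuousLinearMap.toBilinForm_apply, he']
  rw [bilinInChart_symm _ hx]

end ManifoldBeltrami

/-! ### The Ricci tensor of the Beltrami metric -/

section

variable {N : Type*} [TopologicalSpace N] [ChartedSpace R3 N] [IsManifold (𝓡 3) ω N]

lemma contDiffAt_metric (h : AnalyticMetric N) {x₀ x : N}
    (hx : x ∈ (extChartAt (𝓡 3) x₀).source) :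
    ContDiffAt ℝ ω (bilinInChart (𝓡 3) h.inner x₀) (extChartAt (𝓡 3) x₀ x) :=
  contDiffAt_bilinInChart (𝓡 3) hx (h.contMDiff x)

lemma contDiffAt_beltramiField {h : AnalyticMetric N} {o : ManifoldOrientation N}
    {A : OneForm (𝓡 3) N} (hA : IsBeltramiField h o A) {x₀ x : N}
    (hx : x ∈ (extChartAt (𝓡 3) x₀).source) :
    ContDiffAt ℝ ∞ (oneFormInChart (𝓡 3) A x₀) (extChartAt (𝓡 3) x₀ x) :=
  have : IsManifold (𝓡 3) ∞ N := .of_le (n := ω) le_top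
  contDiffAt_oneFormInChart (𝓡 3) hx (hA.smooth x)

lemma eq_zero_of_inner_eq_zero (h : AnalyticMetric N) {x : N} {u : TangentSpace (𝓡 3) x}
    (hu : ∀ v, h.inner x u v = 0) : u = 0 := by
  by_contra h0
  exact (h.pos x u h0).ne' (hu u)

lemma inner_sharp (h : AnalyticMetric N) (x : N) (α : TangentSpace (𝓡 3) x →L[ℝ] ℝ)
    (v : TangentSpace (𝓡 3) x) : h.inner x (sharp h x α) v = α v := by
  have : (h.inner x).IsInvertible :=
    isInvertible_of_injective (E := R3) (B := h.inner x) fun u hu => eq_zero_of_inner_eq_zero h hu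
  have h1 : h.inner x ((h.inner x).inverse α) = α := this.self_apply_inverse α
  exact DFunLike.congr_fun h1 v

/-- The Beltrami equation in a chart and a positively oriented basis. -/
lemma beltrami_chart {h : AnalyticMetric N} {o : ManifoldOrientation N}
    {A : OneForm (𝓡 3) N} (hA : IsBeltramiField h o A) (x₀ : N)
    {e : Module.Basis (Fin 3) ℝ R3}
    (he : ∀ᶠ y in 𝓝 x₀, ∀ hy : y ∈ (trivializationAt R3 (TangentSpace (𝓡 3)) x₀).baseSet,
      Orientation.map (Fin 3) ((trivializationAt R3 (TangentSpace (𝓡 3)) x₀).continuousLinearEquivAt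
        ℝ y hy).toLinearEquiv (o.at_point y) = e.orientation) :
    ∀ᶠ y in 𝓝 (extChartAt (𝓡 3) x₀ x₀), ∀ l,
      ∑ k, bilinInChart (𝓡 3) h.inner x₀ y (e l) (e k) *
        (fderiv ℝ (oneFormInChart (𝓡 3) A x₀) y (e (k + 1)) (e (k + 2))
          - fderiv ℝ (oneFormInChart (𝓡 3) A x₀) y (e (k + 2)) (e (k + 1)))
      = -2 * Real.sqrt (Matrix.of fun i j => bilinInChart (𝓡 3) h.inner x₀ y (e i) (e j)).det
        * oneFormInChart (𝓡 3) A x₀ y (e l) := by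
  refine eventually_extChartAt (𝓡 3) (mem_extChartAt_source x₀) ?_
  filter_upwards [he] with x hox hx l
  have hbs : x ∈ (trivializationAt R3 (TangentSpace (𝓡 3)) x₀).baseSet := by
    rwa [TangentBundle.trivializationAt_baseSet, ← extChartAt_source (I := 𝓡 3)]
  have ho := hox hbs
  rw [trivializationAt_eq_chartReading hx hbs] at ho
  set H := bilinInChart (𝓡 3) h.inner x₀ (extChartAt (𝓡 3) x₀ x)
  set α := oneFormInChart (𝓡 3) A x₀
  set ξ := chartReading (𝓡 3) x₀ x (sharp h x (A x))
  have hξ : ∀ u, H u ξ = α (extChartAt (𝓡 3) x₀ x) u := by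
    intro u
    have h1 := bilinInChart_reading (𝓡 3) hx h.inner (chartReadingSymm (𝓡 3) x₀ x u)
      (sharp h x (A x))
    have h2 := oneFormInChart_reading (𝓡 3) hx A (chartReadingSymm (𝓡 3) x₀ x u)
    rw [chartReading_symm _ hx] at h1 h2
    rw [h1, h2, h.symm, inner_sharp]
  have hD : ∀ k, fderiv ℝ α (extChartAt (𝓡 3) x₀ x) (e (k + 1)) (e (k + 2))
      - fderiv ℝ α (extChartAt (𝓡 3) x₀ x) (e (k + 2)) (e (k + 1))
      = -2 * (Real.sqrt (Matrix.of fun i j => H (e i) (e j)).det * e.repr ξ k) := by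
    intro k
    have hd : ∀ x₁, x ∈ (extChartAt (𝓡 3) x₁).source →
        DifferentiableAt ℝ (oneFormInChart (𝓡 3) A x₁) (extChartAt (𝓡 3) x₁ x) := fun x₁ hx₁ =>
      (contDiffAt_beltramiField hA hx₁).differentiableAt (by simp)
    have h1 := extDerivOneForm_eq_chart (𝓡 3) hx (hd x (mem_extChartAt_source x)) (hd x₀ hx)
      (chartReadingSymm (𝓡 3) x₀ x (e (k + 1))) (chartReadingSymm (𝓡 3) x₀ x (e (k + 2)))
    rw [chartReading_symm _ hx, chartReading_symm _ hx] at h1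
    have h2 := hA.equation x (chartReadingSymm (𝓡 3) x₀ x (e (k + 1)))
      (chartReadingSymm (𝓡 3) x₀ x (e (k + 2)))
    rw [hodgeStar, volumeForm_chart h o hx e ho] at h2
    have h3 : (fun i => chartReading (𝓡 3) x₀ x (![sharp h x (A x),
        chartReadingSymm (𝓡 3) x₀ x (e (k + 1)), chartReadingSymm (𝓡 3) x₀ x (e (k + 2))] i))
        = ![ξ, e (k + 1), e (k + 2)] := by
      funext i
      fin_cases i
      · rfl
      · exact chartReading_symm _ hx _
      · exact chartReading_symm _ hx _
    rw [h3, det_cyclic] at h2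
    rw [← h1]
    linarith
  have hsum : ∑ k, e.repr ξ k * H (e l) (e k) = α (extChartAt (𝓡 3) x₀ x) (e l) := by
    rw [← hξ]
    conv_rhs => rw [← e.sum_repr ξ, map_sum]
    simp only [map_smul, smul_eq_mul]
  simp only [hD, ← hsum, Finset.mul_sum]
  exact Finset.sum_congr rfl fun k _ => by ring

/-- The Ricci tensor of the Beltrami metric. -/
theorem ricci_beltramiMetric {h : AnalyticMetric N} {o : ManifoldOrientation N}
    {A : OneForm (𝓡 3) N} (hA : IsBeltramiField h o A) {p : N × ℝ} (hp : 0 < p.2)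
    (u v : TangentSpace ((𝓡 3).prod 𝓘(ℝ, ℝ)) p) :
    ricci ((𝓡 3).prod 𝓘(ℝ, ℝ)) (beltramiMetric h A) p u v
      = ricci (𝓡 3) h.inner p.1 (u : R3 × ℝ).1 (v : R3 × ℝ).1
        - 2 * h.inner p.1 (u : R3 × ℝ).1 (v : R3 × ℝ).1 := by
  obtain ⟨x, ρ⟩ := p
  have hxs := mem_extChartAt_source (I := 𝓡 3) x
  obtain ⟨o₀, ho₀⟩ := o.locally_constant x
  set H := bilinInChart (𝓡 3) h.inner x
  set α := oneFormInChart (𝓡 3) A x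
  set y := extChartAt (𝓡 3) x x
  have hH : ContDiffAt ℝ ω H y := contDiffAt_metric h hxs
  have hα : ContDiffAt ℝ ∞ α y := contDiffAt_beltramiField hA hxs
  have hHs : ∀ᶠ z in 𝓝 y, ∀ v w, H z v w = H z w v := by
    refine eventually_extChartAt (𝓡 3) hxs (.of_forall fun z hz u v => ?_)
    rw [bilinInChart_symm _ hz, bilinInChart_symm _ hz, h.symm]
  have hHy : ∀ u v : R3, H y u v = h.inner x u v := fun u v =>
    bilinInChart_self (𝓡 3) x h.inner u v
  obtain ⟨e, he, heo⟩ := exists_orthonormal_basis_orientation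
    (ContinuousLinearMap.toBilinForm (H y)) (by simp) hHs.self_of_nhds
    (fun u hu => by
      rw [ContinuousLinearMap.toBilinForm_apply, hHy]
      exact h.pos x u hu) o₀
  have hjet := beltrami_jet (H := H) (α := α) e he (hH.differentiableAt (by simp))
    (hα.of_le (by norm_cast)) (beltrami_chart hA x (by rwa [heo]))
  have key := ricciE_beltramiE (p := (y, ρ)) (ne_of_gt hp) (hH.of_le le_top)
    (hα.of_le (by norm_cast)) hHs e he hjet.1 hjet.2 (u : R3 × ℝ) (v : R3 × ℝ)
  have hG : bilinInChart ((𝓡 3).prod 𝓘(ℝ, ℝ)) (beltramiMetric h A) (x, ρ)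
      =ᶠ[𝓝 (y, ρ)] beltramiE H α := beltramiInChart_eventuallyEq h A x ρ
  have hr1 : ricci ((𝓡 3).prod 𝓘(ℝ, ℝ)) (beltramiMetric h A) (x, ρ) u v
      = ricciE (bilinInChart ((𝓡 3).prod 𝓘(ℝ, ℝ)) (beltramiMetric h A) (x, ρ)) (y, ρ) u v := by
    rw [ricci_apply, extChartAt_prod_line_apply]
  have hr2 : ∀ u v : R3, ricci (𝓡 3) h.inner x u v = ricciE H y u v :=
    ricci_apply (𝓡 3) h.inner x
  exact hr1.trans ((ricciE_congr hG _ _).trans (key.trans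
    (congrArg₂ (fun a b : ℝ => a - 2 * b) (hr2 _ _).symm (hHy _ _))))

lemma ricci_zero_zero (h : AnalyticMetric N) (x : N) : ricci (𝓡 3) h.inner x 0 0 = 0 := by
  have h1 : ∀ (G : R3 → R3 →L[ℝ] R3 →L[ℝ] ℝ) y u, christoffelE G y u 0 = 0 := fun G y u => by
    have : koszulE G y u 0 = 0 := by ext w; simp [koszulE]
    rw [christoffelE, this, smul_zero, map_zero]
  have h2 := ricci_apply (𝓡 3) h.inner x 0 0
  refine h2.trans ?_
  change ricciE _ _ (0 : R3) (0 : R3) = 0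
  simp [ricciE, curvatureE, h1]

/-- The Beltrami metric is Einstein exactly when `Ric_h = 2 h`. -/
theorem isEinsteinOn_beltramiMetric_iff {h : AnalyticMetric N} {o : ManifoldOrientation N}
    {A : OneForm (𝓡 3) N} (hA : IsBeltramiField h o A) :
    IsEinsteinOn ((𝓡 3).prod 𝓘(ℝ, ℝ)) (beltramiMetric h A) (totalSpace N) ↔
      ∀ (x : N) (u v : TangentSpace (𝓡 3) x), ricci (𝓡 3) h.inner x u v = 2 * h.inner x u v := by
  constructor
  · rintro ⟨c, hc⟩ x u v
    have hR : ∀ u v : R3 × ℝ, ricci (𝓡 3) h.inner x u.1 v.1 - 2 * h.inner x u.1 v.1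
        = c * (1 ^ 2 * h.inner x u.1 v.1 + (1 ^ 2)⁻¹ * ((1 * u.2 + A x u.1)
          * (1 * v.2 + A x v.1))) := fun u v => by
      have h1 := hc (x, 1) ⟨mem_univ _, one_pos (α := ℝ)⟩ u v
      exact (ricci_beltramiMetric hA (p := (x, 1)) one_pos u v).symm.trans
        (h1.trans (congrArg (c * ·) (beltramiMetric_apply h A (x, 1) u v)))
    have h0 := hR (0, 1) (0, 1)
    have hz : ricci (𝓡 3) h.inner x (0 : R3) (0 : R3) = 0 := ricci_zero_zero h x
    have hi : h.inner x (0 : R3) (0 : R3) = 0 := map_zero (h.inner x (0 : R3))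
    have ha : A x (0 : R3) = 0 := map_zero (A x)
    rw [hz, hi, ha] at h0
    have hc0 : c = 0 := by linarith
    have h2 := hR (u, 0) (v, 0)
    rw [hc0, zero_mul] at h2
    exact sub_eq_zero.1 h2
  · intro hR
    refine ⟨0, fun p hp u v => ?_⟩
    exact (ricci_beltramiMetric hA hp.2 u v).trans
      ((sub_eq_zero.2 (hR p.1 _ _)).trans (zero_mul _).symm)

end

/-! ### The soliton equation for the Beltrami metric -/

section Slices

variable {𝕜 : Type*} [NontriviallyNormedField 𝕜]
  {E : Type*} [NormedAddCommGroup E] [NormedSpace 𝕜 E]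

/-- The component along `E` of a vector field on `E × 𝕜`, on the slice of height `ρ`. -/
def sliceField (X : E × 𝕜 → E × 𝕜) (ρ : 𝕜) (z : E) : E := (X (z, ρ)).1

lemma hasFDerivAt_sliceField {X : E × 𝕜 → E × 𝕜} {ρ : 𝕜} {y : E}
    (hX : DifferentiableAt 𝕜 X (y, ρ)) :
    HasFDerivAt (sliceField X ρ) ((ContinuousLinearMap.fst 𝕜 E 𝕜).comp
      ((fderiv 𝕜 X (y, ρ)).comp (ContinuousLinearMap.inl 𝕜 E 𝕜))) y :=
  (HasFDerivAt.comp (f := fun z : E => (z, ρ)) y hX.hasFDerivAt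
    ((hasFDerivAt_id y).prodMk (hasFDerivAt_const ρ y))).fst

lemma fderiv_sliceField {X : E × 𝕜 → E × 𝕜} {ρ : 𝕜} {y : E}
    (hX : DifferentiableAt 𝕜 X (y, ρ)) (u : E) :
    fderiv 𝕜 (sliceField X ρ) y u = (fderiv 𝕜 X (y, ρ) (u, 0)).1 := by
  rw [(hasFDerivAt_sliceField hX).fderiv]; rfl

lemma hasDerivAt_apply_line {F : Type*} [NormedAddCommGroup F] [NormedSpace 𝕜 F]
    {X : E × 𝕜 → F} {ρ : 𝕜} {y : E} (hX : DifferentiableAt 𝕜 X (y, ρ)) :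
    HasDerivAt (fun t => X (y, t)) (fderiv 𝕜 X (y, ρ) (0, 1)) ρ :=
  HasFDerivAt.comp_hasDerivAt (l := X) (f := fun t : 𝕜 => (y, t)) ρ hX.hasFDerivAt
    ((hasDerivAt_const ρ y).prodMk (hasDerivAt_id ρ))

/-- The Lie derivative of the pull-back of a bilinear form to a product with a line, restricted to
a slice, is the Lie derivative along the slice of the field. -/
lemma lieDerivE_pullback_fst {X : E × 𝕜 → E × 𝕜} {T : E → E →L[𝕜] E →L[𝕜] 𝕜}
    {S : E × 𝕜 → E × 𝕜 →L[𝕜] E × 𝕜 →L[𝕜] 𝕜} {ρ : 𝕜} {y : E}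
    (hX : DifferentiableAt 𝕜 X (y, ρ)) (hT : DifferentiableAt 𝕜 T y)
    (hS : S =ᶠ[𝓝 (y, ρ)] fun q => pullBilin (ContinuousLinearMap.fst 𝕜 E 𝕜) (T q.1)) (u v : E) :
    lieDerivE X S (y, ρ) (u, 0) (v, 0) = lieDerivE (sliceField X ρ) T y u v := by
  have hT' : HasFDerivAt (fun q : E × 𝕜 => T q.1)
      ((fderiv 𝕜 T y).comp (ContinuousLinearMap.fst 𝕜 E 𝕜)) (y, ρ) :=
    HasFDerivAt.comp (g := T) (y, ρ) hT.hasFDerivAt hasFDerivAt_fst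
  have hSd : DifferentiableAt 𝕜 S (y, ρ) :=
    ((differentiableAt_const _).clm_comp (hT'.differentiableAt.clm_comp
      (differentiableAt_const _))).congr_of_eventuallyEq hS
  have e1 : ∀ a b c : E × 𝕜, fderiv 𝕜 S (y, ρ) a b c = fderiv 𝕜 T y a.1 b.1 c.1 := by
    intro a b c
    rw [← fderiv_apply_const₂ hSd b c]
    have h1 : (fun z => S z b c) =ᶠ[𝓝 (y, ρ)] fun q => T q.1 b.1 c.1 := by
      filter_upwards [hS] with q hq
      rw [hq]; rfl
    rw [h1.fderiv_eq (𝕜 := 𝕜), fderiv_apply_const₂ hT'.differentiableAt, hT'.fderiv]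
    rfl
  have e2 : ∀ a b, S (y, ρ) a b = T y a.1 b.1 := fun a b => by rw [hS.self_of_nhds]; rfl
  rw [lieDerivE_apply, lieDerivE_apply, e1, e2, e2, fderiv_sliceField hX, fderiv_sliceField hX]
  rfl

end Slices

section LocalSoliton

variable {E : Type*} [NormedAddCommGroup E] [NormedSpace ℝ E]
  {H : E → E →L[ℝ] E →L[ℝ] ℝ} {α : E → E →L[ℝ] ℝ} {X : E × ℝ → E × ℝ} {y : E} {ρ : ℝ}

lemma lieDerivE_beltramiE_vertical (hρ : ρ ≠ 0) (hH : DifferentiableAt ℝ H y)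
    (hα : DifferentiableAt ℝ α y) (hG : DifferentiableAt ℝ (beltramiE H α) (y, ρ)) :
    lieDerivE X (beltramiE H α) (y, ρ) (0, 1) (0, 1)
      = 2 * ((fderiv ℝ X (y, ρ) (0, 1)).2 + α y (fderiv ℝ X (y, ρ) (0, 1)).1 / ρ) := by
  rw [lieDerivE_apply, fderiv_beltramiE (by exact hρ) hH hα hG, beltramiE_apply (by exact hρ),
    beltramiE_apply (by exact hρ)]
  simp [etaDeriv]
  ring

lemma lieDerivE_beltramiE_horizontal (hρ : ρ ≠ 0) (hH : DifferentiableAt ℝ H y)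
    (hα : DifferentiableAt ℝ α y) (hG : DifferentiableAt ℝ (beltramiE H α) (y, ρ))
    (hX : DifferentiableAt ℝ X (y, ρ)) (u v : E) :
    lieDerivE X (beltramiE H α) (y, ρ) (u, -α y u / ρ) (v, -α y v / ρ)
      = 2 * ρ * (X (y, ρ)).2 * H y u v + ρ ^ 2 * lieDerivE (sliceField X ρ) H y u v
        - ρ * (α y u * H y (fderiv ℝ X (y, ρ) (0, 1)).1 v
          + α y v * H y u (fderiv ℝ X (y, ρ) (0, 1)).1) := by
  have e1 : ∀ u : E, (fderiv ℝ X (y, ρ) (u, -α y u / ρ))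
      = fderiv ℝ X (y, ρ) (u, 0) + (-α y u / ρ) • fderiv ℝ X (y, ρ) (0, 1) := by
    intro u
    rw [← map_smul, ← map_add]
    congr 1
    ext <;> simp
  rw [lieDerivE_apply, fderiv_beltramiE (by exact hρ) hH hα hG, beltramiE_apply (by exact hρ),
    beltramiE_apply (by exact hρ), lieDerivE_apply, e1, e1, fderiv_sliceField hX,
    fderiv_sliceField hX]
  simp only [Prod.fst_add, Prod.smul_fst, map_add, map_smul, add_apply, smul_apply, smul_eq_mul,
    sliceField]
  field_simp
  ring

end LocalSoliton

section ManifoldSoliton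

variable {𝕜 : Type*} [NontriviallyNormedField 𝕜]
  {E : Type*} [NormedAddCommGroup E] [NormedSpace 𝕜 E]
  {H : Type*} [TopologicalSpace H] (I : ModelWithCorners 𝕜 E H)
  {M : Type*} [TopologicalSpace M] [ChartedSpace H M]

/-- The expression of a vector field on a product with a line in the chart at `x₀` of the first
factor. -/
noncomputable def lineField (X : VField (I.prod 𝓘(𝕜, 𝕜)) (M × 𝕜)) (x₀ : M) : E × 𝕜 → E × 𝕜 :=
  vfieldInChart (I.prod 𝓘(𝕜, 𝕜)) X (x₀, 0)

lemma extChartAt_line_base (x₀ : M) (ρ ρ' : 𝕜) :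
    extChartAt (I.prod 𝓘(𝕜, 𝕜)) (x₀, ρ) = extChartAt (I.prod 𝓘(𝕜, 𝕜)) (x₀, ρ') := by
  simp only [extChartAt_prod, extChartAt_model_space_eq_id]

lemma vfieldInChart_line_eq (X : VField (I.prod 𝓘(𝕜, 𝕜)) (M × 𝕜)) (x₀ : M) (ρ : 𝕜) :
    vfieldInChart (I.prod 𝓘(𝕜, 𝕜)) X (x₀, ρ) = lineField I X x₀ := by
  unfold lineField vfieldInChart
  funext y
  rw [extChartAt_line_base I x₀ ρ 0]

lemma lineField_apply [IsManifold I 1 M] (X : VField (I.prod 𝓘(𝕜, 𝕜)) (M × 𝕜)) {x₀ x : M}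
    (hx : x ∈ (extChartAt I x₀).source) (ρ : 𝕜) :
    lineField I X x₀ (extChartAt I x₀ x, ρ)
      = (chartReading I x₀ x (X (x, ρ) : E × 𝕜).1, (X (x, ρ) : E × 𝕜).2) :=
  vfieldInChart_line I (p := (x₀, 0)) (q := (x, ρ)) hx X

lemma contDiffAt_lineField [CompleteSpace 𝕜] [I.Boundaryless] [IsManifold I ω M]
    {X : VField (I.prod 𝓘(𝕜, 𝕜)) (M × 𝕜)} {x₀ x : M} {ρ : 𝕜}
    (hx : x ∈ (extChartAt I x₀).source)
    (hX : ContMDiffAt (I.prod 𝓘(𝕜, 𝕜)) (I.prod 𝓘(𝕜, 𝕜)).tangent ω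
      (fun p => (⟨p, X p⟩ : TangentBundle (I.prod 𝓘(𝕜, 𝕜)) (M × 𝕜))) (x, ρ)) :
    ContDiffAt 𝕜 ω (lineField I X x₀) (extChartAt I x₀ x, ρ) := by
  have := contDiffAt_vfieldInChart (I.prod 𝓘(𝕜, 𝕜)) (x₀ := (x₀, 0)) (x := (x, ρ))
    ((mem_extChartAt_source_line I).2 hx) hX
  rwa [extChartAt_prod_line_apply] at this

end ManifoldSoliton

section Equations

variable {N : Type*} [TopologicalSpace N] [ChartedSpace R3 N] [IsManifold (𝓡 3) ω N]

lemma lieDerivE_congr {𝕜 E : Type*} [NontriviallyNormedField 𝕜] [NormedAddCommGroup E]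
    [NormedSpace 𝕜 E] {X X' : E → E} {T T' : E → E →L[𝕜] E →L[𝕜] 𝕜} {y : E}
    (hX : X =ᶠ[𝓝 y] X') (hT : T =ᶠ[𝓝 y] T') : lieDerivE X T y = lieDerivE X' T' y := by
  simp only [lieDerivE, hX.self_of_nhds, hT.self_of_nhds, hX.fderiv_eq (𝕜 := 𝕜),
    hT.fderiv_eq (𝕜 := 𝕜)]

/-- The soliton equation for the Beltrami metric: the vertical and the horizontal components. -/
theorem soliton_equations {h : AnalyticMetric N} {o : ManifoldOrientation N}
    {A : OneForm (𝓡 3) N} (hA : IsBeltramiField h o A)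
    {X : VField ((𝓡 3).prod 𝓘(ℝ, ℝ)) (N × ℝ)} {a : ℝ} {x : N} {ρ : ℝ} (hρ : 0 < ρ)
    (hX : ContMDiffAt ((𝓡 3).prod 𝓘(ℝ, ℝ)) ((𝓡 3).prod 𝓘(ℝ, ℝ)).tangent ω
      (fun p => (⟨p, X p⟩ : TangentBundle ((𝓡 3).prod 𝓘(ℝ, ℝ)) (N × ℝ))) (x, ρ))
    (hsol : ∀ u v : TangentSpace ((𝓡 3).prod 𝓘(ℝ, ℝ)) (x, ρ),
      ricci ((𝓡 3).prod 𝓘(ℝ, ℝ)) (beltramiMetric h A) (x, ρ) u v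
        + a * beltramiMetric h A (x, ρ) u v
        + 1 / 2 * lieDeriv ((𝓡 3).prod 𝓘(ℝ, ℝ)) X (beltramiMetric h A) (x, ρ) u v = 0) :
    (a + (fderiv ℝ (lineField (𝓡 3) X x) (extChartAt (𝓡 3) x x, ρ) (0, 1)).2
      + A x (fderiv ℝ (lineField (𝓡 3) X x) (extChartAt (𝓡 3) x x, ρ) (0, 1)).1 / ρ = 0) ∧
    ∀ u v : R3, ricci (𝓡 3) h.inner x u v - 2 * h.inner x u v
      + (a * ρ ^ 2 + ρ * (lineField (𝓡 3) X x (extChartAt (𝓡 3) x x, ρ)).2) * h.inner x u v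
      + 1 / 2 * ρ ^ 2 * lieDerivE (sliceField (lineField (𝓡 3) X x) ρ)
          (bilinInChart (𝓡 3) h.inner x) (extChartAt (𝓡 3) x x) u v
      - 1 / 2 * ρ * (A x u * h.inner x
          (fderiv ℝ (lineField (𝓡 3) X x) (extChartAt (𝓡 3) x x, ρ) (0, 1)).1 v
        + A x v * h.inner x u
          (fderiv ℝ (lineField (𝓡 3) X x) (extChartAt (𝓡 3) x x, ρ) (0, 1)).1) = 0 := by
  have hxs := mem_extChartAt_source (I := 𝓡 3) x
  have hH := contDiffAt_metric h hxs
  have hα := contDiffAt_beltramiField hA hxs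
  have hHd : DifferentiableAt ℝ (bilinInChart (𝓡 3) h.inner x) (extChartAt (𝓡 3) x x) :=
    hH.differentiableAt (by simp)
  have hαd : DifferentiableAt ℝ (oneFormInChart (𝓡 3) A x) (extChartAt (𝓡 3) x x) :=
    hα.differentiableAt (by simp)
  have hGd : DifferentiableAt ℝ (beltramiE (bilinInChart (𝓡 3) h.inner x)
      (oneFormInChart (𝓡 3) A x)) (extChartAt (𝓡 3) x x, ρ) :=
    (contDiffAt_beltramiE (n := 1) hρ.ne' (hH.of_le le_top)
      (hα.of_le (by norm_cast))).differentiableAt (by simp)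
  have hXd : DifferentiableAt ℝ (lineField (𝓡 3) X x) (extChartAt (𝓡 3) x x, ρ) :=
    (contDiffAt_lineField (𝓡 3) hxs hX).differentiableAt (by simp)
  have hLie : ∀ u v : R3 × ℝ,
      lieDeriv ((𝓡 3).prod 𝓘(ℝ, ℝ)) X (beltramiMetric h A) (x, ρ) u v
        = lieDerivE (lineField (𝓡 3) X x) (beltramiE (bilinInChart (𝓡 3) h.inner x)
          (oneFormInChart (𝓡 3) A x)) (extChartAt (𝓡 3) x x, ρ) u v := by
    intro u v
    refine (lieDeriv_apply ((𝓡 3).prod 𝓘(ℝ, ℝ)) X (beltramiMetric h A) (x, ρ) u v).trans ?_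
    rw [vfieldInChart_line_eq, extChartAt_prod_line_apply,
      lieDerivE_congr .rfl (beltramiInChart_eventuallyEq h A x ρ)]
  have hsol' : ∀ u v : R3 × ℝ, ricci (𝓡 3) h.inner x u.1 v.1 - 2 * h.inner x u.1 v.1
      + a * (ρ ^ 2 * h.inner x u.1 v.1 + (ρ ^ 2)⁻¹ * ((ρ * u.2 + A x u.1) * (ρ * v.2 + A x v.1)))
      + 1 / 2 * lieDerivE (lineField (𝓡 3) X x) (beltramiE (bilinInChart (𝓡 3) h.inner x)
          (oneFormInChart (𝓡 3) A x)) (extChartAt (𝓡 3) x x, ρ) u v = 0 := by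
    intro u v
    have e1 := ricci_beltramiMetric hA (p := (x, ρ)) hρ u v
    have e2 := beltramiMetric_apply h A (x, ρ) u v
    have e3 := hsol u v
    exact (congrArg₂ (fun a b : ℝ => a + b) (congrArg₂ (fun b c : ℝ => b + a * c) e1 e2)
      (congrArg (1 / 2 * ·) (hLie u v))).symm.trans e3
  have hHx : ∀ u v : R3, bilinInChart (𝓡 3) h.inner x (extChartAt (𝓡 3) x x) u v
      = h.inner x u v := bilinInChart_self (𝓡 3) x h.inner
  have hαx : ∀ u : R3, oneFormInChart (𝓡 3) A x (extChartAt (𝓡 3) x x) u = A x u :=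
    oneFormInChart_self (𝓡 3) x A
  have hz : ricci (𝓡 3) h.inner x (0 : R3) (0 : R3) = 0 := ricci_zero_zero h x
  have hi : h.inner x (0 : R3) (0 : R3) = 0 := map_zero (h.inner x (0 : R3))
  have ha : A x (0 : R3) = 0 := map_zero (A x)
  constructor
  · have := hsol' (0, 1) (0, 1)
    rw [lieDerivE_beltramiE_vertical hρ.ne' hHd hαd hGd] at this
    simp only [hz, hi, ha, hαx] at this
    rw [← this]
    field_simp
    ring
  · intro u v
    have := hsol' (u, -A x u / ρ) (v, -A x v / ρ)
    have e := lieDerivE_beltramiE_horizontal (X := lineField (𝓡 3) X x) hρ.ne' hHd hαd hGd hXd u v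
    simp only [hαx, hHx] at e
    rw [e] at this
    have h1 : ∀ c : ℝ, ρ * (-c / ρ) + c = 0 := fun c => by field_simp; ring
    simp only [h1] at this
    rw [← this]
    ring

end Equations

/-! ### Identities between functions which are analytic along a circle -/

section Circle

variable {r : ℝ}

/-- A function which is analytic along a circle and vanishes on a real interval meeting the circle
vanishes on the circle. -/
lemma eq_zero_on_circle (hr : 0 < r) {f : ℂ → ℂ} (hf : AnalyticOnNhd ℂ f (Metric.sphere 0 r))
    (h : ∀ᶠ t : ℝ in 𝓝 r, f t = 0) : ∀ z ∈ Metric.sphere (0 : ℂ) r, f z = 0 := by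
  have hpre : IsPreconnected (Metric.sphere (0 : ℂ) r) :=
    isPreconnected_sphere (by rw [Complex.rank_real_complex]; norm_num) 0 r
  have hr' : (r : ℂ) ∈ Metric.sphere (0 : ℂ) r := by simp [abs_of_pos hr]
  refine fun z hz => hf.eqOn_zero_of_preconnected_of_frequently_eq_zero hpre hr' ?_ hz
  have ht : Tendsto (fun t : ℝ => (t : ℂ)) (𝓝[≠] r) (𝓝[≠] (r : ℂ)) :=
    tendsto_nhdsWithin_of_tendsto_nhds_of_eventually_within _
      (Complex.continuous_ofReal.continuousAt.tendsto.mono_left nhdsWithin_le_nhds)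
      (eventually_mem_nhdsWithin.mono fun t ht => by simpa using ht)
  exact ht.frequently (h.filter_mono nhdsWithin_le_nhds).frequently

lemma circleIntegrable_of_analytic (hr : 0 < r) {f : ℂ → ℂ}
    (hf : AnalyticOnNhd ℂ f (Metric.sphere 0 r)) : CircleIntegrable f 0 r :=
  hf.continuousOn.circleIntegrable hr.le

lemma analyticOnNhd_pow (n : ℕ) (s : Set ℂ) : AnalyticOnNhd ℂ (fun z : ℂ => z ^ n) s :=
  fun z _ => by fun_prop

/-- A linear relation between analytic functions along a circle may be integrated. -/
lemma circleIntegral_linear_relation (hr : 0 < r) {m : ℕ} (k : Fin m → ℂ) (g : Fin m → ℂ → ℂ)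
    (hg : ∀ i, AnalyticOnNhd ℂ (g i) (Metric.sphere 0 r))
    (h : ∀ z ∈ Metric.sphere (0 : ℂ) r, ∑ i, k i * g i z = 0) :
    ∑ i, k i * (∮ z in C(0, r), g i z) = 0 := by
  have h1 : (∮ z in C(0, r), ∑ i, k i * g i z) = ∮ z in C((0 : ℂ), r), (0 : ℂ) :=
    circleIntegral.integral_congr hr.le h
  have h2 : (∮ z in C((0 : ℂ), r), (0 : ℂ)) = 0 := by simp [circleIntegral]
  rw [h2, circleIntegral.integral_fun_sum fun i _ => circleIntegrable_of_analytic hr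
    (analyticOnNhd_const.mul (hg i))] at h1
  simpa only [circleIntegral.integral_const_mul] using h1

/-- Integration by parts along a circle. -/
lemma circleIntegral_pow_mul_deriv (hr : 0 < r) {f : ℂ → ℂ}
    (hf : AnalyticOnNhd ℂ f (Metric.sphere 0 r)) (n : ℕ) :
    (∮ z in C(0, r), z ^ n * deriv f z) = -n * ∮ z in C(0, r), z ^ (n - 1) * f z := by
  have h1 : (∮ z in C(0, r), ((n * (z ^ (n - 1) * f z)) + z ^ n * deriv f z)) = 0 := by
    refine circleIntegral.integral_eq_zero_of_hasDerivWithinAt (f := fun z => z ^ n * f z) hr.le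
      fun z hz => ?_
    have := ((hasDerivAt_pow n z).mul (hf z hz).differentiableAt.hasDerivAt).hasDerivWithinAt
      (s := Metric.sphere 0 r)
    rwa [mul_assoc] at this
  rw [circleIntegral.integral_add] at h1
  · rw [circleIntegral.integral_const_mul] at h1
    linear_combination h1
  · exact circleIntegrable_of_analytic hr
      (analyticOnNhd_const.mul ((analyticOnNhd_pow _ _).mul hf))
  · exact circleIntegrable_of_analytic hr ((analyticOnNhd_pow _ _).mul hf.deriv)

lemma circleIntegral_deriv (hr : 0 < r) {f : ℂ → ℂ}
    (hf : AnalyticOnNhd ℂ f (Metric.sphere 0 r)) : (∮ z in C(0, r), deriv f z) = 0 := by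
  have := circleIntegral_pow_mul_deriv hr hf 0
  simpa using this

lemma circleIntegral_pow (hr : 0 < r) (n : ℕ) : (∮ z in C(0, r), z ^ n) = 0 := by
  have h := circleIntegral_pow_mul_deriv hr (analyticOnNhd_pow (n + 1) _) 0
  simp only [pow_zero, one_mul, Nat.cast_zero, neg_zero, zero_mul] at h
  have h2 : (∮ z in C(0, r), deriv (fun w : ℂ => w ^ (n + 1)) z)
      = (n + 1 : ℂ) * ∮ z in C(0, r), z ^ n := by
    rw [← circleIntegral.integral_const_mul]
    congr 1
    funext z
    simp
  rw [h2] at h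
  exact (mul_eq_zero.1 h).resolve_left (by exact_mod_cast Nat.succ_ne_zero n)

/-- If `α ⊙ Y` is a multiple of the identity in dimension three, with `α ≠ 0` real, then `Y = 0`. -/
lemma eq_zero_of_symmetric_product {α : Fin 3 → ℝ} (hα : α ≠ 0) {Y : Fin 3 → ℂ} {μ : ℂ}
    (h : ∀ i j, α i * Y j + α j * Y i = if i = j then μ else 0) : Y = 0 := by
  obtain ⟨i, hi⟩ := Function.ne_iff.1 hα
  have hi' : (α i : ℂ) ≠ 0 := by exact_mod_cast hi
  obtain ⟨j, k, hij, hik, hjk, hall⟩ : ∃ j k : Fin 3, i ≠ j ∧ i ≠ k ∧ j ≠ k ∧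
      ∀ l, l = i ∨ l = j ∨ l = k := by clear hi' hi; revert i; decide
  have h1 := h i j
  have h2 := h i k
  have h3 := h j k
  have h4 := h i i
  have h5 := h j j
  simp only [hij, hik, hjk, if_false, if_true] at h1 h2 h3 h4 h5
  have hne : ((α i : ℂ) ^ 2 + (α j : ℂ) ^ 2) ≠ 0 := by
    have : 0 < α i ^ 2 + α j ^ 2 := by
      have : α i ≠ 0 := hi
      positivity
    exact_mod_cast this.ne'
  have hYi : Y i = 0 := by
    have : ((α i : ℂ) ^ 2 + (α j : ℂ) ^ 2) * Y i = 0 := by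
      linear_combination (α i : ℂ) / 2 * (h4 - h5) + (α j : ℂ) * h1
    exact (mul_eq_zero.1 this).resolve_left hne
  have hYj : Y j = 0 := by
    rw [hYi, mul_zero, add_zero] at h1
    exact (mul_eq_zero.1 h1).resolve_left hi'
  have hYk : Y k = 0 := by
    rw [hYi, mul_zero, add_zero] at h2
    exact (mul_eq_zero.1 h2).resolve_left hi'
  funext l
  rcases hall l with rfl | rfl | rfl <;> assumption

variable {c : Fin 3 → ℂ → ℂ} {F : ℂ → ℂ} {L : Fin 3 → Fin 3 → ℂ → ℂ} {α : Fin 3 → ℝ}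
  {R : Fin 3 → Fin 3 → ℝ} {a : ℝ}

/-- The horizontal equation, integrated against `ρ ^ n`. -/
lemma circle_horizontal_pow (hr : 0 < r) (hc : ∀ k, AnalyticOnNhd ℂ (c k) (Metric.sphere 0 r))
    (hF : AnalyticOnNhd ℂ F (Metric.sphere 0 r))
    (hL : ∀ i j, AnalyticOnNhd ℂ (L i j) (Metric.sphere 0 r))
    (h3 : ∀ i j, ∀ᶠ t : ℝ in 𝓝 r, (R i j : ℂ) + (a * t ^ 2 + t * F t) * (if i = j then 1 else 0)
      + 1 / 2 * t ^ 2 * L i j t - 1 / 2 * t * (α i * deriv (c j) t + α j * deriv (c i) t) = 0)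
    (n : ℕ) (i j : Fin 3) :
    (∮ z in C(0, r), z ^ (n + 1) * F z) * (if i = j then 1 else 0)
      + 1 / 2 * (∮ z in C(0, r), z ^ (n + 2) * L i j z)
      - 1 / 2 * (α i * (∮ z in C(0, r), z ^ (n + 1) * deriv (c j) z)
        + α j * (∮ z in C(0, r), z ^ (n + 1) * deriv (c i) z)) = 0 := by
  have hp := fun m => analyticOnNhd_pow m (Metric.sphere (0 : ℂ) r)
  have hid : AnalyticOnNhd ℂ (fun z : ℂ => z) (Metric.sphere (0 : ℂ) r) := analyticOnNhd_id
  have hz := eq_zero_on_circle hr (f := fun z => (R i j : ℂ) + (a * z ^ 2 + z * F z)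
      * (if i = j then 1 else 0) + 1 / 2 * z ^ 2 * L i j z
      - 1 / 2 * z * (α i * deriv (c j) z + α j * deriv (c i) z))
    (((analyticOnNhd_const.add (((analyticOnNhd_const.mul (hp 2)).add (hid.mul hF)).mul
      analyticOnNhd_const)).add ((analyticOnNhd_const.mul (hp 2)).mul (hL i j))).sub
      ((analyticOnNhd_const.mul hid).mul ((analyticOnNhd_const.mul (hc j).deriv).add
        (analyticOnNhd_const.mul (hc i).deriv)))) (h3 i j)
  have h0 := circleIntegral_linear_relation hr
    ![(R i j : ℂ), a * (if i = j then 1 else 0), if i = j then 1 else 0, 1 / 2, -(1 / 2 * α i),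
      -(1 / 2 * α j)]
    ![fun z => z ^ n, fun z => z ^ (n + 2), fun z => z ^ (n + 1) * F z,
      fun z => z ^ (n + 2) * L i j z, fun z => z ^ (n + 1) * deriv (c j) z,
      fun z => z ^ (n + 1) * deriv (c i) z]
    (fun l => by
      fin_cases l
      exacts [hp n, hp (n + 2), (hp (n + 1)).mul hF, (hp (n + 2)).mul (hL i j),
        (hp (n + 1)).mul (hc j).deriv, (hp (n + 1)).mul (hc i).deriv])
    (fun z hzs => by
      have := hz z hzs
      generalize (if i = j then (1 : ℂ) else 0) = d at this ⊢
      simp only [Fin.sum_univ_six, Matrix.cons_val]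
      linear_combination z ^ n * this)
  generalize (if i = j then (1 : ℂ) else 0) = d at h0 ⊢
  simp only [Fin.sum_univ_six, Matrix.cons_val, circleIntegral_pow hr] at h0
  linear_combination h0

/-- If `∮ ρ ^ (n + 2) L` is a multiple of the identity, then `∮ ρ ^ n c = 0`. -/
theorem circle_moment_eq_zero (hr : 0 < r) (hα : α ≠ 0)
    (hc : ∀ k, AnalyticOnNhd ℂ (c k) (Metric.sphere 0 r))
    (hF : AnalyticOnNhd ℂ F (Metric.sphere 0 r))
    (hL : ∀ i j, AnalyticOnNhd ℂ (L i j) (Metric.sphere 0 r))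
    (h3 : ∀ i j, ∀ᶠ t : ℝ in 𝓝 r, (R i j : ℂ) + (a * t ^ 2 + t * F t) * (if i = j then 1 else 0)
      + 1 / 2 * t ^ 2 * L i j t - 1 / 2 * t * (α i * deriv (c j) t + α j * deriv (c i) t) = 0)
    (n : ℕ) {μ : ℂ} (hμ : ∀ i j, (∮ z in C(0, r), z ^ (n + 2) * L i j z) = if i = j then μ else 0)
    (k : Fin 3) : (∮ z in C(0, r), z ^ n * c k z) = 0 := by
  have h := circle_horizontal_pow hr hc hF hL h3 n
  have hY : (fun k => ∮ z in C(0, r), z ^ (n + 1) * deriv (c k) z) = 0 := by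
    refine eq_zero_of_symmetric_product hα
      (μ := 2 * (∮ z in C(0, r), z ^ (n + 1) * F z) + μ) fun i j => ?_
    have := h i j
    rw [hμ] at this
    split_ifs at this ⊢ <;> linear_combination -2 * this
  have := congrFun hY k
  rw [circleIntegral_pow_mul_deriv hr (hc k)] at this
  exact (mul_eq_zero.1 this).resolve_left
    (neg_ne_zero.2 (by exact_mod_cast Nat.succ_ne_zero n))

/-- The first moment of `L` is the residue given by `R`. -/
theorem circle_first_moment (hr : 0 < r)
    (hc : ∀ k, AnalyticOnNhd ℂ (c k) (Metric.sphere 0 r))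
    (hF : AnalyticOnNhd ℂ F (Metric.sphere 0 r))
    (hL : ∀ i j, AnalyticOnNhd ℂ (L i j) (Metric.sphere 0 r))
    (h1 : ∀ᶠ t : ℝ in 𝓝 r, (a : ℂ) + deriv F t + (∑ k, α k * deriv (c k) t) / t = 0)
    (h3 : ∀ i j, ∀ᶠ t : ℝ in 𝓝 r, (R i j : ℂ) + (a * t ^ 2 + t * F t) * (if i = j then 1 else 0)
      + 1 / 2 * t ^ 2 * L i j t - 1 / 2 * t * (α i * deriv (c j) t + α j * deriv (c i) t) = 0)
    (i j : Fin 3) :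
    (∮ z in C(0, r), z ^ 1 * L i j z) = -(4 * Real.pi * Complex.I) * R i j := by
  have hp := fun m => analyticOnNhd_pow m (Metric.sphere (0 : ℂ) r)
  have hid : AnalyticOnNhd ℂ (fun z : ℂ => z) (Metric.sphere (0 : ℂ) r) := analyticOnNhd_id
  have hne : ∀ z ∈ Metric.sphere (0 : ℂ) r, z ≠ 0 := fun z hz h0 => by
    rw [h0] at hz; simp at hz; exact hr.ne hz
  -- the mean of `F` vanishes
  have hF0 : (∮ z in C(0, r), F z) = 0 := by
    have hz := eq_zero_on_circle hr (f := fun z => (a : ℂ) * z + z ^ 1 * deriv F z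
        + (α 0 * deriv (c 0) z + α 1 * deriv (c 1) z + α 2 * deriv (c 2) z))
      (((analyticOnNhd_const.mul hid).add ((hp 1).mul hF.deriv)).add
        (((analyticOnNhd_const.mul (hc 0).deriv).add (analyticOnNhd_const.mul (hc 1).deriv)).add
        (analyticOnNhd_const.mul (hc 2).deriv))) (by
        filter_upwards [h1, lt_mem_nhds hr] with t ht ht0
        have ht0' : (t : ℂ) ≠ 0 := by exact_mod_cast ht0.ne'
        rw [Fin.sum_univ_three] at ht
        field_simp at ht
        linear_combination ht)
    have h0 := circleIntegral_linear_relation hr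
      ![(a : ℂ), 1, α 0, α 1, α 2]
      ![fun z => z ^ 1, fun z => z ^ 1 * deriv F z, deriv (c 0), deriv (c 1), deriv (c 2)]
      (fun l => by
        fin_cases l
        exacts [hp 1, (hp 1).mul hF.deriv, (hc 0).deriv, (hc 1).deriv, (hc 2).deriv])
      (fun z hzs => by
        have := hz z hzs
        simp [Fin.sum_univ_five] at this ⊢
        linear_combination this)
    have hz1 := circleIntegral_pow hr 1
    have hz2 := circleIntegral_pow_mul_deriv hr hF 1
    simp [Fin.sum_univ_five, circleIntegral_deriv hr (hc _)] at h0 hz1 hz2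
    rw [hz1, hz2] at h0
    simpa using h0
  have hz := eq_zero_on_circle hr (f := fun z => (R i j : ℂ) + (a * z ^ 2 + z * F z)
      * (if i = j then 1 else 0) + 1 / 2 * z ^ 2 * L i j z
      - 1 / 2 * z * (α i * deriv (c j) z + α j * deriv (c i) z))
    (((analyticOnNhd_const.add (((analyticOnNhd_const.mul (hp 2)).add (hid.mul hF)).mul
      analyticOnNhd_const)).add ((analyticOnNhd_const.mul (hp 2)).mul (hL i j))).sub
      ((analyticOnNhd_const.mul hid).mul ((analyticOnNhd_const.mul (hc j).deriv).add
        (analyticOnNhd_const.mul (hc i).deriv)))) (h3 i j)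
  have hinv : AnalyticOnNhd ℂ (fun z : ℂ => z⁻¹) (Metric.sphere (0 : ℂ) r) := fun z hz =>
    analyticAt_inv (hne z hz)
  have hres : (∮ z in C(0, r), z⁻¹) = 2 * Real.pi * Complex.I := by
    have := circleIntegral.integral_sub_center_inv 0 hr.ne'
    simpa using this
  have h0 := circleIntegral_linear_relation hr
    ![(R i j : ℂ), a * (if i = j then 1 else 0), if i = j then 1 else 0, 1 / 2, -(1 / 2 * α i),
      -(1 / 2 * α j)]
    ![fun z => z⁻¹, fun z => z ^ 1, F, fun z => z ^ 1 * L i j z, deriv (c j), deriv (c i)]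
    (fun l => by
      fin_cases l
      exacts [hinv, hp 1, hF, (hp 1).mul (hL i j), (hc j).deriv, (hc i).deriv])
    (fun z hzs => by
      have h5 := hz z hzs
      have h6 : z * z⁻¹ = 1 := mul_inv_cancel₀ (hne z hzs)
      generalize (if i = j then (1 : ℂ) else 0) = d at h5 ⊢
      simp only [Fin.sum_univ_six, Matrix.cons_val]
      linear_combination z⁻¹ * h5 - (d * (a * z + F z)
        + 1 / 2 * z * L i j z - 1 / 2 * (α i * deriv (c j) z + α j * deriv (c i) z)) * h6)
  have hz1 := circleIntegral_pow hr 1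
  rw [Fin.sum_univ_six] at h0
  simp only [Matrix.cons_val] at h0
  rw [hz1, hF0, hres, circleIntegral_deriv hr (hc _), circleIntegral_deriv hr (hc _)] at h0
  linear_combination 2 * h0

end Circle

/-! ### Circle integrals depending on parameters -/

section ParametricCircle

variable {E F G : Type} [NormedAddCommGroup E] [NormedSpace ℂ E] [NormedAddCommGroup F]
  [NormedSpace ℂ F] [CompleteSpace F] [NormedAddCommGroup G] [NormedSpace ℂ G] [CompleteSpace G]
  {r : ℝ}

lemma clm_circleIntegral_comm (L : F →L[ℂ] G) {f : ℂ → F} (hf : CircleIntegrable f 0 r) :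
    (∮ z in C(0, r), L (f z)) = L (∮ z in C(0, r), f z) := by
  rw [circleIntegral, circleIntegral, ← ContinuousLinearMap.intervalIntegral_comp_comm L hf.out]
  simp only [map_smul]

/-- A property of points of a product which holds near a slice over a compact set. -/
lemma eventually_forall_mem_sphere {P : E × ℂ → Prop} {z₀ : E}
    (h : ∀ ρ ∈ Metric.sphere (0 : ℂ) r, ∀ᶠ q in 𝓝 (z₀, ρ), P q) :
    ∀ᶠ z in 𝓝 z₀, ∀ ρ ∈ Metric.sphere (0 : ℂ) r, P (z, ρ) := by
  have := (isCompact_sphere (0 : ℂ) r).eventually_forall_of_forall_eventually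
    (x₀ := z₀) (P := fun z ρ => P (z, ρ)) h
  exact this

/-- Differentiation under a circle integral. -/
theorem hasFDerivAt_circleIntegral (hr : 0 ≤ r) {f : E × ℂ → F} {z₀ : E}
    (hf : ∀ ρ ∈ Metric.sphere (0 : ℂ) r, ContDiffAt ℂ 1 f (z₀, ρ)) :
    HasFDerivAt (fun z => ∮ ρ in C(0, r), f (z, ρ))
      (∮ ρ in C(0, r), (fderiv ℂ f (z₀, ρ)).comp (ContinuousLinearMap.inl ℂ E ℂ)) z₀ := by
  set D : E × ℂ → E →L[ℂ] F := fun q => (fderiv ℂ f q).comp (ContinuousLinearMap.inl ℂ E ℂ)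
    with hD
  have hDc : ∀ q, ContDiffAt ℂ 1 f q → ContinuousAt D q := fun q hq =>
    ((hq.fderiv_right (m := 0) (by norm_num)).clm_comp contDiffAt_const).continuousAt
  have hmem : ∀ θ, circleMap 0 r θ ∈ Metric.sphere (0 : ℂ) r := circleMap_mem_sphere 0 hr
  have hdc : Continuous (deriv (circleMap 0 r)) := by
    rw [show deriv (circleMap 0 r) = fun θ => circleMap 0 r θ * Complex.I from
      funext (deriv_circleMap 0 r)]
    exact (continuous_circleMap 0 r).mul continuous_const
  -- a bound near the circle
  obtain ⟨C, hC⟩ := (isCompact_sphere (0 : ℂ) r).exists_bound_of_continuousOn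
    (f := fun ρ => D (z₀, ρ)) (fun ρ hρ => ((hDc _ (hf ρ hρ)).comp
      (f := fun ρ : ℂ => (z₀, ρ)) (by fun_prop)).continuousWithinAt)
  have hs := eventually_forall_mem_sphere (r := r) (z₀ := z₀)
    (P := fun q => ContDiffAt ℂ 1 f q ∧ ‖D q‖ < C + 1) fun ρ hρ =>
    ((hf ρ hρ).eventually (by simp)).and
      ((hDc _ (hf ρ hρ)).norm.eventually_lt_const (lt_of_le_of_lt (hC ρ hρ) (lt_add_one C)))
  have hcont : ∀ z, (∀ ρ ∈ Metric.sphere (0 : ℂ) r, ContDiffAt ℂ 1 f (z, ρ)) →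
      Continuous fun θ => deriv (circleMap 0 r) θ • f (z, circleMap 0 r θ) := fun z hz =>
    hdc.smul
      (continuous_iff_continuousAt.2 fun θ => ((hz _ (hmem θ)).continuousAt).comp
        (f := fun θ => (z, circleMap 0 r θ)) (by fun_prop))
  have hcont' : Continuous fun θ => deriv (circleMap 0 r) θ • D (z₀, circleMap 0 r θ) :=
    hdc.smul
      (continuous_iff_continuousAt.2 fun θ => (hDc _ (hf _ (hmem θ))).comp
        (f := fun θ => (z₀, circleMap 0 r θ)) (by fun_prop))
  refine intervalIntegral.hasFDerivAt_integral_of_dominated_of_fderiv_le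
    (F := fun z θ => deriv (circleMap 0 r) θ • f (z, circleMap 0 r θ))
    (F' := fun z θ => deriv (circleMap 0 r) θ • D (z, circleMap 0 r θ))
    (bound := fun _ => r * (C + 1)) hs ?_ ?_ ?_ ?_ ?_ ?_
  · exact hs.mono fun z hz => (hcont z fun ρ hρ => (hz ρ hρ).1).aestronglyMeasurable
  · exact (hcont z₀ hf).intervalIntegrable _ _
  · exact hcont'.aestronglyMeasurable
  · refine .of_forall fun θ _ z hz => ?_
    have h1 : ‖deriv (circleMap 0 r) θ‖ = r := by simp [abs_of_nonneg hr]
    rw [norm_smul, h1]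
    exact mul_le_mul_of_nonneg_left (hz _ (hmem θ)).2.le hr
  · exact intervalIntegrable_const
  · refine .of_forall fun θ _ z hz => HasFDerivAt.const_smul ?_ _
    have h1 := ((hz _ (hmem θ)).1.differentiableAt (by simp)).hasFDerivAt
    exact HasFDerivAt.comp (f := fun z : E => (z, circleMap 0 r θ)) z h1
      ((hasFDerivAt_id z).prodMk (hasFDerivAt_const _ z))

lemma contDiffAt_circleIntegral_nat (hr : 0 ≤ r) (n : ℕ) : ∀ {F : Type} [NormedAddCommGroup F]
    [NormedSpace ℂ F] [CompleteSpace F] {f : E × ℂ → F} {z₀ : E},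
    (∀ ρ ∈ Metric.sphere (0 : ℂ) r, ContDiffAt ℂ ω f (z₀, ρ)) →
    ContDiffAt ℂ n (fun z => ∮ ρ in C(0, r), f (z, ρ)) z₀ := by
  induction n with
  | zero =>
    intro F _ _ _ f z₀ hf
    have h1 := eventually_forall_mem_sphere (r := r) (z₀ := z₀) fun ρ hρ =>
      (hf ρ hρ).eventually (by simp)
    refine contDiffAt_zero.2 ⟨_, h1, fun z hz => ?_⟩
    exact (hasFDerivAt_circleIntegral hr fun ρ hρ =>
      (hz ρ hρ).of_le le_top).continuousAt.continuousWithinAt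
  | succ n ih =>
    intro F _ _ _ f z₀ hf
    have h1 := eventually_forall_mem_sphere (r := r) (z₀ := z₀) fun ρ hρ =>
      (hf ρ hρ).eventually (by simp)
    refine contDiffAt_succ_iff_hasFDerivAt.2 ⟨fun z => ∮ ρ in C(0, r),
      (fderiv ℂ f (z, ρ)).comp (ContinuousLinearMap.inl ℂ E ℂ), ⟨_, h1, fun z hz =>
        hasFDerivAt_circleIntegral hr fun ρ hρ => (hz ρ hρ).of_le le_top⟩, ?_⟩
    exact ih (f := fun q => (fderiv ℂ f q).comp (ContinuousLinearMap.inl ℂ E ℂ)) fun ρ hρ =>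
      ((hf ρ hρ).fderiv_right (m := ω) (by simp)).clm_comp contDiffAt_const

/-- Circle integrals of functions which depend analytically on a parameter are smooth. -/
theorem contDiffAt_circleIntegral (hr : 0 ≤ r) {f : E × ℂ → F} {z₀ : E}
    (hf : ∀ ρ ∈ Metric.sphere (0 : ℂ) r, ContDiffAt ℂ ω f (z₀, ρ)) :
    ContDiffAt ℂ ∞ (fun z => ∮ ρ in C(0, r), f (z, ρ)) z₀ :=
  contDiffAt_infty.2 fun n => contDiffAt_circleIntegral_nat hr n hf

end ParametricCircle

/-! ### Identity theorems -/

section Identity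

variable {E F : Type*} [NormedAddCommGroup E] [NormedSpace ℂ E] [NormedAddCommGroup F]
  [NormedSpace ℂ F] [CompleteSpace F]

/-- The identity theorem on a ball, along the lines through a point. -/
lemma eqOn_zero_of_iteratedDeriv_line {T : E → F} {B : Set E} (hB : Convex ℝ B) (hBo : IsOpen B)
    (hT : DifferentiableOn ℂ T B) {q₀ : E} (hq₀ : q₀ ∈ B)
    (h : ∀ w n, iteratedDeriv n (fun t : ℂ => T (q₀ + t • w)) 0 = 0) : ∀ q ∈ B, T q = 0 := by
  intro q hq
  let l : ℂ → E := fun t => q₀ + t • (q - q₀)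
  have hl : Differentiable ℂ l := by fun_prop
  have hlo : IsOpen (l ⁻¹' B) := hBo.preimage hl.continuous
  have hlc : Convex ℝ (l ⁻¹' B) := by
    intro s hs t ht a b ha hb hab
    have : l (a • s + b • t) = a • l s + b • l t := by
      have e : q₀ = a • q₀ + b • q₀ := by rw [← add_smul, hab, one_smul]
      simp only [l]
      rw [add_smul, smul_assoc, smul_assoc, smul_add, smul_add]
      nth_rewrite 1 [e]
      abel
    rw [mem_preimage, this]
    exact hB hs ht ha hb hab
  have h0 : (0 : ℂ) ∈ l ⁻¹' B := by simpa [l] using hq₀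
  have h1 : (1 : ℂ) ∈ l ⁻¹' B := by simpa [l] using hq
  have hg : AnalyticOnNhd ℂ (T ∘ l) (l ⁻¹' B) :=
    (hT.comp hl.differentiableOn fun _ h => h).analyticOnNhd hlo
  have htop : analyticOrderAt (T ∘ l) 0 = ⊤ := by
    refine ENat.eq_top_iff_forall_ge.2 fun n => ?_
    exact (natCast_le_analyticOrderAt_iff_iteratedDeriv_eq_zero (hg 0 h0)).2
      fun i _ => h (q - q₀) i
  have := hg.eqOn_zero_of_preconnected_of_eventuallyEq_zero hlc.isPreconnected h0
    (analyticOrderAt_eq_top.1 htop) h1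
  simpa [l] using this

lemma eqOn_zero_of_eventually {T : E → F} {B : Set E} (hB : Convex ℝ B) (hBo : IsOpen B)
    (hT : DifferentiableOn ℂ T B) {q₀ : E} (hq₀ : q₀ ∈ B) (h : ∀ᶠ q in 𝓝 q₀, T q = 0) :
    ∀ q ∈ B, T q = 0 := by
  refine eqOn_zero_of_iteratedDeriv_line hB hBo hT hq₀ fun w n => ?_
  have hl : Tendsto (fun t : ℂ => q₀ + t • w) (𝓝 0) (𝓝 q₀) := by
    have : Continuous fun t : ℂ => q₀ + t • w := by fun_prop
    simpa using this.tendsto 0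
  have : (fun t : ℂ => T (q₀ + t • w)) =ᶠ[𝓝 0] fun _ => 0 := hl.eventually h
  rw [this.iteratedDeriv_eq]
  simp

variable {V : Type*} [NormedAddCommGroup V] [NormedSpace ℝ V] {φ : V → E} {y₀ : V}

/-- The derivative of a function which vanishes on a totally real submanifold vanishes there. -/
lemma fderiv_eq_zero_of_totally_real {T : E → F} {y : V} (hφ : DifferentiableAt ℝ φ y)
    (htr : ∀ w, ∃ u v, w = fderiv ℝ φ y u + Complex.I • fderiv ℝ φ y v)
    (hT : DifferentiableAt ℂ T (φ y)) (h : ∀ᶠ z in 𝓝 y, T (φ z) = 0) :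
    fderiv ℂ T (φ y) = 0 := by
  have h1 := (hT.hasFDerivAt.restrictScalars ℝ).comp y hφ.hasFDerivAt
  have h2 := h1.unique ((hasFDerivAt_const (0 : F) y).congr_of_eventuallyEq h)
  have h3 : ∀ u, fderiv ℂ T (φ y) (fderiv ℝ φ y u) = 0 := fun u => DFunLike.congr_fun h2 u
  ext w
  obtain ⟨u, v, rfl⟩ := htr w
  rw [map_add, map_smul, h3, h3]
  simp

/-- A holomorphic function which vanishes on a totally real submanifold of maximal dimension
vanishes. -/
theorem eqOn_zero_of_totally_real (hφ : ∀ᶠ y in 𝓝 y₀, DifferentiableAt ℝ φ y)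
    (htr : ∀ᶠ y in 𝓝 y₀, ∀ w, ∃ u v, w = fderiv ℝ φ y u + Complex.I • fderiv ℝ φ y v)
    {T : E → F} {B : Set E} (hB : Convex ℝ B) (hBo : IsOpen B)
    (hT : ContDiffOn ℂ ∞ T B) (hq₀ : φ y₀ ∈ B) (h : ∀ᶠ y in 𝓝 y₀, T (φ y) = 0) :
    ∀ q ∈ B, T q = 0 := by
  refine eqOn_zero_of_iteratedDeriv_line hB hBo (hT.differentiableOn (by simp)) hq₀ fun w n => ?_
  have hφB : ∀ᶠ y in 𝓝 y₀, φ y ∈ B :=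
    hφ.self_of_nhds.continuousAt.eventually (hBo.mem_nhds hq₀)
  have hl : Continuous fun t : ℂ => φ y₀ + t • w := by fun_prop
  induction n generalizing T with
  | zero => simpa using h.self_of_nhds
  | succ n ih =>
    have hTd : ∀ q ∈ B, DifferentiableAt ℂ T q := fun q hq =>
      (hT.differentiableOn (by simp)).differentiableAt (hBo.mem_nhds hq)
    have h1 := ih (T := fun q => fderiv ℂ T q w)
      ((hT.fderiv_of_isOpen hBo (m := ∞) (by simp)).clm_apply contDiffOn_const) (by
        filter_upwards [hφ, htr, h.eventually_nhds, hφB] with y h1 h2 h3 h4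
        rw [fderiv_eq_zero_of_totally_real h1 h2 (hTd _ h4) h3]; rfl)
    have h2 : deriv (fun t : ℂ => T (φ y₀ + t • w)) =ᶠ[𝓝 0]
        fun t => fderiv ℂ T (φ y₀ + t • w) w := by
      have : ∀ᶠ t : ℂ in 𝓝 0, φ y₀ + t • w ∈ B :=
        hl.continuousAt.eventually (hBo.mem_nhds (by simpa using hq₀))
      filter_upwards [this] with t ht
      have h3 := (hTd _ ht).hasFDerivAt.comp_hasDerivAt t
        (((hasDerivAt_id t).smul_const w).const_add (φ y₀))
      simpa [Function.comp_def] using h3.deriv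
    rw [iteratedDeriv_succ', h2.iteratedDeriv_eq, h1]

/-- Propagation, along a preconnected set, of a property which satisfies an identity principle. -/
lemma forall_of_preconnected {M : Type*} [TopologicalSpace M] {C : Set M} (hC : IsPreconnected C)
    {P : M → Prop} (hloc : ∀ p ∈ C, ∃ O ∈ 𝓝 p, (∃ q ∈ O, ∀ᶠ z in 𝓝 q, P z) → ∀ q ∈ O, P q)
    (h0 : ∃ p ∈ C, ∀ᶠ q in 𝓝 p, P q) : ∀ p ∈ C, P p := by
  have h : C ⊆ {p | ∀ᶠ q in 𝓝 p, P q} := by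
    refine hC.subset_of_closure_inter_subset isOpen_setOfPred_eventually_nhds h0 ?_
    rintro p ⟨hp, hpC⟩
    obtain ⟨O, hO, hOP⟩ := hloc p hpC
    obtain ⟨q, hqO, hq⟩ := mem_closure_iff_nhds.1 hp O hO
    exact mem_of_superset hO (hOP ⟨q, hqO, hq⟩)
  exact fun p hp => (h hp).self_of_nhds

end Identity

/-! ### Contour integrals of Lie derivatives -/

section SliceIntegrals

variable {E : Type} [NormedAddCommGroup E] [NormedSpace ℂ E]

/-- The contribution of the derivative of a vector field to the Lie derivative. -/
noncomputable def lieDerivative₁ (B : E →L[ℂ] E →L[ℂ] ℂ) : (E →L[ℂ] E) →L[ℂ] E →L[ℂ] E →L[ℂ] ℂ :=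
  ContinuousLinearMap.compL ℂ E E (E →L[ℂ] ℂ) B
    + ((ContinuousLinearMap.flipₗᵢ ℂ E E ℂ).toContinuousLinearEquiv.toContinuousLinearMap).comp
      (ContinuousLinearMap.compL ℂ E E (E →L[ℂ] ℂ) B.flip)

lemma lieDerivE_eq (X : E → E) (T : E → E →L[ℂ] E →L[ℂ] ℂ) (y : E) :
    lieDerivE X T y = fderiv ℂ T y (X y) + lieDerivative₁ (T y) (fderiv ℂ X y) :=
  ContinuousLinearMap.ext fun u => ContinuousLinearMap.ext fun v => by
    rw [lieDerivE_apply, add_assoc]; rfl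

variable {f : E × ℂ → E × ℂ} {y : E}

lemma fderiv_sliceField_eq {ρ : ℂ} (hf : DifferentiableAt ℂ f (y, ρ)) :
    fderiv ℂ (sliceField f ρ) y = (ContinuousLinearMap.fst ℂ E ℂ).comp
      ((fderiv ℂ f (y, ρ)).comp (ContinuousLinearMap.inl ℂ E ℂ)) :=
  (hasFDerivAt_sliceField hf).fderiv

lemma analyticAt_slice [CompleteSpace E] {ρ : ℂ} (hf : ContDiffAt ℂ ω f (y, ρ)) :
    AnalyticAt ℂ (fun t => f (y, t)) ρ :=
  (ContDiffAt.comp (f := fun t : ℂ => (y, t)) ρ hf (by fun_prop)).analyticAt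

lemma analyticAt_fderiv_sliceField [CompleteSpace E] {ρ : ℂ} (hf : ContDiffAt ℂ ω f (y, ρ)) :
    AnalyticAt ℂ (fun t => fderiv ℂ (sliceField f t) y) ρ := by
  have h1 : ContDiffAt ℂ ω (fun t : ℂ => (ContinuousLinearMap.fst ℂ E ℂ).comp
      ((fderiv ℂ f (y, t)).comp (ContinuousLinearMap.inl ℂ E ℂ))) ρ :=
    contDiffAt_const.clm_comp ((ContDiffAt.comp (f := fun t : ℂ => (y, t)) ρ
      (hf.fderiv_right (m := ω) (by simp)) (by fun_prop)).clm_comp contDiffAt_const)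
  refine (h1.congr_of_eventuallyEq ?_).analyticAt
  have h2 : ∀ᶠ t : ℂ in 𝓝 ρ, ContDiffAt ℂ ω f (y, t) :=
    (show ContinuousAt (fun t : ℂ => (y, t)) ρ by fun_prop).eventually (hf.eventually (by simp))
  filter_upwards [h2] with t ht
  exact fderiv_sliceField_eq (ht.differentiableAt (by simp))

lemma analyticAt_lieDerivE_sliceField [CompleteSpace E] {ρ : ℂ} (hf : ContDiffAt ℂ ω f (y, ρ))
    (T : E → E →L[ℂ] E →L[ℂ] ℂ) :
    AnalyticAt ℂ (fun t => lieDerivE (sliceField f t) T y) ρ := by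
  simp only [lieDerivE_eq]
  exact (((fderiv ℂ T y).analyticAt _).comp (f := fun t => (f (y, t)).1)
    (((ContinuousLinearMap.fst ℂ E ℂ).analyticAt _).comp (analyticAt_slice hf))).add
    (((lieDerivative₁ (T y)).analyticAt _).comp (analyticAt_fderiv_sliceField hf))

/-- Contour integrals of Lie derivatives along the slices are Lie derivatives along contour
integrals. -/
theorem circleIntegral_lieDerivE_sliceField [CompleteSpace E] {r : ℝ} (hr : 0 ≤ r)
    (hf : ∀ ρ ∈ Metric.sphere (0 : ℂ) r, ContDiffAt ℂ ω f (y, ρ)) (k : ℕ)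
    (T : E → E →L[ℂ] E →L[ℂ] ℂ) :
    (∮ ρ in C(0, r), ρ ^ k • lieDerivE (sliceField f ρ) T y)
      = lieDerivE (fun z => ∮ ρ in C(0, r), ρ ^ k • (f (z, ρ)).1) T y := by
  have h1 : ∀ ρ ∈ Metric.sphere (0 : ℂ) r,
      ContDiffAt ℂ ω (fun q : E × ℂ => q.2 ^ k • (f q).1) (y, ρ) := fun ρ hρ =>
    (contDiffAt_snd.pow k).smul (contDiffAt_fst.comp _ (hf ρ hρ))
  have h2 := hasFDerivAt_circleIntegral hr fun ρ hρ => (h1 ρ hρ).of_le le_top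
  have h3 : ∀ ρ ∈ Metric.sphere (0 : ℂ) r,
      (fderiv ℂ (fun q : E × ℂ => q.2 ^ k • (f q).1) (y, ρ)).comp (ContinuousLinearMap.inl ℂ E ℂ)
        = ρ ^ k • fderiv ℂ (sliceField f ρ) y := by
    intro ρ hρ
    have h4 := HasFDerivAt.comp (f := fun z : E => (z, ρ)) y
      ((h1 ρ hρ).differentiableAt (by simp)).hasFDerivAt
      ((hasFDerivAt_id y).prodMk (hasFDerivAt_const ρ y))
    have h5 := (hasFDerivAt_sliceField ((hf ρ hρ).differentiableAt (by simp))).const_smul (ρ ^ k)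
    rw [fderiv_sliceField_eq ((hf ρ hρ).differentiableAt (by simp))]
    exact h4.unique h5
  rw [circleIntegral.integral_congr hr h3] at h2
  have hi1 : CircleIntegrable (fun ρ => ρ ^ k • (f (y, ρ)).1) 0 r :=
    ContinuousOn.circleIntegrable hr fun ρ hρ => ContinuousAt.continuousWithinAt
      ((continuousAt_id.pow k).smul (analyticAt_slice (hf ρ hρ)).continuousAt.fst)
  have hi2 : CircleIntegrable (fun ρ => ρ ^ k • fderiv ℂ (sliceField f ρ) y) 0 r :=
    ContinuousOn.circleIntegrable hr fun ρ hρ => ContinuousAt.continuousWithinAt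
      ((continuousAt_id.pow k).smul (analyticAt_fderiv_sliceField (hf ρ hρ)).continuousAt)
  rw [lieDerivE_eq, h2.fderiv, ← clm_circleIntegral_comm _ hi1, ← clm_circleIntegral_comm _ hi2,
    ← circleIntegral.integral_add]
  · refine circleIntegral.integral_congr hr fun ρ _ => ?_
    simp only [lieDerivE_eq, map_smul, smul_add]
    rfl
  · exact ⟨(fderiv ℂ T y).integrable_comp hi1.1, (fderiv ℂ T y).integrable_comp hi1.2⟩
  · exact ⟨(lieDerivative₁ (T y)).integrable_comp hi2.1,
      (lieDerivative₁ (T y)).integrable_comp hi2.2⟩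

end SliceIntegrals

section ContourField

variable {NC : Type*} [TopologicalSpace NC] [ChartedSpace C3 NC] [IsManifold 𝓘(ℂ, C3) ω NC]
  {hC : BilinField 𝓘(ℂ, C3) NC} {XC : VField (𝓘(ℂ, C3).prod 𝓘(ℂ, ℂ)) (NC × ℂ)} {r : ℝ}

/-- The contour integral `∫_γ ρ^k X dρ` of the component of a vector field along `NC`. -/
noncomputable def contourField (XC : VField (𝓘(ℂ, C3).prod 𝓘(ℂ, ℂ)) (NC × ℂ)) (r : ℝ) (k : ℕ) :
    VField 𝓘(ℂ, C3) NC :=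
  fun p => (∮ ρ in C(0, r), ρ ^ k • (XC (p, ρ) : C3 × ℂ).1 : C3)

/-- `X` is holomorphic near the circle over `p`. -/
def IsHolomorphicOver (XC : VField (𝓘(ℂ, C3).prod 𝓘(ℂ, ℂ)) (NC × ℂ)) (r : ℝ) (p : NC) : Prop :=
  ∀ ρ ∈ Metric.sphere (0 : ℂ) r,
    ContMDiffAt (𝓘(ℂ, C3).prod 𝓘(ℂ, ℂ)) (𝓘(ℂ, C3).prod 𝓘(ℂ, ℂ)).tangent ω
      (fun p => (⟨p, XC p⟩ : TangentBundle (𝓘(ℂ, C3).prod 𝓘(ℂ, ℂ)) (NC × ℂ))) (p, ρ)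

lemma lineField_self (XC : VField (𝓘(ℂ, C3).prod 𝓘(ℂ, ℂ)) (NC × ℂ)) (p : NC) (ρ : ℂ) :
    lineField 𝓘(ℂ, C3) XC p (extChartAt 𝓘(ℂ, C3) p p, ρ) = XC (p, ρ) := by
  rw [lineField_apply 𝓘(ℂ, C3) XC (mem_extChartAt_source p)]
  exact Prod.ext (chartReading_self 𝓘(ℂ, C3) p _) rfl

lemma circleIntegrable_contourField (hr : 0 ≤ r) {p : NC} (hX : IsHolomorphicOver XC r p) (k : ℕ) :
    CircleIntegrable (fun ρ => ρ ^ k • (XC (p, ρ) : C3 × ℂ).1) 0 r := by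
  refine ContinuousOn.circleIntegrable hr fun ρ hρ => ContinuousAt.continuousWithinAt
    ((continuousAt_id.pow k).smul (ContinuousAt.fst ?_))
  have := (analyticAt_slice (contDiffAt_lineField 𝓘(ℂ, C3) (mem_extChartAt_source p)
    (hX ρ hρ))).continuousAt
  simp only [lineField_self] at this
  exact this

lemma vfieldInChart_contourField (hr : 0 ≤ r) {p₀ p : NC}
    (hp : p ∈ (extChartAt 𝓘(ℂ, C3) p₀).source) (hX : IsHolomorphicOver XC r p) (k : ℕ) :
    vfieldInChart 𝓘(ℂ, C3) (contourField XC r k) p₀ (extChartAt 𝓘(ℂ, C3) p₀ p)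
      = ∮ ρ in C(0, r), ρ ^ k • (lineField 𝓘(ℂ, C3) XC p₀ (extChartAt 𝓘(ℂ, C3) p₀ p, ρ)).1 := by
  have hi := circleIntegrable_contourField hr hX k
  rw [vfieldInChart_reading 𝓘(ℂ, C3) hp]
  refine (clm_circleIntegral_comm (chartReading 𝓘(ℂ, C3) p₀ p : C3 →L[ℂ] C3) hi).symm.trans ?_
  congr 1
  funext ρ
  rw [lineField_apply 𝓘(ℂ, C3) XC hp]
  exact map_smul (chartReading 𝓘(ℂ, C3) p₀ p : C3 →L[ℂ] C3) _ _

lemma vfieldInChart_contourField_eventuallyEq (hr : 0 ≤ r) {p₀ p : NC}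
    (hp : p ∈ (extChartAt 𝓘(ℂ, C3) p₀).source) (hX : ∀ᶠ q in 𝓝 p, IsHolomorphicOver XC r q)
    (k : ℕ) :
    vfieldInChart 𝓘(ℂ, C3) (contourField XC r k) p₀ =ᶠ[𝓝 (extChartAt 𝓘(ℂ, C3) p₀ p)]
      fun z => ∮ ρ in C(0, r), ρ ^ k • (lineField 𝓘(ℂ, C3) XC p₀ (z, ρ)).1 :=
  eventually_extChartAt 𝓘(ℂ, C3) hp
    (P := fun y => vfieldInChart 𝓘(ℂ, C3) (contourField XC r k) p₀ y
      = ∮ ρ in C(0, r), ρ ^ k • (lineField 𝓘(ℂ, C3) XC p₀ (y, ρ)).1)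
    (hX.mono fun _ hq hqs => vfieldInChart_contourField hr hqs hq k)

lemma contDiffAt_contourField (hr : 0 ≤ r) {p₀ p : NC}
    (hp : p ∈ (extChartAt 𝓘(ℂ, C3) p₀).source) (hX : ∀ᶠ q in 𝓝 p, IsHolomorphicOver XC r q)
    (k : ℕ) :
    ContDiffAt ℂ ∞ (vfieldInChart 𝓘(ℂ, C3) (contourField XC r k) p₀)
      (extChartAt 𝓘(ℂ, C3) p₀ p) := by
  refine ContDiffAt.congr_of_eventuallyEq ?_ (vfieldInChart_contourField_eventuallyEq hr hp hX k)
  exact contDiffAt_circleIntegral hr (f := fun q : C3 × ℂ =>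
    q.2 ^ k • (lineField 𝓘(ℂ, C3) XC p₀ q).1) fun ρ hρ => (contDiffAt_snd.pow k).smul
    (contDiffAt_fst.comp _ (contDiffAt_lineField 𝓘(ℂ, C3) hp (hX.self_of_nhds ρ hρ)))

lemma lieSlice_eq {p : NC} {ρ : ℂ}
    (hX : DifferentiableAt ℂ (lineField 𝓘(ℂ, C3) XC p) (extChartAt 𝓘(ℂ, C3) p p, ρ))
    (hh : DifferentiableAt ℂ (bilinInChart 𝓘(ℂ, C3) hC p) (extChartAt 𝓘(ℂ, C3) p p)) :
    lieSlice hC XC ρ p = lieDerivE (sliceField (lineField 𝓘(ℂ, C3) XC p) ρ)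
      (bilinInChart 𝓘(ℂ, C3) hC p) (extChartAt 𝓘(ℂ, C3) p p) := by
  have hm : ∀ u : C3, mfderiv 𝓘(ℂ, C3) (𝓘(ℂ, C3).prod 𝓘(ℂ, ℂ)) (fun q : NC => (q, ρ)) p u
      = (u, 0) := fun u => by rw [mfderiv_prod_left]; rfl
  have hS : bilinInChart (𝓘(ℂ, C3).prod 𝓘(ℂ, ℂ)) (pullback (𝓘(ℂ, C3).prod 𝓘(ℂ, ℂ)) 𝓘(ℂ, C3)
      Prod.fst hC) (p, ρ) =ᶠ[𝓝 (extChartAt 𝓘(ℂ, C3) p p, ρ)] fun q =>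
      pullBilin (ContinuousLinearMap.fst ℂ C3 ℂ) (bilinInChart 𝓘(ℂ, C3) hC p q.1) := by
    have h1 := eventually_extChartAt (𝓘(ℂ, C3).prod 𝓘(ℂ, ℂ)) (x₀ := (p, ρ)) (x := (p, ρ))
      (P := fun q => bilinInChart (𝓘(ℂ, C3).prod 𝓘(ℂ, ℂ)) (pullback (𝓘(ℂ, C3).prod 𝓘(ℂ, ℂ))
        𝓘(ℂ, C3) Prod.fst hC) (p, ρ) q
        = pullBilin (ContinuousLinearMap.fst ℂ C3 ℂ) (bilinInChart 𝓘(ℂ, C3) hC p q.1))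
      (mem_extChartAt_source _) (.of_forall fun q hq => by
        rw [extChartAt_prod_line_apply]
        exact bilinInChart_pullback_fst 𝓘(ℂ, C3) (p := (p, ρ))
          ((mem_extChartAt_source_line _).1 hq) hC)
    rwa [extChartAt_prod_line_apply] at h1
  refine ContinuousLinearMap.ext fun u => ContinuousLinearMap.ext fun v => ?_
  have h1 : lieSlice hC XC ρ p u v = lieDeriv (𝓘(ℂ, C3).prod 𝓘(ℂ, ℂ)) XC
      (pullback (𝓘(ℂ, C3).prod 𝓘(ℂ, ℂ)) 𝓘(ℂ, C3) Prod.fst hC) (p, ρ)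
      ((u, 0) : C3 × ℂ) ((v, 0) : C3 × ℂ) :=
    congrArg₂ (fun a b : C3 × ℂ => lieDeriv (𝓘(ℂ, C3).prod 𝓘(ℂ, ℂ)) XC
      (pullback (𝓘(ℂ, C3).prod 𝓘(ℂ, ℂ)) 𝓘(ℂ, C3) Prod.fst hC) (p, ρ) a b) (hm u) (hm v)
  refine h1.trans ((lieDeriv_apply (𝓘(ℂ, C3).prod 𝓘(ℂ, ℂ)) XC _ (p, ρ) _ _).trans ?_)
  rw [vfieldInChart_line_eq, extChartAt_prod_line_apply]
  exact lieDerivE_pullback_fst hX hh hS u v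

/-- The contour integral of the Lie derivative is the Lie derivative along the contour integral. -/
theorem contourForm_eq_lieDeriv (hr : 0 ≤ r) {p : NC}
    (hX : ∀ᶠ q in 𝓝 p, IsHolomorphicOver XC r q)
    (hh : DifferentiableAt ℂ (bilinInChart 𝓘(ℂ, C3) hC p) (extChartAt 𝓘(ℂ, C3) p p)) (k : ℕ) :
    contourForm hC XC r k p = lieDerivE (vfieldInChart 𝓘(ℂ, C3) (contourField XC r k) p)
      (bilinInChart 𝓘(ℂ, C3) hC p) (extChartAt 𝓘(ℂ, C3) p p) := by
  have hps := mem_extChartAt_source (I := 𝓘(ℂ, C3)) p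
  have hf : ∀ ρ ∈ Metric.sphere (0 : ℂ) r, ContDiffAt ℂ ω (lineField 𝓘(ℂ, C3) XC p)
      (extChartAt 𝓘(ℂ, C3) p p, ρ) := fun ρ hρ =>
    contDiffAt_lineField 𝓘(ℂ, C3) hps (hX.self_of_nhds ρ hρ)
  rw [lieDerivE_congr (vfieldInChart_contourField_eventuallyEq hr hps hX k) .rfl,
    ← circleIntegral_lieDerivE_sliceField hr hf]
  refine circleIntegral.integral_congr hr fun ρ hρ => ?_
  exact congrArg (ρ ^ k • ·) (lieSlice_eq ((hf ρ hρ).differentiableAt (by simp)) hh)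

end ContourField

/-! ### The totally real submanifold in charts -/

section Inclusion

variable {NC : Type*} [TopologicalSpace NC] [ChartedSpace C3 NC]

lemma isManifold_real [IsManifold 𝓘(ℂ, C3) ω NC] : IsManifold 𝓘(ℝ, C3) ω NC := by
  refine isManifold_of_contDiffOn _ _ _ fun e e' he he' => ?_
  have h1 := ((contDiffGroupoid ω 𝓘(ℂ, C3)).compatible he he')
  rw [contDiffGroupoid, mem_groupoid_of_pregroupoid] at h1
  exact h1.1.restrict_scalars ℝ

lemma chartReading_real [IsManifold 𝓘(ℂ, C3) ω NC] {p₀ p : NC}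
    (hp : p ∈ (extChartAt 𝓘(ℂ, C3) p₀).source) (w : C3) :
    chartReading 𝓘(ℝ, C3) p₀ p w = chartReading 𝓘(ℂ, C3) p₀ p w := by
  have : IsManifold 𝓘(ℂ, C3) 1 NC := .of_le le_top
  have h1 : HasMFDerivAt 𝓘(ℂ, C3) 𝓘(ℂ, C3) (extChartAt 𝓘(ℂ, C3) p₀) p
      (chartReading 𝓘(ℂ, C3) p₀ p) :=
    (mdifferentiableAt_extChartAt (by rwa [← extChartAt_source (I := 𝓘(ℂ, C3))])).hasMFDerivAt
  have h2 : HasMFDerivAt 𝓘(ℝ, C3) 𝓘(ℝ, C3) (extChartAt 𝓘(ℝ, C3) p₀) p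
      ((chartReading 𝓘(ℂ, C3) p₀ p : C3 →L[ℂ] C3).restrictScalars ℝ) :=
    ⟨h1.1, h1.2.restrictScalars ℝ⟩
  exact DFunLike.congr_fun h2.mfderiv w

variable {N : Type*} [TopologicalSpace N] [ChartedSpace R3 N] [IsManifold (𝓡 3) ω N]
  [IsManifold 𝓘(ℂ, C3) ω NC] {ι : N → NC} {x₀ x : N}

/-- The expression of `ι : N → NC` in the charts at `x₀` and `ι x₀`. -/
noncomputable def inclusionInCharts (ι : N → NC) (x₀ : N) : R3 → C3 :=
  mapInCharts (𝓡 3) 𝓘(ℝ, C3) ι x₀ (ι x₀)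

lemma inclusionInCharts_apply (ι : N → NC) (hx : x ∈ (extChartAt (𝓡 3) x₀).source) :
    inclusionInCharts ι x₀ (extChartAt (𝓡 3) x₀ x) = extChartAt 𝓘(ℂ, C3) (ι x₀) (ι x) :=
  mapInCharts_apply (𝓡 3) 𝓘(ℝ, C3) hx ι (ι x₀)

lemma contDiffAt_inclusionInCharts (hι : IsComplexification ι) (hx : x ∈ (extChartAt (𝓡 3) x₀).source)
    (hx' : ι x ∈ (extChartAt 𝓘(ℂ, C3) (ι x₀)).source) :
    ContDiffAt ℝ ω (inclusionInCharts ι x₀) (extChartAt (𝓡 3) x₀ x) :=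
  have : IsManifold 𝓘(ℝ, C3) ω NC := isManifold_real
  contDiffAt_mapInCharts (𝓡 3) 𝓘(ℝ, C3) hx hx' hι.analytic.contMDiffAt

lemma fderiv_inclusionInCharts (hι : IsComplexification ι) (hx : x ∈ (extChartAt (𝓡 3) x₀).source)
    (hx' : ι x ∈ (extChartAt 𝓘(ℂ, C3) (ι x₀)).source) (u : R3) :
    fderiv ℝ (inclusionInCharts ι x₀) (extChartAt (𝓡 3) x₀ x) u
      = chartReading 𝓘(ℂ, C3) (ι x₀) (ι x)
        (realDifferential ι x (chartReadingSymm (𝓡 3) x₀ x u)) := by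
  have : IsManifold 𝓘(ℝ, C3) ω NC := isManifold_real
  have : IsManifold 𝓘(ℝ, C3) 1 NC := .of_le le_top
  have h := fderiv_mapInCharts (𝓡 3) 𝓘(ℝ, C3) hx hx'
    (hι.analytic.mdifferentiableAt (by simp)) u
  exact h.trans (chartReading_real hx' _)

lemma fderiv_inclusionInCharts_self (hι : IsComplexification ι) (x : N) (u : R3) :
    fderiv ℝ (inclusionInCharts ι x) (extChartAt (𝓡 3) x x) u = realDifferential ι x u := by
  have h1 := fderiv_inclusionInCharts hι (mem_extChartAt_source (I := 𝓡 3) x)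
    (mem_extChartAt_source (ι x)) u
  have h2 : chartReadingSymm (𝓡 3) x x u = u :=
    (congrArg (chartReadingSymm (𝓡 3) x x) (chartReading_self (𝓡 3) x u)).symm.trans
      (chartReadingSymm_reading (𝓡 3) (mem_extChartAt_source x) u)
  exact h1.trans ((chartReading_self 𝓘(ℂ, C3) (ι x) _).trans (congrArg (realDifferential ι x) h2))

lemma inclusionInCharts_totally_real (hι : IsComplexification ι) (hx : x ∈ (extChartAt (𝓡 3) x₀).source)
    (hx' : ι x ∈ (extChartAt 𝓘(ℂ, C3) (ι x₀)).source) (w : C3) :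
    ∃ u v, w = fderiv ℝ (inclusionInCharts ι x₀) (extChartAt (𝓡 3) x₀ x) u
      + Complex.I • fderiv ℝ (inclusionInCharts ι x₀) (extChartAt (𝓡 3) x₀ x) v := by
  obtain ⟨⟨u, v⟩, huv, -⟩ := hι.totally_real x (chartReadingSymm 𝓘(ℂ, C3) (ι x₀) (ι x) w)
  refine ⟨chartReading (𝓡 3) x₀ x u, chartReading (𝓡 3) x₀ x v, ?_⟩
  rw [fderiv_inclusionInCharts hι hx hx', fderiv_inclusionInCharts hι hx hx',
    chartReadingSymm_reading (𝓡 3) hx, chartReadingSymm_reading (𝓡 3) hx]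
  have h1 := congrArg (chartReading 𝓘(ℂ, C3) (ι x₀) (ι x)) huv
  rw [chartReading_symm 𝓘(ℂ, C3) hx'] at h1
  refine h1.trans ?_
  rw [map_add, map_smul]

/-- A property of points near `x₀`, in the charts at `x₀` and `ι x₀`. -/
lemma eventually_inclusionInCharts (hι : IsComplexification ι) (x₀ : N) {P : R3 → Prop}
    (h : ∀ᶠ x in 𝓝 x₀, x ∈ (extChartAt (𝓡 3) x₀).source →
      ι x ∈ (extChartAt 𝓘(ℂ, C3) (ι x₀)).source → P (extChartAt (𝓡 3) x₀ x)) :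
    ∀ᶠ y in 𝓝 (extChartAt (𝓡 3) x₀ x₀), P y := by
  refine eventually_extChartAt (𝓡 3) (mem_extChartAt_source x₀) ?_
  filter_upwards [h, hι.analytic.continuous.continuousAt.eventually
    (eventually_mem_extChartAt_source 𝓘(ℂ, C3) (mem_extChartAt_source (ι x₀)))] with x h1 h2 h3
  exact h1 h3 h2

lemma bilinInChart_inclusionInCharts (hι : IsComplexification ι) {h : AnalyticMetric N}
    {UC : Set NC} {hC : BilinField 𝓘(ℂ, C3) NC} (hhC : IsMetricComplexification ι h UC hC)
    (hx : x ∈ (extChartAt (𝓡 3) x₀).source)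
    (hx' : ι x ∈ (extChartAt 𝓘(ℂ, C3) (ι x₀)).source) (hxU : ι x ∈ UC) (u v : R3) :
    bilinInChart 𝓘(ℂ, C3) hC (ι x₀) (inclusionInCharts ι x₀ (extChartAt (𝓡 3) x₀ x))
      (fderiv ℝ (inclusionInCharts ι x₀) (extChartAt (𝓡 3) x₀ x) u)
      (fderiv ℝ (inclusionInCharts ι x₀) (extChartAt (𝓡 3) x₀ x) v)
      = (bilinInChart (𝓡 3) h.inner x₀ (extChartAt (𝓡 3) x₀ x) u v : ℂ) := by
  rw [inclusionInCharts_apply ι hx, fderiv_inclusionInCharts hι hx hx',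
    fderiv_inclusionInCharts hι hx hx', bilinInChart_reading 𝓘(ℂ, C3) hx',
    hhC.extends_real x hxU, bilinInChart_symm (𝓡 3) hx]

lemma inclusionDifferential_apply (hι : IsComplexification ι) (p : N × ℝ)
    (u : TangentSpace ((𝓡 3).prod 𝓘(ℝ, ℝ)) p) :
    inclusionDifferential ι p u
      = ((realDifferential ι p.1 (u : R3 × ℝ).1, ((u : R3 × ℝ).2 : ℂ)) : C3 × ℂ) := by
  have h1 : HasMFDerivAt 𝓘(ℝ, ℝ) 𝓘(ℝ, ℂ) (fun t : ℝ => (t : ℂ)) p.2 Complex.ofRealCLM :=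
    Complex.ofRealCLM.hasFDerivAt.hasMFDerivAt
  have h2 := mfderiv_prodMap (p := p) (I := 𝓡 3) (J := 𝓘(ℝ, C3)) (I' := 𝓘(ℝ, ℝ)) (J' := 𝓘(ℝ, ℂ))
    (f := ι) (g := fun t : ℝ => (t : ℂ)) (hι.analytic.mdifferentiableAt (by simp))
    h1.mdifferentiableAt
  have h3 := DFunLike.congr_fun h2 u
  refine h3.trans (Prod.ext rfl ?_)
  exact DFunLike.congr_fun h1.mfderiv (u : R3 × ℝ).2

lemma lineField_inclusionInCharts (hι : IsComplexification ι)
    {X : VField ((𝓡 3).prod 𝓘(ℝ, ℝ)) (N × ℝ)}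
    {W : Set (NC × ℂ)} {XC : VField (𝓘(ℂ, C3).prod 𝓘(ℂ, ℂ)) (NC × ℂ)}
    (hXC : IsVFieldComplexification ι X W XC) (hx : x ∈ (extChartAt (𝓡 3) x₀).source)
    (hx' : ι x ∈ (extChartAt 𝓘(ℂ, C3) (ι x₀)).source) {ρ : ℝ} (hρ : 0 < ρ)
    (hW : (ι x, (ρ : ℂ)) ∈ W) :
    lineField 𝓘(ℂ, C3) XC (ι x₀) (inclusionInCharts ι x₀ (extChartAt (𝓡 3) x₀ x), (ρ : ℂ))
      = (fderiv ℝ (inclusionInCharts ι x₀) (extChartAt (𝓡 3) x₀ x)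
          (lineField (𝓡 3) X x₀ (extChartAt (𝓡 3) x₀ x, ρ)).1,
        ((lineField (𝓡 3) X x₀ (extChartAt (𝓡 3) x₀ x, ρ)).2 : ℂ)) := by
  rw [inclusionInCharts_apply ι hx, lineField_apply 𝓘(ℂ, C3) XC hx', lineField_apply (𝓡 3) X hx,
    fderiv_inclusionInCharts hι hx hx']
  have h2 : chartReadingSymm (𝓡 3) x₀ x (chartReading (𝓡 3) x₀ x (X (x, ρ) : R3 × ℝ).1)
      = (X (x, ρ) : R3 × ℝ).1 := chartReadingSymm_reading (𝓡 3) hx _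
  have h1 := (hXC.extends_real x ρ hρ hW).trans (inclusionDifferential_apply hι (x, ρ) _)
  have h3 := congrArg (fun w : C3 × ℂ => w.2) h1
  exact Prod.ext ((congrArg (fun w : C3 × ℂ => chartReading 𝓘(ℂ, C3) (ι x₀) (ι x) w.1) h1).trans
      (congrArg (fun w : R3 => chartReading 𝓘(ℂ, C3) (ι x₀) (ι x) (realDifferential ι x w)) h2.symm))
    h3

end Inclusion

/-! ### The complexified soliton equation along the circle -/

lemma deriv_of_eq_ofReal {c : ℂ → ℂ} {g : ℝ → ℝ} {g' t : ℝ} (hc : DifferentiableAt ℂ c t)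
    (hg : HasDerivAt g g' t) (h : ∀ᶠ s : ℝ in 𝓝 t, c s = g s) : deriv c t = g' :=
  hc.hasDerivAt.comp_ofReal.unique (hg.ofReal_comp.congr_of_eventuallyEq h)

section TotallyReal

variable {N : Type*} [TopologicalSpace N] [ChartedSpace R3 N] [IsManifold (𝓡 3) ω N]
  {NC : Type*} [TopologicalSpace NC] [ChartedSpace C3 NC] [IsManifold 𝓘(ℂ, C3) ω NC]
  {ι : N → NC} {x : N}

/-- The differential of the inclusion as a linear map between the model spaces. -/
noncomputable def realDifferentialL (ι : N → NC) (x : N) : R3 →L[ℝ] C3 :=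
  mfderiv (𝓡 3) 𝓘(ℝ, C3) ι x

/-- The images of a real basis under the differential of a totally real inclusion form a complex
basis. -/
lemma exists_complex_basis (hι : IsComplexification ι) (x : N) (e : Module.Basis (Fin 3) ℝ R3) :
    ∃ b : Module.Basis (Fin 3) ℂ C3, (∀ i, b i = realDifferentialL ι x (e i)) ∧
      ∀ v k, b.coord k (realDifferentialL ι x v) = (e.coord k v : ℂ) := by
  have hli : LinearIndependent ℂ fun i => realDifferentialL ι x (e i) := by
    rw [Fintype.linearIndependent_iff]
    intro g hg
    have h1 : ∀ s : Fin 3 → ℝ, realDifferentialL ι x (∑ i, s i • e i)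
        = ∑ i, (s i : ℂ) • realDifferentialL ι x (e i) := fun s => by
      simp only [map_sum, map_smul, Complex.coe_smul]
    have h2 : (0 : C3) = realDifferentialL ι x (∑ i, (g i).re • e i)
        + Complex.I • realDifferentialL ι x (∑ i, (g i).im • e i) := by
      rw [h1, h1, ← hg, Finset.smul_sum, ← Finset.sum_add_distrib]
      refine Finset.sum_congr rfl fun i _ => ?_
      rw [smul_smul, ← add_smul]
      congr 1
      rw [mul_comm]
      exact (Complex.re_add_im (g i)).symm
    have h3 : (0 : C3) = realDifferentialL ι x 0 + Complex.I • realDifferentialL ι x 0 := by simp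
    have h4 := (hι.totally_real x (0 : C3)).unique
      (y₁ := (((∑ i, (g i).re • e i : R3), (∑ i, (g i).im • e i : R3)) : R3 × R3))
      (y₂ := ((0, 0) : R3 × R3)) h2 h3
    have h5 := Fintype.linearIndependent_iff.1 e.linearIndependent (fun i => (g i).re)
      (congrArg Prod.fst h4)
    have h6 := Fintype.linearIndependent_iff.1 e.linearIndependent (fun i => (g i).im)
      (congrArg Prod.snd h4)
    exact fun i => Complex.ext (h5 i) (h6 i)
  let b := basisOfLinearIndependentOfCardEqFinrank hli (by simp)
  have hb : ∀ i, b i = realDifferentialL ι x (e i) := fun i => by simp [b]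
  refine ⟨b, hb, fun v k => ?_⟩
  conv_lhs => rw [← e.sum_repr v]
  simp only [map_sum, map_smul, ← hb]
  simp [Finsupp.single_apply]

end TotallyReal

section Circle

variable {N : Type*} [TopologicalSpace N] [ChartedSpace R3 N] [IsManifold (𝓡 3) ω N]
  {NC : Type*} [TopologicalSpace NC] [ChartedSpace C3 NC] [IsManifold 𝓘(ℂ, C3) ω NC]
  {ι : N → NC} {h : AnalyticMetric N}
  {X : VField ((𝓡 3).prod 𝓘(ℝ, ℝ)) (N × ℝ)} {W : Set (NC × ℂ)} {UC : Set NC}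
  {XC : VField (𝓘(ℂ, C3).prod 𝓘(ℂ, ℂ)) (NC × ℂ)} {hC : BilinField 𝓘(ℂ, C3) NC} {x : N}

lemma inclusionInCharts_self (ι : N → NC) (x : N) :
    inclusionInCharts ι x (extChartAt (𝓡 3) x x) = extChartAt 𝓘(ℂ, C3) (ι x) (ι x) :=
  inclusionInCharts_apply ι (mem_extChartAt_source x)

lemma contDiffAt_complexMetric (hUC : IsOpen UC) (hhC : IsMetricComplexification ι h UC hC)
    {p₀ p : NC} (hp : p ∈ (extChartAt 𝓘(ℂ, C3) p₀).source) (hpU : p ∈ UC) :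
    ContDiffAt ℂ ω (bilinInChart 𝓘(ℂ, C3) hC p₀) (extChartAt 𝓘(ℂ, C3) p₀ p) :=
  contDiffAt_bilinInChart 𝓘(ℂ, C3) hp (hhC.holomorphic.contMDiffAt (hUC.mem_nhds hpU))

lemma xField_eq (hι : IsComplexification ι) (hXC : IsVFieldComplexification ι X W XC) {t : ℝ}
    (ht : 0 < t) (hW : (ι x, (t : ℂ)) ∈ W) :
    (XC (ι x, (t : ℂ)) : C3 × ℂ)
      = (realDifferentialL ι x (lineField (𝓡 3) X x (extChartAt (𝓡 3) x x, t)).1,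
        ((lineField (𝓡 3) X x (extChartAt (𝓡 3) x x, t)).2 : ℂ)) := by
  have h1 := lineField_inclusionInCharts hι hXC (mem_extChartAt_source x)
    (mem_extChartAt_source (ι x)) ht hW
  rw [inclusionInCharts_self, lineField_self] at h1
  refine h1.trans (Prod.ext ?_ rfl)
  exact fderiv_inclusionInCharts_self hι x _

/-- On the real points the complexified Lie derivative is the real one. -/
lemma lieSlice_real (hι : IsComplexification ι) (hXC : IsVFieldComplexification ι X W XC)
    (hUC : IsOpen UC) (hhC : IsMetricComplexification ι h UC hC) (hx : ι x ∈ UC) {t : ℝ}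
    (ht : 0 < t) (hW : (ι x, (t : ℂ)) ∈ W)
    (hX : DifferentiableAt ℝ (lineField (𝓡 3) X x) (extChartAt (𝓡 3) x x, t)) (u v : R3) :
    (lieSlice hC XC t (ι x) : C3 →L[ℂ] C3 →L[ℂ] ℂ) (realDifferentialL ι x u)
      (realDifferentialL ι x v) = (lieDerivE (sliceField (lineField (𝓡 3) X x) t)
        (bilinInChart (𝓡 3) h.inner x) (extChartAt (𝓡 3) x x) u v : ℂ) := by
  have hxs := mem_extChartAt_source (I := 𝓡 3) x
  have hps := mem_extChartAt_source (I := 𝓘(ℂ, C3)) (ι x)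
  have hXCd : DifferentiableAt ℂ (lineField 𝓘(ℂ, C3) XC (ι x))
      (extChartAt 𝓘(ℂ, C3) (ι x) (ι x), (t : ℂ)) :=
    (contDiffAt_lineField 𝓘(ℂ, C3) hps (hXC.holomorphic.contMDiffAt
      (hXC.isOpen.mem_nhds hW))).differentiableAt (by simp)
  have hhd := (contDiffAt_complexMetric hUC hhC hps hx).differentiableAt (by simp)
  have hJ := inclusionInCharts_self ι x
  have hιc := hι.analytic.continuous
  have key := lieDerivE_natural (𝕜 := ℝ) (𝕜' := ℂ) (φ := inclusionInCharts ι x)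
    (X := sliceField (lineField (𝓡 3) X x) t) (T := bilinInChart (𝓡 3) h.inner x)
    (X' := sliceField (lineField 𝓘(ℂ, C3) XC (ι x)) t) (T' := bilinInChart 𝓘(ℂ, C3) hC (ι x))
    (y := extChartAt (𝓡 3) x x)
    ((contDiffAt_inclusionInCharts hι hxs hps).of_le le_top)
    (hasFDerivAt_sliceField hX).differentiableAt
    ((contDiffAt_metric h hxs).differentiableAt (by simp))
    (by rw [hJ]; exact (hasFDerivAt_sliceField hXCd).differentiableAt)
    (by rwa [hJ])
    (eventually_inclusionInCharts hι x (by
      have h1 : ∀ᶠ z in 𝓝 x, (ι z, (t : ℂ)) ∈ W :=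
        (show Continuous fun z => (ι z, (t : ℂ)) by fun_prop).continuousAt.eventually
          (hXC.isOpen.mem_nhds hW)
      filter_upwards [h1] with z h1 h2 h3
      exact congrArg Prod.fst (lineField_inclusionInCharts hι hXC h2 h3 ht h1)))
    (eventually_inclusionInCharts hι x (by
      filter_upwards [hιc.continuousAt.eventually (hUC.mem_nhds hx)] with z h1 h2 h3
      exact bilinInChart_inclusionInCharts hι hhC h2 h3 h1)) u v
  have hl := lieSlice_eq (hC := hC) hXCd hhd
  rw [hJ] at key
  refine Eq.trans ?_ key
  refine (congrArg (fun B : C3 →L[ℂ] C3 →L[ℂ] ℂ => B (realDifferentialL ι x u)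
    (realDifferentialL ι x v)) hl).trans ?_
  exact congrArg₂ (fun a b : C3 => lieDerivE (sliceField (lineField 𝓘(ℂ, C3) XC (ι x)) t)
    (bilinInChart 𝓘(ℂ, C3) hC (ι x)) (extChartAt 𝓘(ℂ, C3) (ι x) (ι x)) a b)
    (fderiv_inclusionInCharts_self hι x u).symm (fderiv_inclusionInCharts_self hι x v).symm

end Circle

section CircleData

variable {N : Type*} [TopologicalSpace N] [ChartedSpace R3 N] [IsManifold (𝓡 3) ω N]
  {NC : Type*} [TopologicalSpace NC] [ChartedSpace C3 NC] [IsManifold 𝓘(ℂ, C3) ω NC]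
  {ι : N → NC} {h : AnalyticMetric N} {o : ManifoldOrientation N} {A : OneForm (𝓡 3) N}
  {X : VField ((𝓡 3).prod 𝓘(ℝ, ℝ)) (N × ℝ)} {W : Set (NC × ℂ)} {UC : Set NC}
  {XC : VField (𝓘(ℂ, C3).prod 𝓘(ℂ, ℂ)) (NC × ℂ)} {hC : BilinField 𝓘(ℂ, C3) NC} {x : N}
  {a r : ℝ}

/-- In an orthonormal basis at `x`, the components of the complexified flow and of the complexified
Lie derivative satisfy the soliton equations on the real axis. -/
theorem exists_basis_circle_equations (hA : IsBeltramiField h o A) (hι : IsComplexification ι)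
    (hX : ContMDiffOn ((𝓡 3).prod 𝓘(ℝ, ℝ)) ((𝓡 3).prod 𝓘(ℝ, ℝ)).tangent ω
      (fun p => (⟨p, X p⟩ : TangentBundle ((𝓡 3).prod 𝓘(ℝ, ℝ)) (N × ℝ))) (totalSpace N))
    (hsol : ∀ p ∈ totalSpace N, ∀ u v : TangentSpace ((𝓡 3).prod 𝓘(ℝ, ℝ)) p,
      ricci ((𝓡 3).prod 𝓘(ℝ, ℝ)) (beltramiMetric h A) p u v + a * beltramiMetric h A p u v
        + 1 / 2 * lieDeriv ((𝓡 3).prod 𝓘(ℝ, ℝ)) X (beltramiMetric h A) p u v = 0)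
    (hXC : IsVFieldComplexification ι X W XC) (hUC : IsOpen UC)
    (hhC : IsMetricComplexification ι h UC hC) (hr : 0 < r) (hx : ι x ∈ UC)
    (hW : ∀ ρ ∈ Metric.sphere (0 : ℂ) r, (ι x, ρ) ∈ W) :
    ∃ (e : Module.Basis (Fin 3) ℝ R3) (b : Module.Basis (Fin 3) ℂ C3)
      (R : R3 →L[ℝ] R3 →L[ℝ] ℝ) (L : Fin 3 → Fin 3 → ℂ → ℂ) (c : Fin 3 → ℂ → ℂ) (F : ℂ → ℂ),
      (∀ i j, (hC (ι x) : C3 →L[ℂ] C3 →L[ℂ] ℂ) (b i) (b j) = if i = j then 1 else 0) ∧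
      (∀ u v : R3, R u v = ricci (𝓡 3) h.inner x u v - 2 * h.inner x u v) ∧
      (∀ i j ρ, L i j ρ = (lieSlice hC XC ρ (ι x) : C3 →L[ℂ] C3 →L[ℂ] ℂ) (b i) (b j)) ∧
      (∀ k ρ, c k ρ = b.coord k (XC (ι x, ρ) : C3 × ℂ).1) ∧
      (∀ k, AnalyticOnNhd ℂ (c k) (Metric.sphere 0 r)) ∧
      AnalyticOnNhd ℂ F (Metric.sphere 0 r) ∧
      (∀ i j, AnalyticOnNhd ℂ (L i j) (Metric.sphere 0 r)) ∧
      (∀ᶠ t : ℝ in 𝓝 r, (a : ℂ) + deriv F t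
        + (∑ k, (A x (e k) : ℂ) * deriv (c k) t) / t = 0) ∧
      ∀ i j, ∀ᶠ t : ℝ in 𝓝 r, (R (e i) (e j) : ℂ) + (a * t ^ 2 + t * F t)
        * (if i = j then 1 else 0) + 1 / 2 * t ^ 2 * L i j t
        - 1 / 2 * t * ((A x (e i) : ℂ) * deriv (c j) t + (A x (e j) : ℂ) * deriv (c i) t) = 0 := by
  have hXat : ∀ t : ℝ, 0 < t → ContMDiffAt ((𝓡 3).prod 𝓘(ℝ, ℝ)) ((𝓡 3).prod 𝓘(ℝ, ℝ)).tangent ω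
      (fun p => (⟨p, X p⟩ : TangentBundle ((𝓡 3).prod 𝓘(ℝ, ℝ)) (N × ℝ))) (x, t) := fun t ht =>
    hX.contMDiffAt ((isOpen_univ.prod isOpen_Ioi).mem_nhds ⟨mem_univ _, ht⟩)
  have hsol' := fun (t : ℝ) (ht : 0 < t) =>
    soliton_equations hA ht (hXat t ht) (hsol (x, t) ⟨mem_univ _, ht⟩)
  have hxs := mem_extChartAt_source (I := 𝓡 3) x
  have hps := mem_extChartAt_source (I := 𝓘(ℂ, C3)) (ι x)
  set y := extChartAt (𝓡 3) x x with hy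
  set z := extChartAt 𝓘(ℂ, C3) (ι x) (ι x) with hz
  set V : ℝ → R3 × ℝ := fun t => lineField (𝓡 3) X x (y, t) with hV
  have hVd : ∀ t : ℝ, 0 < t → DifferentiableAt ℝ (lineField (𝓡 3) X x) (y, t) := fun t ht =>
    (contDiffAt_lineField (𝓡 3) hxs (hXat t ht)).differentiableAt (by simp)
  set V' : ℝ → R3 × ℝ := fun t => fderiv ℝ (lineField (𝓡 3) X x) (y, t) (0, 1) with hV'
  have hVV' : ∀ t : ℝ, 0 < t → HasDerivAt V (V' t) t := fun t ht => hasDerivAt_apply_line (hVd t ht)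
  -- an orthonormal basis
  let B : R3 →L[ℝ] R3 →L[ℝ] ℝ := h.inner x
  let α : R3 →L[ℝ] ℝ := A x
  obtain ⟨e, he, -⟩ := exists_orthonormal_basis_orientation
    (ContinuousLinearMap.toBilinForm B) (by simp) (fun u v => h.symm x u v)
    (fun u hu => h.pos x u hu) (Module.Basis.orientation (EuclideanSpace.basisFun (Fin 3) ℝ).toBasis)
  have he' : ∀ i j, B (e i) (e j) = if i = j then 1 else 0 := he
  have hcoord : ∀ v k, B v (e k) = e.coord k v := fun v k => by
    have h1 : B v (e k) = ∑ i, e.repr v i * B (e i) (e k) := by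
      conv_lhs => rw [← e.sum_repr v]
      simp only [map_sum, map_smul, sum_apply, smul_apply, smul_eq_mul]
    rw [h1]
    simp [he']
  have hcoord' : ∀ v k, B (e k) v = e.coord k v := fun v k => by
    rw [← hcoord]; exact h.symm x _ _
  obtain ⟨b, hb, hbc⟩ := exists_complex_basis hι x e
  -- the bilinear form `Ric - 2 h`
  let R : R3 →L[ℝ] R3 →L[ℝ] ℝ := -((a * r ^ 2 + r * (V r).2) • B
    + (1 / 2 * r ^ 2) • lieDerivE (sliceField (lineField (𝓡 3) X x) r)
      (bilinInChart (𝓡 3) h.inner x) y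
    - (1 / 2 * r) • (α.smulRight (B (V' r).1)
      + (B.flip (V' r).1).smulRight α))
  have hR : ∀ u v : R3, R u v = ricci (𝓡 3) h.inner x u v - 2 * h.inner x u v := by
    intro u v
    have h1 := (hsol' r hr).2 u v
    have h2 : R u v = -((a * r ^ 2 + r * (V r).2) * B u v
      + (1 / 2 * r ^ 2) * lieDerivE (sliceField (lineField (𝓡 3) X x) r)
      (bilinInChart (𝓡 3) h.inner x) y u v
      - (1 / 2 * r) * (α u * B (V' r).1 v
      + B u (V' r).1 * α v)) := rfl
    rw [h2]
    linear_combination -h1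
  -- analyticity
  have hXCc : ∀ ρ, (ι x, ρ) ∈ W → ContDiffAt ℂ ω (lineField 𝓘(ℂ, C3) XC (ι x)) (z, ρ) :=
    fun ρ hρ => contDiffAt_lineField 𝓘(ℂ, C3) hps (hXC.holomorphic.contMDiffAt
      (hXC.isOpen.mem_nhds hρ))
  have hXCa : ∀ ρ, (ι x, ρ) ∈ W → AnalyticAt ℂ (fun t => (XC (ι x, t) : C3 × ℂ)) ρ := fun ρ hρ => by
    have := analyticAt_slice (hXCc ρ hρ)
    simp only [hz, lineField_self] at this
    exact this
  have hhd := (contDiffAt_complexMetric hUC hhC hps hx).differentiableAt (by simp)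
  let bc : Fin 3 → C3 →L[ℂ] ℂ := fun k => LinearMap.toContinuousLinearMap (b.coord k)
  let c : Fin 3 → ℂ → ℂ := fun k ρ => b.coord k (XC (ι x, ρ) : C3 × ℂ).1
  let F : ℂ → ℂ := fun ρ => (XC (ι x, ρ) : C3 × ℂ).2
  let L : Fin 3 → Fin 3 → ℂ → ℂ := fun i j ρ =>
    (lieSlice hC XC ρ (ι x) : C3 →L[ℂ] C3 →L[ℂ] ℂ) (b i) (b j)
  have hc : ∀ ρ, (ι x, ρ) ∈ W → ∀ k, AnalyticAt ℂ (c k) ρ := fun ρ hρ k =>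
    ((bc k).analyticAt _).comp (f := fun t => (XC (ι x, t) : C3 × ℂ).1)
      (((ContinuousLinearMap.fst ℂ C3 ℂ).analyticAt _).comp (hXCa ρ hρ))
  have hF : ∀ ρ, (ι x, ρ) ∈ W → AnalyticAt ℂ F ρ := fun ρ hρ =>
    ((ContinuousLinearMap.snd ℂ C3 ℂ).analyticAt _).comp (hXCa ρ hρ)
  have hWo : ∀ ρ, (ι x, ρ) ∈ W → ∀ᶠ t in 𝓝 ρ, (ι x, t) ∈ W := fun ρ hρ =>
    (show Continuous fun t : ℂ => (ι x, t) by fun_prop).continuousAt.eventually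
      (hXC.isOpen.mem_nhds hρ)
  have hL : ∀ ρ, (ι x, ρ) ∈ W → ∀ i j, AnalyticAt ℂ (L i j) ρ := fun ρ hρ i j => by
    have h1 := analyticAt_lieDerivE_sliceField (hXCc ρ hρ) (bilinInChart 𝓘(ℂ, C3) hC (ι x))
    have h2 := ((ContinuousLinearMap.apply ℂ ℂ (b j)).analyticAt _).comp
      (((ContinuousLinearMap.apply ℂ (C3 →L[ℂ] ℂ) (b i)).analyticAt _).comp h1)
    refine h2.congr ?_
    filter_upwards [hWo ρ hρ] with t ht
    exact (congrArg (fun T : C3 →L[ℂ] C3 →L[ℂ] ℂ => T (b i) (b j))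
      (lieSlice_eq ((hXCc t ht).differentiableAt (by simp)) hhd)).symm
  -- the real points
  have hrW : (ι x, (r : ℂ)) ∈ W := hW r (by simp [abs_of_pos hr])
  have hreal : ∀ᶠ t : ℝ in 𝓝 r, 0 < t ∧ (ι x, (t : ℂ)) ∈ W :=
    (lt_mem_nhds hr).and (Complex.continuous_ofReal.continuousAt.eventually (hWo r hrW))
  have hcr : ∀ t : ℝ, 0 < t ∧ (ι x, (t : ℂ)) ∈ W → ∀ k, c k t = e.coord k (V t).1 := by
    rintro t ⟨ht, htW⟩ k
    rw [← hbc]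
    exact congrArg (fun w : C3 × ℂ => b.coord k w.1) (xField_eq hι hXC ht htW)
  have hFr : ∀ t : ℝ, 0 < t ∧ (ι x, (t : ℂ)) ∈ W → F t = (V t).2 := by
    rintro t ⟨ht, htW⟩
    exact congrArg (fun w : C3 × ℂ => w.2) (xField_eq hι hXC ht htW)
  have hLr : ∀ t : ℝ, 0 < t ∧ (ι x, (t : ℂ)) ∈ W → ∀ i j, L i j t
      = (lieDerivE (sliceField (lineField (𝓡 3) X x) t) (bilinInChart (𝓡 3) h.inner x) y
        (e i) (e j) : ℂ) := by
    rintro t ⟨ht, htW⟩ i j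
    rw [← lieSlice_real hι hXC hUC hhC hx ht htW (hVd t ht), ← hb, ← hb]
  have hcd : ∀ᶠ t : ℝ in 𝓝 r, ∀ k, deriv (c k) t = (e.coord k (V' t).1 : ℂ) := by
    filter_upwards [hreal.eventually_nhds] with t ht k
    let ec : R3 →L[ℝ] ℝ := LinearMap.toContinuousLinearMap (e.coord k)
    exact deriv_of_eq_ofReal (hc t ht.self_of_nhds.2 k).differentiableAt
      (ec.hasFDerivAt.comp_hasDerivAt t (hVV' t ht.self_of_nhds.1).fst)
      (ht.mono fun s hs => hcr s hs k)
  have hFd : ∀ᶠ t : ℝ in 𝓝 r, deriv F t = ((V' t).2 : ℂ) := by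
    filter_upwards [hreal.eventually_nhds] with t ht
    exact deriv_of_eq_ofReal (hF t ht.self_of_nhds.2).differentiableAt
      (hVV' t ht.self_of_nhds.1).snd (ht.mono fun s hs => hFr s hs)
  refine ⟨e, b, R, L, c, F, fun i j => ?_, hR, fun _ _ _ => rfl, fun _ _ => rfl,
    fun k ρ hρ => hc ρ (hW ρ hρ) k, fun ρ hρ => hF ρ (hW ρ hρ),
    fun i j ρ hρ => hL ρ (hW ρ hρ) i j, ?_, fun i j => ?_⟩
  · rw [hb, hb]
    refine (hhC.extends_real x hx (e i) (e j)).trans ?_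
    rw [show h.inner x (e i) (e j) = _ from he' i j]
    split_ifs <;> simp
  · filter_upwards [hreal, hcd, hFd] with t ht h1 h2
    have h3 := (hsol' t ht.1).1
    have h4 : α (V' t).1 = ∑ k, α (e k) * e.coord k (V' t).1 := by
      conv_lhs => rw [← e.sum_repr (V' t).1]
      simp only [map_sum, map_smul, smul_eq_mul]
      exact Finset.sum_congr rfl fun k _ => mul_comm _ _
    have h5 : a + (V' t).2 + (∑ k, α (e k) * e.coord k (V' t).1) / t = 0 := by
      rw [← h4]; exact h3
    simp only [h1, h2]
    exact_mod_cast congrArg (fun s : ℝ => (s : ℂ)) h5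
  · filter_upwards [hreal, hcd] with t ht h1
    have h3 := (hsol' t ht.1).2 (e i) (e j)
    have h4 : R (e i) (e j) + (a * t ^ 2 + t * (V t).2) * B (e i) (e j)
      + 1 / 2 * t ^ 2 * lieDerivE (sliceField (lineField (𝓡 3) X x) t)
        (bilinInChart (𝓡 3) h.inner x) y (e i) (e j)
      - 1 / 2 * t * (α (e i) * B (V' t).1 (e j) + α (e j) * B (e i) (V' t).1) = 0 := by
      rw [hR]; exact h3
    rw [he', hcoord, hcoord'] at h4
    have h5 := congrArg (fun s : ℝ => (s : ℂ)) h4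
    rw [h1, h1, hFr t ht, hLr t ht]
    push_cast at h5
    have h6 : ((if i = j then (1 : ℝ) else 0 : ℝ) : ℂ) = if i = j then (1 : ℂ) else 0 := by
      split_ifs <;> simp
    rw [h6] at h5
    exact h5

end CircleData

/-! ### Moments of the complexified Lie derivative on the real points -/

section Moments

variable {N : Type*} [TopologicalSpace N] [ChartedSpace R3 N] [IsManifold (𝓡 3) ω N]
  {NC : Type*} [TopologicalSpace NC] [ChartedSpace C3 NC] [IsManifold 𝓘(ℂ, C3) ω NC]
  {ι : N → NC} {h : AnalyticMetric N} {o : ManifoldOrientation N} {A : OneForm (𝓡 3) N}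
  {X : VField ((𝓡 3).prod 𝓘(ℝ, ℝ)) (N × ℝ)} {W : Set (NC × ℂ)} {U : Set N} {UC : Set NC}
  {XC : VField (𝓘(ℂ, C3).prod 𝓘(ℂ, ℂ)) (NC × ℂ)} {hC : BilinField 𝓘(ℂ, C3) NC} {x : N}
  {a r : ℝ}

lemma isHolomorphicOver (hXC : IsVFieldComplexification ι X W XC)
    (hW : UC ×ˢ Metric.sphere (0 : ℂ) r ⊆ W) {p : NC} (hp : p ∈ UC) : IsHolomorphicOver XC r p :=
  fun _ hρ => hXC.holomorphic.contMDiffAt (hXC.isOpen.mem_nhds (hW ⟨hp, hρ⟩))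

lemma contourForm_apply (hr : 0 ≤ r) {p : NC} (hX : IsHolomorphicOver XC r p)
    (hh : DifferentiableAt ℂ (bilinInChart 𝓘(ℂ, C3) hC p) (extChartAt 𝓘(ℂ, C3) p p)) (k : ℕ)
    (u v : C3) :
    contourForm hC XC r k p u v
      = ∮ ρ in C(0, r), ρ ^ k * (lieSlice hC XC ρ p : C3 →L[ℂ] C3 →L[ℂ] ℂ) u v := by
  have hf : ∀ ρ ∈ Metric.sphere (0 : ℂ) r, ContDiffAt ℂ ω (lineField 𝓘(ℂ, C3) XC p)
      (extChartAt 𝓘(ℂ, C3) p p, ρ) := fun ρ hρ =>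
    contDiffAt_lineField 𝓘(ℂ, C3) (mem_extChartAt_source p) (hX ρ hρ)
  let l : ℂ → C3 →L[ℂ] C3 →L[ℂ] ℂ := fun ρ => lieSlice hC XC ρ p
  have hi : CircleIntegrable (fun ρ => ρ ^ k • l ρ) 0 r := by
    refine ContinuousOn.circleIntegrable hr (ContinuousOn.smul (continuousOn_pow k) ?_)
    refine ContinuousOn.congr (f := fun ρ => lieDerivE (sliceField (lineField 𝓘(ℂ, C3) XC p) ρ)
      (bilinInChart 𝓘(ℂ, C3) hC p) (extChartAt 𝓘(ℂ, C3) p p)) (fun ρ hρ =>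
      (analyticAt_lieDerivE_sliceField (hf ρ hρ) _).continuousAt.continuousWithinAt) fun ρ hρ => ?_
    exact lieSlice_eq ((hf ρ hρ).differentiableAt (by simp)) hh
  have h1 := clm_circleIntegral_comm ((ContinuousLinearMap.apply ℂ ℂ v).comp
    (ContinuousLinearMap.apply ℂ (C3 →L[ℂ] ℂ) u)) hi
  refine h1.symm.trans ?_
  simp only [map_smul, smul_eq_mul]
  rfl

/-- The first moment of the complexified Lie derivative vanishes at a real point exactly when
`Ric = 2 h` there. -/
theorem contourForm_one_eq_zero_iff (hA : IsBeltramiField h o A) (hι : IsComplexification ι)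
    (hX : ContMDiffOn ((𝓡 3).prod 𝓘(ℝ, ℝ)) ((𝓡 3).prod 𝓘(ℝ, ℝ)).tangent ω
      (fun p => (⟨p, X p⟩ : TangentBundle ((𝓡 3).prod 𝓘(ℝ, ℝ)) (N × ℝ))) (totalSpace N))
    (hsol : ∀ p ∈ totalSpace N, ∀ u v : TangentSpace ((𝓡 3).prod 𝓘(ℝ, ℝ)) p,
      ricci ((𝓡 3).prod 𝓘(ℝ, ℝ)) (beltramiMetric h A) p u v + a * beltramiMetric h A p u v
        + 1 / 2 * lieDeriv ((𝓡 3).prod 𝓘(ℝ, ℝ)) X (beltramiMetric h A) p u v = 0)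
    (hXC : IsVFieldComplexification ι X W XC) (hUC : IsOpen UC)
    (hhC : IsMetricComplexification ι h UC hC) (hr : 0 < r)
    (hW : UC ×ˢ Metric.sphere (0 : ℂ) r ⊆ W) (hx : ι x ∈ UC) :
    contourForm hC XC r 1 (ι x) = 0 ↔
      ∀ u v : TangentSpace (𝓡 3) x, ricci (𝓡 3) h.inner x u v = 2 * h.inner x u v := by
  obtain ⟨e, b, R, L, c, F, -, hR, hL, -, hca, hFa, hLa, h1, h3⟩ :=
    exists_basis_circle_equations hA hι hX hsol hXC hUC hhC hr hx fun ρ hρ => hW ⟨hx, hρ⟩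
  have hm : ∀ i j, contourForm hC XC r 1 (ι x) (b i) (b j)
      = -(4 * Real.pi * Complex.I) * R (e i) (e j) := fun i j => by
    rw [contourForm_apply hr.le (isHolomorphicOver hXC hW hx) ((contDiffAt_complexMetric hUC hhC
      (mem_extChartAt_source _) hx).differentiableAt (by simp))]
    simp only [← hL]
    exact circle_first_moment (α := fun k => A x (e k)) (R := fun i j => R (e i) (e j))
      hr hca hFa hLa h1 h3 i j
  have hR0 : (∀ u v : TangentSpace (𝓡 3) x, ricci (𝓡 3) h.inner x u v = 2 * h.inner x u v)
      ↔ ∀ i j, R (e i) (e j) = 0 := by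
    refine ⟨fun hu i j => (hR _ _).trans (sub_eq_zero.2 (hu _ _)), fun hij u v => ?_⟩
    have h0 : R.toBilinForm = 0 := e.ext fun i => e.ext fun j => hij i j
    exact sub_eq_zero.1 ((hR u v).symm.trans (LinearMap.congr_fun (LinearMap.congr_fun h0 u) v))
  have hC0 : contourForm hC XC r 1 (ι x) = 0 ↔
      ∀ i j, contourForm hC XC r 1 (ι x) (b i) (b j) = 0 := by
    refine ⟨fun h i j => by rw [h]; rfl, fun hij => ?_⟩
    have h0 : (contourForm hC XC r 1 (ι x)).toBilinForm = 0 := b.ext fun i => b.ext fun j => hij i j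
    exact ContinuousLinearMap.ext fun u => ContinuousLinearMap.ext fun v =>
      LinearMap.congr_fun (LinearMap.congr_fun h0 u) v
  rw [hR0, hC0]
  refine forall_congr' fun i => forall_congr' fun j => ?_
  rw [hm]
  simp [Real.pi_ne_zero, Complex.I_ne_zero]

/-- If the moment of order `n + 2` of the complexified Lie derivative is pure trace at a real point,
then the moment of order `n` of the flow along `NC` vanishes there. -/
theorem contourField_eq_zero (hA : IsBeltramiField h o A) (hA0 : ∀ x, A x ≠ 0)
    (hι : IsComplexification ι)
    (hX : ContMDiffOn ((𝓡 3).prod 𝓘(ℝ, ℝ)) ((𝓡 3).prod 𝓘(ℝ, ℝ)).tangent ω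
      (fun p => (⟨p, X p⟩ : TangentBundle ((𝓡 3).prod 𝓘(ℝ, ℝ)) (N × ℝ))) (totalSpace N))
    (hsol : ∀ p ∈ totalSpace N, ∀ u v : TangentSpace ((𝓡 3).prod 𝓘(ℝ, ℝ)) p,
      ricci ((𝓡 3).prod 𝓘(ℝ, ℝ)) (beltramiMetric h A) p u v + a * beltramiMetric h A p u v
        + 1 / 2 * lieDeriv ((𝓡 3).prod 𝓘(ℝ, ℝ)) X (beltramiMetric h A) p u v = 0)
    (hXC : IsVFieldComplexification ι X W XC) (hUC : IsOpen UC)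
    (hhC : IsMetricComplexification ι h UC hC) (hr : 0 < r)
    (hW : UC ×ˢ Metric.sphere (0 : ℂ) r ⊆ W) (hx : ι x ∈ UC) {n : ℕ}
    (hn : traceFreePart (hC (ι x)) (contourForm hC XC r (n + 2) (ι x)) = 0) :
    contourField XC r n (ι x) = 0 := by
  obtain ⟨e, b, R, L, c, F, hb, -, hL, hc, hca, hFa, hLa, -, h3⟩ :=
    exists_basis_circle_equations hA hι hX hsol hXC hUC hhC hr hx fun ρ hρ => hW ⟨hx, hρ⟩
  have hhol := isHolomorphicOver hXC hW hx
  have hα : (fun k => A x (e k)) ≠ 0 := fun h0 => hA0 x <| by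
    let α : R3 →L[ℝ] ℝ := A x
    have h1 : α.toLinearMap = 0 := e.ext fun k => congrFun h0 k
    exact ContinuousLinearMap.ext fun u => LinearMap.congr_fun h1 u
  obtain ⟨μ, hμ⟩ : ∃ μ : ℂ, ∀ u v : C3, contourForm hC XC r (n + 2) (ι x) u v
      = μ * (hC (ι x) : C3 →L[ℂ] C3 →L[ℂ] ℂ) u v :=
    ⟨_, fun u v => congrArg (fun B : C3 →L[ℂ] C3 →L[ℂ] ℂ => B u v) (sub_eq_zero.1 hn)⟩
  have hm : ∀ i j, (∮ z in C(0, r), z ^ (n + 2) * L i j z) = if i = j then μ else 0 := by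
    intro i j
    simp only [hL]
    rw [← contourForm_apply hr.le hhol ((contDiffAt_complexMetric hUC hhC
      (mem_extChartAt_source _) hx).differentiableAt (by simp)), hμ, hb, mul_ite, mul_one, mul_zero]
  have hz := circle_moment_eq_zero (α := fun k => A x (e k)) (R := fun i j => R (e i) (e j))
    hr hα hca hFa hLa h3 n hm
  have hi : CircleIntegrable (fun ρ => ρ ^ n • (XC (ι x, ρ) : C3 × ℂ).1) 0 r :=
    circleIntegrable_contourField hr.le hhol n
  refine b.ext_elem fun k => ?_
  have h1 := clm_circleIntegral_comm (LinearMap.toContinuousLinearMap (b.coord k)) hi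
  have h2 : (∮ ρ in C(0, r), LinearMap.toContinuousLinearMap (b.coord k)
      (ρ ^ n • (XC (ι x, ρ) : C3 × ℂ).1)) = ∮ ρ in C(0, r), ρ ^ n * c k ρ := by
    congr 1
    funext ρ
    rw [hc]
    simp
  rw [h2, hz] at h1
  exact h1.symm.trans (map_zero (b.coord k)).symm

/-- If the moment of the flow vanishes on the real points, then so does the corresponding moment of
the complexified Lie derivative. -/
theorem contourForm_eq_zero_of_contourField (hι : IsComplexification ι)
    (hXC : IsVFieldComplexification ι X W XC) (hUC : IsOpen UC)
    (hhC : IsMetricComplexification ι h UC hC) (hr : 0 ≤ r)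
    (hW : UC ×ˢ Metric.sphere (0 : ℂ) r ⊆ W) (hx : ι x ∈ UC) {n : ℕ}
    (hn : ∀ᶠ z in 𝓝 x, contourField XC r n (ι z) = 0) :
    contourForm hC XC r n (ι x) = 0 := by
  have hps := mem_extChartAt_source (I := 𝓘(ℂ, C3)) (ι x)
  have hxs := mem_extChartAt_source (I := 𝓡 3) x
  have hhol : ∀ᶠ q in 𝓝 (ι x), IsHolomorphicOver XC r q :=
    (hUC.eventually_mem hx).mono fun q hq => isHolomorphicOver hXC hW hq
  have hJ := inclusionInCharts_self ι x
  have hY := contDiffAt_contourField hr hps hhol n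
  have h0 : ∀ᶠ y in 𝓝 (extChartAt (𝓡 3) x x),
      vfieldInChart 𝓘(ℂ, C3) (contourField XC r n) (ι x) (inclusionInCharts ι x y) = 0 := by
    refine eventually_inclusionInCharts hι x ?_
    filter_upwards [hn] with z hz hzs hzs'
    rw [inclusionInCharts_apply ι hzs, vfieldInChart_reading 𝓘(ℂ, C3) hzs', hz]
    exact map_zero (chartReading 𝓘(ℂ, C3) (ι x) (ι z) : C3 →L[ℂ] C3)
  have h1 := fderiv_eq_zero_of_totally_real
    ((contDiffAt_inclusionInCharts hι hxs hps).differentiableAt (by simp))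
    (inclusionInCharts_totally_real hι hxs hps)
    (T := vfieldInChart 𝓘(ℂ, C3) (contourField XC r n) (ι x))
    (by rw [hJ]; exact hY.differentiableAt (by simp)) h0
  have h2 := h0.self_of_nhds
  rw [hJ] at h1 h2
  rw [contourForm_eq_lieDeriv hr hhol ((contDiffAt_complexMetric hUC hhC
    hps hx).differentiableAt (by simp)), lieDerivE_eq, h1, h2, map_zero, map_zero, add_zero]

lemma traceFreePart_eq_zero (B : C3 →L[ℂ] C3 →L[ℂ] ℂ) {T : C3 →L[ℂ] C3 →L[ℂ] ℂ} (hT : T = 0) :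
    traceFreePart B T = 0 := by
  simp [traceFreePart, traceWrt, hT]

/-- If the moment of order `n + 2` is pure trace on the real points, then the moment of order `n`
vanishes there. -/
theorem contourForm_eq_zero_of_traceFreePart (hA : IsBeltramiField h o A)
    (hA0 : ∀ x, A x ≠ 0) (hι : IsComplexification ι)
    (hX : ContMDiffOn ((𝓡 3).prod 𝓘(ℝ, ℝ)) ((𝓡 3).prod 𝓘(ℝ, ℝ)).tangent ω
      (fun p => (⟨p, X p⟩ : TangentBundle ((𝓡 3).prod 𝓘(ℝ, ℝ)) (N × ℝ))) (totalSpace N))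
    (hsol : ∀ p ∈ totalSpace N, ∀ u v : TangentSpace ((𝓡 3).prod 𝓘(ℝ, ℝ)) p,
      ricci ((𝓡 3).prod 𝓘(ℝ, ℝ)) (beltramiMetric h A) p u v + a * beltramiMetric h A p u v
        + 1 / 2 * lieDeriv ((𝓡 3).prod 𝓘(ℝ, ℝ)) X (beltramiMetric h A) p u v = 0)
    (hXC : IsVFieldComplexification ι X W XC) (hU : IsOpen U) (hUC : IsOpen UC)
    (hUUC : ∀ x ∈ U, ι x ∈ UC)
    (hhC : IsMetricComplexification ι h UC hC) (hr : 0 < r)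
    (hW : UC ×ˢ Metric.sphere (0 : ℂ) r ⊆ W) {n : ℕ}
    (hn : ∀ x ∈ U, traceFreePart (hC (ι x)) (contourForm hC XC r (n + 2) (ι x)) = 0) :
    ∀ x ∈ U, contourForm hC XC r n (ι x) = 0 := fun x hx =>
  contourForm_eq_zero_of_contourField hι hXC hUC hhC hr.le hW (hUUC x hx)
    ((hU.eventually_mem hx).mono fun z hz => contourField_eq_zero hA hA0 hι hX hsol hXC hUC
      hhC hr hW (hUUC z hz) (hn z hz))

/-- Descent on the order of the moments. -/
theorem contourForm_one_eq_zero_of_traceFreePart (hA : IsBeltramiField h o A)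
    (hA0 : ∀ x, A x ≠ 0) (hι : IsComplexification ι)
    (hX : ContMDiffOn ((𝓡 3).prod 𝓘(ℝ, ℝ)) ((𝓡 3).prod 𝓘(ℝ, ℝ)).tangent ω
      (fun p => (⟨p, X p⟩ : TangentBundle ((𝓡 3).prod 𝓘(ℝ, ℝ)) (N × ℝ))) (totalSpace N))
    (hsol : ∀ p ∈ totalSpace N, ∀ u v : TangentSpace ((𝓡 3).prod 𝓘(ℝ, ℝ)) p,
      ricci ((𝓡 3).prod 𝓘(ℝ, ℝ)) (beltramiMetric h A) p u v + a * beltramiMetric h A p u v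
        + 1 / 2 * lieDeriv ((𝓡 3).prod 𝓘(ℝ, ℝ)) X (beltramiMetric h A) p u v = 0)
    (hXC : IsVFieldComplexification ι X W XC) (hU : IsOpen U) (hUC : IsOpen UC)
    (hUUC : ∀ x ∈ U, ι x ∈ UC)
    (hhC : IsMetricComplexification ι h UC hC) (hr : 0 < r)
    (hW : UC ×ˢ Metric.sphere (0 : ℂ) r ⊆ W) (j n : ℕ) (hjn : n = 2 * (j + 1) + 1)
    (hn : ∀ x ∈ U, traceFreePart (hC (ι x)) (contourForm hC XC r n (ι x)) = 0) :
    ∀ x ∈ U, contourForm hC XC r 1 (ι x) = 0 := by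
  obtain ⟨m, rfl⟩ : ∃ m, n = m + 2 := ⟨2 * j + 1, by omega⟩
  have h0 := contourForm_eq_zero_of_traceFreePart hA hA0 hι hX hsol hXC hU hUC hUUC hhC hr hW hn
  induction j generalizing m with
  | zero =>
    obtain rfl : m = 1 := by omega
    exact h0
  | succ j ih =>
    obtain ⟨l, rfl⟩ : ∃ l, m = l + 2 := ⟨2 * j + 1, by omega⟩
    have h1 : ∀ x ∈ U, traceFreePart (hC (ι x)) (contourForm hC XC r (l + 2) (ι x)) = 0 :=
      fun x hx => traceFreePart_eq_zero _ (h0 x hx)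
    exact ih l (by omega) h1
      (contourForm_eq_zero_of_traceFreePart hA hA0 hι hX hsol hXC hU hUC hUUC hhC hr hW h1)

end Moments

/-! ### Analytic continuation -/

section Ricci

lemma contDiffAt_ricciE {E : Type*} [NormedAddCommGroup E] [NormedSpace ℝ E]
    [FiniteDimensional ℝ E] {G : E → E →L[ℝ] E →L[ℝ] ℝ} {y : E} (hG : ContDiffAt ℝ ω G y)
    (hi : (G y).IsInvertible) (v w : E) : ContDiffAt ℝ ω (fun z => ricciE G z v w) y := by
  have : CompleteSpace E := FiniteDimensional.complete ℝ E
  have hΓ : ContDiffAt ℝ ω (christoffelL G) y := contDiffAt_christoffelL hG hi (by simp)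
  have hΓ' : ContDiffAt ℝ ω (fderiv ℝ (christoffelL G)) y := hΓ.fderiv_right (by simp)
  have hc : ∀ v : E, ContDiffAt ℝ ω (fun _ : E => v) y := fun v => contDiffAt_const
  have h1 : ∀ i, ContDiffAt ℝ ω (fun z => (LinearMap.toContinuousLinearMap
      ((Module.finBasis ℝ E).coord i)) (fderiv ℝ (christoffelL G) z (Module.finBasis ℝ E i) v w
        - fderiv ℝ (christoffelL G) z v (Module.finBasis ℝ E i) w
        + christoffelL G z (Module.finBasis ℝ E i) (christoffelL G z v w)
        - christoffelL G z v (christoffelL G z (Module.finBasis ℝ E i) w))) y := fun i =>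
    contDiffAt_const.clm_apply ((((((hΓ'.clm_apply (hc _)).clm_apply (hc _)).clm_apply (hc _)).sub
      (((hΓ'.clm_apply (hc _)).clm_apply (hc _)).clm_apply (hc _))).add
      ((hΓ.clm_apply (hc _)).clm_apply ((hΓ.clm_apply (hc _)).clm_apply (hc _)))).sub
      ((hΓ.clm_apply (hc _)).clm_apply ((hΓ.clm_apply (hc _)).clm_apply (hc _))))
  refine (ContDiffAt.sum (s := Finset.univ) fun i _ => h1 i).congr_of_eventuallyEq ?_
  filter_upwards [hΓ.eventually (by simp)] with z hz
  simp only [ricciE, curvatureE_eq (hz.differentiableAt (by simp))]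
  rfl

variable {N : Type*} [TopologicalSpace N] [ChartedSpace R3 N] [IsManifold (𝓡 3) ω N]

/-- An analytic metric with `Ric = c h` near a point of a connected manifold has `Ric = c h`
everywhere. -/
theorem ricci_eq_of_eventually [PreconnectedSpace N] (h : AnalyticMetric N) (c : ℝ) {x₁ : N}
    (h₁ : ∀ᶠ x in 𝓝 x₁, ∀ u v : TangentSpace (𝓡 3) x,
      ricci (𝓡 3) h.inner x u v = c * h.inner x u v) (x : N) :
    ∀ u v : TangentSpace (𝓡 3) x, ricci (𝓡 3) h.inner x u v = c * h.inner x u v := by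
  refine forall_of_preconnected (M := N) isPreconnected_univ
    (P := fun x => ∀ u v : TangentSpace (𝓡 3) x, ricci (𝓡 3) h.inner x u v = c * h.inner x u v)
    (fun x₀ _ => ?_) ⟨x₁, mem_univ _, h₁⟩ x (mem_univ x)
  have hn : ∀ x (u : TangentSpace (𝓡 3) x), (∀ v, h.inner x u v = 0) → u = 0 := fun x u hu => by
    by_contra hne
    exact (h.pos x u hne).ne' (hu u)
  set H := bilinInChart (𝓡 3) h.inner x₀ with hH
  obtain ⟨ε, hε, hB⟩ := Metric.isOpen_iff.1 (isOpen_extChartAt_target (I := 𝓡 3) x₀)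
    (extChartAt (𝓡 3) x₀ x₀) (mem_extChartAt_target x₀)
  set B := Metric.ball (extChartAt (𝓡 3) x₀ x₀) ε
  -- the equation in the chart
  have key : ∀ q ∈ (extChartAt (𝓡 3) x₀).source,
      (∀ u v : TangentSpace (𝓡 3) q, ricci (𝓡 3) h.inner q u v = c * h.inner q u v) ↔
        ∀ u v, ricciE H (extChartAt (𝓡 3) x₀ q) u v - c * H (extChartAt (𝓡 3) x₀ q) u v = 0 := by
    intro q hq
    have hr := ricci_eq_chart (𝓡 3) hq ((contDiffAt_metric h hq).of_le le_top)
      (.of_forall fun z u v => h.symm z u v) (hn q)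
    have hb := bilinInChart_reading (𝓡 3) hq h.inner
    constructor
    · intro hu u v
      have := hu (chartReadingSymm (𝓡 3) x₀ q u) (chartReadingSymm (𝓡 3) x₀ q v)
      rw [hr, ← hb, chartReading_symm (𝓡 3) hq, chartReading_symm (𝓡 3) hq] at this
      exact sub_eq_zero.2 this
    · intro hu u v
      rw [hr, ← hb]
      exact sub_eq_zero.1 (hu _ _)
  have han : ∀ u v, AnalyticOnNhd ℝ (fun y => ricciE H y u v - c * H y u v) B := by
    intro u v y hy
    have hys := (extChartAt (𝓡 3) x₀).map_target (hB hy)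
    have h2 := contDiffAt_metric h hys
    have h3 := isInvertible_bilinInChart (𝓡 3) hys (hn _)
    rw [(extChartAt (𝓡 3) x₀).right_inv (hB hy)] at h2 h3
    exact ((contDiffAt_ricciE h2 h3 u v).sub (contDiffAt_const.mul
      ((h2.clm_apply contDiffAt_const).clm_apply contDiffAt_const))).analyticAt
  refine ⟨(extChartAt (𝓡 3) x₀).source ∩ extChartAt (𝓡 3) x₀ ⁻¹' B,
    inter_mem (extChartAt_source_mem_nhds x₀)
      ((continuousAt_extChartAt x₀).preimage_mem_nhds (Metric.ball_mem_nhds _ hε)), ?_⟩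
  rintro ⟨q, ⟨hq, hqB⟩, hev⟩ z ⟨hz, hzB⟩
  rw [key z hz]
  intro u v
  refine (han u v).eqOn_zero_of_preconnected_of_eventuallyEq_zero
    (convex_ball _ _).isPreconnected hqB ?_ hzB
  exact eventually_extChartAt (𝓡 3) hq (P := fun y => ricciE H y u v - c * H y u v = 0)
    (hev.mono fun z hz hzs => (key z hzs).1 hz u v)

end Ricci

section Continuation

variable {N : Type*} [TopologicalSpace N] [ChartedSpace R3 N] [IsManifold (𝓡 3) ω N]
  {NC : Type*} [TopologicalSpace NC] [ChartedSpace C3 NC] [IsManifold 𝓘(ℂ, C3) ω NC]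
  {ι : N → NC} {h : AnalyticMetric N}
  {X : VField ((𝓡 3).prod 𝓘(ℝ, ℝ)) (N × ℝ)} {W : Set (NC × ℂ)} {U : Set N} {UC : Set NC}
  {XC : VField (𝓘(ℂ, C3).prod 𝓘(ℂ, ℂ)) (NC × ℂ)} {hC : BilinField 𝓘(ℂ, C3) NC} {r : ℝ}

/-- The expression in a chart of the contour integral of the complexified Lie derivative. -/
noncomputable def contourInChart (hC : BilinField 𝓘(ℂ, C3) NC)
    (XC : VField (𝓘(ℂ, C3).prod 𝓘(ℂ, ℂ)) (NC × ℂ)) (r : ℝ) (k : ℕ) (p₀ : NC) :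
    C3 → C3 →L[ℂ] C3 →L[ℂ] ℂ :=
  lieDerivE (vfieldInChart 𝓘(ℂ, C3) (contourField XC r k) p₀) (bilinInChart 𝓘(ℂ, C3) hC p₀)

lemma contourForm_eq_zero_iff (hUC : IsOpen UC) (hXC : IsVFieldComplexification ι X W XC)
    (hhC : IsMetricComplexification ι h UC hC) (hr : 0 ≤ r)
    (hW : UC ×ˢ Metric.sphere (0 : ℂ) r ⊆ W) {p₀ p : NC} (hp : p ∈ UC)
    (hps : p ∈ (extChartAt 𝓘(ℂ, C3) p₀).source) (k : ℕ) :
    contourForm hC XC r k p = 0 ↔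
      contourInChart hC XC r k p₀ (extChartAt 𝓘(ℂ, C3) p₀ p) = 0 := by
  have hpp := mem_extChartAt_source (I := 𝓘(ℂ, C3)) p
  have hhol : ∀ᶠ q in 𝓝 p, IsHolomorphicOver XC r q :=
    (hUC.eventually_mem hp).mono fun q hq => isHolomorphicOver hXC hW hq
  have hd : ∀ {p₀ : NC}, p ∈ (extChartAt 𝓘(ℂ, C3) p₀).source → DifferentiableAt ℂ
      (bilinInChart 𝓘(ℂ, C3) hC p₀) (extChartAt 𝓘(ℂ, C3) p₀ p) := fun hs =>
    (contDiffAt_complexMetric hUC hhC hs hp).differentiableAt (by simp)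
  have hY : ∀ {p₀ : NC}, p ∈ (extChartAt 𝓘(ℂ, C3) p₀).source → DifferentiableAt ℂ
      (vfieldInChart 𝓘(ℂ, C3) (contourField XC r k) p₀) (extChartAt 𝓘(ℂ, C3) p₀ p) := fun hs =>
    (contDiffAt_contourField hr hs hhol k).differentiableAt (by simp)
  have h1 : ∀ u v : TangentSpace 𝓘(ℂ, C3) p, contourForm hC XC r k p u v
      = contourInChart hC XC r k p₀ (extChartAt 𝓘(ℂ, C3) p₀ p)
        (chartReading 𝓘(ℂ, C3) p₀ p u) (chartReading 𝓘(ℂ, C3) p₀ p v) := fun u v => by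
    have h2 := lieDeriv_eq_chart 𝓘(ℂ, C3) hps (hY hpp) (hY hps) (hd hpp) (hd hps) u v
    rw [lieDeriv_apply] at h2
    rw [contourForm_eq_lieDeriv hr hhol (hd hpp)]
    exact h2
  constructor
  · intro h0
    refine ContinuousLinearMap.ext fun u => ContinuousLinearMap.ext fun v => ?_
    have h2 := h1 (chartReadingSymm 𝓘(ℂ, C3) p₀ p u) (chartReadingSymm 𝓘(ℂ, C3) p₀ p v)
    rw [chartReading_symm 𝓘(ℂ, C3) hps, chartReading_symm 𝓘(ℂ, C3) hps, h0] at h2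
    exact h2.symm
  · intro h0
    refine ContinuousLinearMap.ext fun u => ContinuousLinearMap.ext fun v => ?_
    refine (h1 u v).trans ?_
    rw [h0]
    rfl

lemma contDiffAt_contourInChart (hUC : IsOpen UC) (hXC : IsVFieldComplexification ι X W XC)
    (hhC : IsMetricComplexification ι h UC hC) (hr : 0 ≤ r)
    (hW : UC ×ˢ Metric.sphere (0 : ℂ) r ⊆ W) {p₀ p : NC} (hp : p ∈ UC)
    (hps : p ∈ (extChartAt 𝓘(ℂ, C3) p₀).source) (k : ℕ) :
    ContDiffAt ℂ ∞ (contourInChart hC XC r k p₀) (extChartAt 𝓘(ℂ, C3) p₀ p) := by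
  have hhol : ∀ᶠ q in 𝓝 p, IsHolomorphicOver XC r q :=
    (hUC.eventually_mem hp).mono fun q hq => isHolomorphicOver hXC hW hq
  have hT : ContDiffAt ℂ ∞ (bilinInChart 𝓘(ℂ, C3) hC p₀) (extChartAt 𝓘(ℂ, C3) p₀ p) :=
    (contDiffAt_complexMetric hUC hhC hps hp).of_le le_top
  have hY := contDiffAt_contourField hr hps hhol k
  have hc : ∀ u : C3, ContDiffAt ℂ ∞ (fun _ : C3 => u) (extChartAt 𝓘(ℂ, C3) p₀ p) :=
    fun u => contDiffAt_const
  refine contDiffAt_clm_of_apply fun u => contDiffAt_clm_of_apply fun v => ?_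
  exact (((((hT.fderiv_right (m := ∞) (by simp)).clm_apply hY).clm_apply (hc u)).clm_apply
    (hc v)).add ((hT.clm_apply ((hY.fderiv_right (m := ∞) (by simp)).clm_apply (hc u))).clm_apply
    (hc v))).add ((hT.clm_apply (hc u)).clm_apply
    ((hY.fderiv_right (m := ∞) (by simp)).clm_apply (hc v)))

/-- A moment of the complexified Lie derivative which vanishes on `U` vanishes on its complex
neighbourhood. -/
theorem contourForm_eq_zero_of_real (hι : IsComplexification ι)
    (hXC : IsVFieldComplexification ι X W XC) (hU : IsOpen U)
    (hUC : IsComplexNeighbourhood ι U UC) (hhC : IsMetricComplexification ι h UC hC) (hr : 0 ≤ r)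
    (hW : UC ×ˢ Metric.sphere (0 : ℂ) r ⊆ W) (k : ℕ)
    (h0 : ∀ x ∈ U, contourForm hC XC r k (ι x) = 0) : ∀ p ∈ UC, contourForm hC XC r k p = 0 := by
  have hιU : ∀ x ∈ U, ι x ∈ UC := fun x hx => hUC.image_subset ⟨x, hx, rfl⟩
  -- balls in charts
  have hball : ∀ p₀ ∈ UC, ∃ B : Set C3, Convex ℝ B ∧ IsOpen B ∧ extChartAt 𝓘(ℂ, C3) p₀ p₀ ∈ B ∧
      B ⊆ (extChartAt 𝓘(ℂ, C3) p₀).target ∧ ContDiffOn ℂ ∞ (contourInChart hC XC r k p₀) B ∧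
      ∀ z ∈ B, (extChartAt 𝓘(ℂ, C3) p₀).symm z ∈ UC := by
    intro p₀ hp₀
    have h1 : ∀ᶠ z in 𝓝 (extChartAt 𝓘(ℂ, C3) p₀ p₀), z ∈ (extChartAt 𝓘(ℂ, C3) p₀).target ∧
        (extChartAt 𝓘(ℂ, C3) p₀).symm z ∈ UC := by
      refine ((isOpen_extChartAt_target p₀).eventually_mem (mem_extChartAt_target p₀)).and ?_
      refine (continuousAt_extChartAt_symm p₀).eventually (hUC.isOpen.mem_nhds ?_)
      rwa [extChartAt_to_inv]
    obtain ⟨ε, hε, hB⟩ := Metric.mem_nhds_iff.1 h1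
    refine ⟨_, convex_ball _ _, Metric.isOpen_ball, Metric.mem_ball_self hε, fun z hz => (hB hz).1,
      fun z hz => ?_, fun z hz => (hB hz).2⟩
    have h2 := contDiffAt_contourInChart hUC.isOpen hXC hhC hr hW (hB hz).2
      ((extChartAt 𝓘(ℂ, C3) p₀).map_target (hB hz).1) k
    rw [(extChartAt 𝓘(ℂ, C3) p₀).right_inv (hB hz).1] at h2
    exact h2.contDiffWithinAt
  -- near the real points
  have hnear : ∀ x ∈ U, ∀ᶠ q in 𝓝 (ι x), contourForm hC XC r k q = 0 := by
    intro x hx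
    obtain ⟨B, hBc, hBo, hxB, hBt, hBs, hBU⟩ := hball (ι x) (hιU x hx)
    have hJ := inclusionInCharts_self ι x
    have hιc := hι.analytic.continuous
    have hz := eqOn_zero_of_totally_real (φ := inclusionInCharts ι x)
      (y₀ := extChartAt (𝓡 3) x x) (T := contourInChart hC XC r k (ι x))
      (eventually_inclusionInCharts hι x (.of_forall fun z hz hz' =>
        (contDiffAt_inclusionInCharts hι hz hz').differentiableAt (by simp)))
      (eventually_inclusionInCharts hι x (.of_forall fun z hz hz' =>
        inclusionInCharts_totally_real hι hz hz')) hBc hBo hBs (by rwa [hJ])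
      (eventually_inclusionInCharts hι x (by
        filter_upwards [hU.eventually_mem hx] with z hzU hz hz'
        rw [inclusionInCharts_apply ι hz,
          ← contourForm_eq_zero_iff hUC.isOpen hXC hhC hr hW (hιU z hzU) hz']
        exact h0 z hzU))
    filter_upwards [hUC.isOpen.mem_nhds (hιU x hx), extChartAt_source_mem_nhds (I := 𝓘(ℂ, C3)) (ι x),
      (continuousAt_extChartAt (I := 𝓘(ℂ, C3)) (ι x)).preimage_mem_nhds (hBo.mem_nhds hxB)]
      with q h1 h2 h3
    exact (contourForm_eq_zero_iff hUC.isOpen hXC hhC hr hW h1 h2 k).2 (hz _ h3)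
  intro p hp
  refine forall_of_preconnected (C := connectedComponentIn UC p) isPreconnected_connectedComponentIn
    (P := fun p => contourForm hC XC r k p = 0) (fun p₀ hp₀ => ?_) ?_ p
    (mem_connectedComponentIn hp)
  · have hp₀U := connectedComponentIn_subset UC p hp₀
    obtain ⟨B, hBc, hBo, hxB, hBt, hBs, hBU⟩ := hball p₀ hp₀U
    refine ⟨UC ∩ ((extChartAt 𝓘(ℂ, C3) p₀).source ∩ extChartAt 𝓘(ℂ, C3) p₀ ⁻¹' B),
      inter_mem (hUC.isOpen.mem_nhds hp₀U) (inter_mem (extChartAt_source_mem_nhds p₀)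
        ((continuousAt_extChartAt p₀).preimage_mem_nhds (hBo.mem_nhds hxB))), ?_⟩
    rintro ⟨q, ⟨hqU, hqs, hqB⟩, hq⟩ z ⟨hzU, hzs, hzB⟩
    rw [contourForm_eq_zero_iff hUC.isOpen hXC hhC hr hW hzU hzs]
    refine eqOn_zero_of_eventually hBc hBo (hBs.differentiableOn (by simp)) hqB ?_ _ hzB
    refine eventually_extChartAt 𝓘(ℂ, C3) hqs
      (P := fun y => contourInChart hC XC r k p₀ y = 0) ?_
    filter_upwards [hq, hUC.isOpen.mem_nhds hqU] with w h1 h2 h3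
    exact (contourForm_eq_zero_iff hUC.isOpen hXC hhC hr hW h2 h3 k).1 h1
  · obtain ⟨_, hq, x, hx, rfl⟩ := hUC.component_meets p hp
    exact ⟨ι x, hq, hnear x hx⟩

end Continuation

end BeltramiSoliton

theorem theorem5p1
    {N : Type*} [TopologicalSpace N] [ChartedSpace BeltramiSoliton.R3 N] [IsManifold (𝓡 3) ω N]
    [ConnectedSpace N]
    (h : BeltramiSoliton.AnalyticMetric N) (o : BeltramiSoliton.ManifoldOrientation N)
    (A : BeltramiSoliton.OneForm (𝓡 3) N) (hA : BeltramiSoliton.IsBeltramiField h o A)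
    (hA0 : ∀ x : N, A x ≠ 0)
    -- a real-analytic soliton flow on `M = N × (0, ∞)`
    (X : BeltramiSoliton.VField ((𝓡 3).prod 𝓘(ℝ, ℝ)) (N × ℝ))
    (hX : ContMDiffOn ((𝓡 3).prod 𝓘(ℝ, ℝ)) ((𝓡 3).prod 𝓘(ℝ, ℝ)).tangent ω
      (fun p => (⟨p, X p⟩ : TangentBundle ((𝓡 3).prod 𝓘(ℝ, ℝ)) (N × ℝ)))
      (BeltramiSoliton.totalSpace N))
    (hsol : BeltramiSoliton.IsSolitonFlowOn ((𝓡 3).prod 𝓘(ℝ, ℝ))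
      (BeltramiSoliton.beltramiMetric h A) X (BeltramiSoliton.totalSpace N))
    -- a complexification of `N`, and a complexification of the flow, on `W`
    {NC : Type*} [TopologicalSpace NC] [ChartedSpace BeltramiSoliton.C3 NC]
    [IsManifold 𝓘(ℂ, BeltramiSoliton.C3) ω NC]
    (ι : N → NC) (hι : BeltramiSoliton.IsComplexification ι)
    (W : Set (NC × ℂ))
    (XC : BeltramiSoliton.VField (𝓘(ℂ, BeltramiSoliton.C3).prod 𝓘(ℂ, ℂ)) (NC × ℂ))
    (hXC : BeltramiSoliton.IsVFieldComplexification ι X W XC)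
    -- `U × γ ⊆ W`, with `γ` the circle `|ρ| = r`; `UC` is a complexification of `U`
    (U : Set N) (hU : IsOpen U) (hUne : U.Nonempty) (r : ℝ) (hr : 0 < r)
    (UC : Set NC) (hUC : BeltramiSoliton.IsComplexNeighbourhood ι U UC)
    (hW : UC ×ˢ Metric.sphere (0 : ℂ) r ⊆ W)
    (hC : BeltramiSoliton.BilinField 𝓘(ℂ, BeltramiSoliton.C3) NC)
    (hhC : BeltramiSoliton.IsMetricComplexification ι h UC hC) :
    (BeltramiSoliton.IsEinsteinOn ((𝓡 3).prod 𝓘(ℝ, ℝ)) (BeltramiSoliton.beltramiMetric h A)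
        (BeltramiSoliton.totalSpace N) ↔
      ∀ p ∈ UC, BeltramiSoliton.contourForm hC XC r 1 p = 0) ∧
    ((∃ j : ℕ, 1 ≤ j ∧ ∀ p ∈ UC, BeltramiSoliton.traceFreePart (hC p)
        (BeltramiSoliton.contourForm hC XC r (2 * j + 1) p) = 0) →
      BeltramiSoliton.IsEinsteinOn ((𝓡 3).prod 𝓘(ℝ, ℝ)) (BeltramiSoliton.beltramiMetric h A)
          (BeltramiSoliton.totalSpace N) ∧
        ∀ p ∈ UC, BeltramiSoliton.contourForm hC XC r 1 p = 0) := by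
  obtain ⟨a, ha⟩ := hsol
  have hUUC : ∀ x ∈ U, ι x ∈ UC := fun x hx => hUC.image_subset ⟨x, hx, rfl⟩
  have hiff := fun (x : N) (hx : ι x ∈ UC) =>
    BeltramiSoliton.contourForm_one_eq_zero_iff hA hι hX ha hXC hUC.isOpen hhC hr hW hx
  have hreal : (∀ x ∈ U, BeltramiSoliton.contourForm hC XC r 1 (ι x) = 0) →
      BeltramiSoliton.IsEinsteinOn ((𝓡 3).prod 𝓘(ℝ, ℝ)) (BeltramiSoliton.beltramiMetric h A)
        (BeltramiSoliton.totalSpace N) := by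
    intro h0
    obtain ⟨x₁, hx₁⟩ := hUne
    exact (BeltramiSoliton.isEinsteinOn_beltramiMetric_iff hA).2
      (BeltramiSoliton.ricci_eq_of_eventually h 2 (x₁ := x₁)
        ((hU.eventually_mem hx₁).mono fun x hx => (hiff x (hUUC x hx)).1 (h0 x hx)))
  have hcont : BeltramiSoliton.IsEinsteinOn ((𝓡 3).prod 𝓘(ℝ, ℝ))
      (BeltramiSoliton.beltramiMetric h A) (BeltramiSoliton.totalSpace N) →
      ∀ p ∈ UC, BeltramiSoliton.contourForm hC XC r 1 p = 0 := fun hE =>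
    BeltramiSoliton.contourForm_eq_zero_of_real hι hXC hU hUC hhC hr.le hW 1 fun x hx =>
      (hiff x (hUUC x hx)).2 ((BeltramiSoliton.isEinsteinOn_beltramiMetric_iff hA).1 hE x)
  refine ⟨⟨hcont, fun h0 => hreal fun x hx => h0 _ (hUUC x hx)⟩, ?_⟩
  rintro ⟨j, hj, hT⟩
  have hE := hreal (BeltramiSoliton.contourForm_one_eq_zero_of_traceFreePart hA hA0 hι hX ha hXC hU
    hUC.isOpen hUUC hhC hr hW (j - 1) (2 * j + 1) (by omega) fun x hx => hT _ (hUUC x hx))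
  exact ⟨hE, hcont hE⟩
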